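/- **Setting.** Consider the $U(N)^2\times O(D)$-invariant model of $D$ complex $N\times N$ matrices $X_1,\dots,X_D$ with the five connected quartic interactions $$I_t=\sum_{\mu,\nu}\mathrm{Tr}(X_\mu X_\nu^\dagger X_\mu X_\nu^\dagger),\quad I_1=\sum_{\mu,\nu}\mathrm{Tr}(X_\mu X_\mu^\dagger X_\nu X_\nu^\dagger),\quad I_2=\sum_{\mu,\nu}\mathrm{Tr}(X_\mu X_\nu^\dagger X_\nu X_\mu^\dagger),$$ $$I_{3b}=\sum_{\mu,\nu}\mathrm{Tr}(X_\mu X_\nu^\dagger)\mathrm{Tr}(X_\nu X_\mu^\dagger),\quad I_{3nb}=\sum_{\mu,\nu}\mathrm{Tr}(X_\mu X_\nu^\dagger)\mathrm{Tr}(X_\mu X_\nu^\dagger).$$ Each interaction is a bubble: a properly $3$-edge-coloured graph on four vertices, white for $X$ and black for $X^\dagger$, with an edge of colour $1$, $2$ or $3$ for each contraction of a left matrix index, right matrix index or vector index. $I_t$ is the tetrahedral bubble, $I_1, I_2$ are the pillows of colours $1,2$, and $I_{3b}, I_{3nb}$ are the bipartite and non-bipartite pillows of colour $3$. (The pillow of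 colour $i$ is disconnected by removing its edges of colour $i$; its two *sides* are the resulting components.) A *$2$-point graph* $\mathcal G$ is a connected graph obtained from finitely many bubbles by joining white vertices to black vertices by edges of colour $0$, so that every vertex is incident to one edge of colour $0$ except for one white and one black vertex, which carry two external half-edges; the bare edge of colour $0$ with no bubble is included. Its closure is obtained by joining the two external half-edges. Let $n_t,n_1,n_2,n_{3b},n_{3nb}$ be the numbers of bubbles of each kind, $E=2(n_t+n_1+n_2+n_{3b}+n_{3nb})$, and let $F_c$ be the number of cycles of alternating colours $0,c$ in the closure (each equal to $1$ for the bare edge). The *genus* $h$ and the *grade* $l$ of $\mathcal G$ are given by $$2-2h=F_1+F_2-E+n_t+n_1+n_2,\qquad 1+h-\tfrac l2=F_3-E+\tfrac32 n_t+n_1+n_2+2(n_{3b}+n_{3nb}).$$ *Melons.* An elementary melon is a $2$-point subgraph which is either a pair of tetrahedral bubbles joined by three edges of colour $0$ in such a way that every two of them belong to a common cycle of colours $0,c$ with only these two edges of colour $0$ (type I), or a pillow with an edge of colour $0$ joining the two vertices on one side (type II). Melonic $2$-point graphs are those obtained from the bare edge by repeatedly inserting elementary melons on edges of colour $0$. *Dipoles.*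 A dipole of colour $i$ is a $4$-point subgraph that is either a pillow of colour $i$, or a pair of distinct tetrahedral bubbles joined by two edges of colour $0$ that form a cycle of colours $0,i$. Two external legs are on the same side if they come from cutting the same edge in the closure of an elementary melon: for a pillow this means the same side of the pillow; for two tetrahedra, that reconnecting them gives a third parallel edge. A dipole is isolated if it shares no bubble with another dipole. *Chains.* A chain is an isolated dipole, or a sequence of at least two dipoles without common bubbles, in which one side of each dipole is joined to a side of the next one by two edges of colour $0$, each dipole using its two different sides. It is maximal if it is not contained in a longer chain. A chain is of colour $i$ if all its dipoles have colour $i$, and broken otherwise. *Schemes.* The scheme of $\mathcal G$ is obtained by first replacing all melonic $2$-point subgraphs by edges of colour $0$, then replacing every maximal chain by a four-legged chain-vertex which records the type of the chain (of colour $1$, $2$, $3$, or broken), the two sides, which legs are opposite to each other along the chain, and the black or white colours of its external legs. Schemes are considered up to isomorphism preserving all of this structure, including the two external half-edges. For $h,l\in\mathbb N$, let $\mathbb S_{h,l}$ be the set of the schemes of all $2$-point graphs of genus $h$ and grade $l$. **Theorem.** For all $h,l\in\mathbb N$, the set $\mathbb S_{h,l}$ is finite. -/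

import Mathlib

/-! ## Bubbles, Feynman graphs, genus and grade -/

namespace QuarticMultiMatrix

/-- The four half-edges of colour `0` carried by a quartic bubble or by a chain-vertex (for a bubble
there is one at each of its four vertices), as the points `(side, level)` of `(ℤ/2)²`. -/
abbrev Leg : Type := ZMod 2 × ZMod 2

/-- The five connected quartic interactions
`I_t = ∑ Tr (X_μ X†_ν X_μ X†_ν)`, `I_1 = ∑ Tr (X_μ X†_μ X_ν X†_ν)`,
`I_2 = ∑ Tr (X_μ X†_ν X_ν X†_μ)`, `I_3b = ∑ Tr (X_μ X†_ν) Tr (X_ν X†_μ)`,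
`I_3nb = ∑ Tr (X_μ X†_ν) Tr (X_μ X†_ν)`. -/
inductive Interaction : Type
  | tetra
  | pillow1
  | pillow2
  | pillow3b
  | pillow3nb
  deriving DecidableEq

namespace Interaction

/-- The colour of a pillow, i.e. the one whose edges disconnect it when they are removed
(the colours `1, 2, 3` are `0, 1, 2 : Fin 3`); `none` for the tetrahedral bubble. -/
def pillowColour : Interaction → Option (Fin 3)
  | tetra => none
  | pillow1 => some 0
  | pillow2 => some 1
  | pillow3b => some 2
  | pillow3nb => some 2

/-- The edge of colour `c` at the vertex `a` of the bubble `k` joins `a` to `a + k.edge c`.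
In the tetrahedral bubble the three edges at a vertex lead to three distinct vertices; in the pillow
of colour `i` the edge of colour `i` goes to the other side, and the two edges of the other colours
both join the two vertices of the same side. -/
def edge (k : Interaction) (c : Fin 3) : Leg :=
  match k.pillowColour with
  | none => ![(1, 0), (0, 1), (1, 1)] c
  | some i => if c = i then (1, 0) else (0, 1)

/-- The vertex colouring of a bubble (`0` is white, a copy of `X`; `1` is black, a copy of `X†`).
Edges of colours `1` and `2` join a white to a black vertex. The edges of colour `3` of
`pillow3nb` join vertices of the same colour, those of `pillow3b` join opposite ones. -/
def colour (k : Interaction) (a : Leg) : ZMod 2 :=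
  if k = pillow3nb then a.2 else a.1 + a.2

end Interaction

/-- The half-edges of colour `0` of a diagram with `n` nodes: the legs of the nodes and the two
external ends. -/
abbrev Half (n : ℕ) : Type := (Fin n × Leg) ⊕ ZMod 2

/-- The node that carries a half-edge; the two external ends form the root (`none`). -/
def Half.node {n : ℕ} : Half n → Option (Fin n)
  | Sum.inl p => some p.1
  | Sum.inr _ => none

/-- The white/black colouring of the half-edges of a diagram. The external end `b` has colour `b`,
so that it is joined to a leg of the opposite colour (or to the other external end). -/
def halfColour {K : Type} (col : K → Leg → ZMod 2) {n : ℕ} (kind : Fin n → K) : Half n → ZMod 2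
  | Sum.inl p => col (kind p.1) p.2
  | Sum.inr b => b

/-- A connected `2`-point diagram whose nodes are four-legged and taken from a collection `K` of
kinds, the legs of a node of kind `k` being coloured by `col k`: a finite collection of nodes,
together with a Wick contraction `pair` which joins by edges of colour `0` every white half-edge to
a black one. One leg of each colour is joined to an external end (or, for the bare propagator, which
has no node at all, the two external ends are joined together). -/
structure Diagram {K : Type} (col : K → Leg → ZMod 2) : Type where
  n : ℕ
  kind : Fin n → K
  pair : Half n → Half n
  pair_pair : ∀ x, pair (pair x) = x
  colour_pair : ∀ x, halfColour col kind (pair x) ≠ halfColour col kind x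
  connected : ∀ x y, Relation.EqvGen (fun x y : Half n => y = pair x ∨ x.node = y.node) x y

/-- The `2`-point Feynman graphs of the quartic `U(N)² × O(D)` multi-matrix model. -/
abbrev Graph : Type := Diagram Interaction.colour

namespace Graph

variable (G : Graph)

/-- Following the edge of colour `c` at a vertex of the closure of `G` (in the closure, the two
external ends are joined, and every face passes from one to the other). -/
def turn (c : Fin 3) : Half G.n → Half G.n
  | Sum.inl p => Sum.inl (p.1, p.2 + (G.kind p.1).edge c)
  | Sum.inr b => Sum.inr (b + 1)

/-- Two half-edges lie on the same cycle of alternating colours `0` and `c`. -/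
def faceSetoid (c : Fin 3) : Setoid (Half G.n) :=
  Relation.EqvGen.setoid fun x y => y = G.pair x ∨ y = G.turn c x

/-- The number of faces of colour `c` of the closure of `G`. -/
noncomputable def numFaces (c : Fin 3) : ℕ := Nat.card (Quotient (G.faceSetoid c))

/-- The number of interactions of a given kind. -/
def count (k : Interaction) : ℕ := (Finset.univ.filter fun v => G.kind v = k).card

/-- The number of edges of colour `0` of the closure of `G`. -/
def numEdges : ℕ := 2 * G.n

open Interaction in
/-- The genus `h`, where `2 - 2 h = F₁ + F₂ - E + n_t + n₁ + n₂`. -/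
noncomputable def genus : ℚ :=
  1 - ((G.numFaces 0 : ℚ) + G.numFaces 1 - G.numEdges
    + G.count tetra + G.count pillow1 + G.count pillow2) / 2

open Interaction in
/-- The grade `l`, where
`1 + h - l / 2 = F₃ - E + (3 / 2) n_t + n₁ + n₂ + 2 (n_3b + n_3nb)`. -/
noncomputable def grade : ℚ :=
  2 * (1 + G.genus - ((G.numFaces 2 : ℚ) - G.numEdges + 3 / 2 * G.count tetra
    + G.count pillow1 + G.count pillow2 + 2 * (G.count pillow3b + G.count pillow3nb)))

/-! ## Melons -/

/-- The legs `p` and `q` are the two external legs of an elementary melon of `G`.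
Type I: two tetrahedral bubbles joined by three parallel edges of colour `0`.
Type II: a pillow whose two vertices on one side are joined by an edge of colour `0`. -/
def IsElementaryMelon (p q : Fin G.n × Leg) : Prop :=
  (p.1 ≠ q.1 ∧ G.kind p.1 = .tetra ∧ G.kind q.1 = .tetra ∧
    ∀ a, a ≠ p.2 → G.pair (Sum.inl (p.1, a)) = Sum.inl (q.1, a + (p.2 + q.2))) ∨
  (p.1 = q.1 ∧ G.kind p.1 ≠ .tetra ∧ q.2 = p.2 + (0, 1) ∧
    G.pair (Sum.inl (p.1, p.2 + (1, 0))) = Sum.inl (p.1, p.2 + (1, 1)))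

/-- The map on half-edges induced by a map on nodes. -/
def mapHalf {m n : ℕ} (f : Fin m → Fin n) : Half m → Half n
  | Sum.inl p => Sum.inl (f p.1, p.2)
  | Sum.inr b => Sum.inr b

/-- `G` is obtained from `H` by cutting an edge of colour `0` (the one between the half-edges `x`
and `H.pair x`) and inserting an elementary melon there. -/
def MelonInsertion (H G : Graph) : Prop :=
  ∃ (f : Fin H.n ↪ Fin G.n) (x : Half H.n) (p q : Fin G.n × Leg),
    G.IsElementaryMelon p q ∧
    (∀ v, v ∈ Set.range f ↔ v ≠ p.1 ∧ v ≠ q.1) ∧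
    (∀ v, G.kind (f v) = H.kind v) ∧
    G.pair (mapHalf f x) = Sum.inl p ∧
    G.pair (mapHalf f (H.pair x)) = Sum.inl q ∧
    ∀ y, y ≠ x → y ≠ H.pair x → G.pair (mapHalf f y) = mapHalf f (H.pair y)

/-- `C` is obtained from `G` by removing all melonic `2`-point subgraphs: elementary melons are
removed one after the other, until none is left. -/
def IsCore (C G : Graph) : Prop :=
  Relation.ReflTransGen MelonInsertion C G ∧ ∀ p q, ¬ C.IsElementaryMelon p q

/-! ## Dipoles and chains -/

/-- `d` gives the four external legs of a dipole of colour `i` of `G`: the legs `d (s, 0)` and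
`d (s, 1)` are those on the side `s` (they come from cutting an edge of the elementary melon), and
the face of colour `i` which enters at the leg `d (0, t)` leaves at the leg `d (1, t)`.
Type II: a pillow of colour `i`.
Type I: two distinct tetrahedral bubbles, joined by two edges of colour `0` which form a face of
degree two and colour `i`. -/
def IsDipole (i : Fin 3) (d : Leg → Fin G.n × Leg) : Prop :=
  (∃ (v : Fin G.n) (t : Leg), (G.kind v).pillowColour = some i ∧ ∀ a, d a = (v, a + t)) ∨
  (∃ (v w : Fin G.n) (a b : Leg), v ≠ w ∧ G.kind v = .tetra ∧ G.kind w = .tetra ∧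
    d (0, 0) = (v, a) ∧ d (1, 0) = (v, a + Interaction.tetra.edge i) ∧
    d (0, 1) = (w, b) ∧ d (1, 1) = (w, b + Interaction.tetra.edge i) ∧
    ∀ c, c ≠ a → c ≠ a + Interaction.tetra.edge i →
      G.pair (Sum.inl (v, c)) = Sum.inl (w, c + (a + b)))

/-- The dipole `d` is isolated: it shares no bubble with any other dipole. -/
def IsIsolated (d : Leg → Fin G.n × Leg) : Prop :=
  ∀ (j : Fin 3) (d' : Leg → Fin G.n × Leg), G.IsDipole j d' →
    (∃ a b, (d a).1 = (d' b).1) → Set.range d' = Set.range d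

/-- Chains, as lists of dipoles (with their colours): an isolated dipole, or at least two dipoles
without common bubbles, side `1` of each being matched to side `0` of the next. -/
def IsChain (l : List (Fin 3 × (Leg → Fin G.n × Leg))) : Prop :=
  l ≠ [] ∧ (∀ x ∈ l, G.IsDipole x.1 x.2) ∧ (∀ x, l = [x] → G.IsIsolated x.2) ∧
  l.Pairwise (fun x y => ∀ a b, (x.2 a).1 ≠ (y.2 b).1) ∧
  l.IsChain (fun x y => ∀ t, G.pair (Sum.inl (x.2 (1, t))) = Sum.inl (y.2 (0, t)))

/-- A chain is maximal if it is not contained in a longer one. -/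
def IsMaximalChain (l : List (Fin 3 × (Leg → Fin G.n × Leg))) : Prop :=
  G.IsChain l ∧ ∀ l', G.IsChain l' → l <:+: l' → l' = l

/-- The bubble `v` belongs to a chain. -/
def InChain (v : Fin G.n) : Prop :=
  ∃ l, G.IsChain l ∧ ∃ x ∈ l, ∃ a, (x.2 a).1 = v

/-- `d` gives the four external legs of the chain `l`: side `0` is that of the first dipole,
side `1` that of the last one. -/
def IsChainEnds (l : List (Fin 3 × (Leg → Fin G.n × Leg))) (d : Leg → Fin G.n × Leg) : Prop :=
  (∃ x ∈ l.head?, ∀ t, d (0, t) = x.2 (0, t)) ∧ (∃ x ∈ l.getLast?, ∀ t, d (1, t) = x.2 (1, t))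

end Graph

/-! ## Schemes -/

/-- The nodes of a scheme: bubbles, and chain-vertices. `chain (some i) ε` stands for a chain of
colour `i` and `chain none ε` for a broken chain; `ε` records the colouring of its boundary (for
`ε = 1` two opposite external legs have opposite colours, for `ε = 0` the same colour). -/
inductive SchemeKind : Type
  | bubble (k : Interaction)
  | chain (c : Option (Fin 3)) (ε : ZMod 2)

/-- The colouring of the legs of a node of a scheme. -/
def SchemeKind.colour : SchemeKind → Leg → ZMod 2
  | .bubble k, a => k.colour a
  | .chain _ ε, a => ε * a.1 + a.2

/-- Diagrams made of bubbles and chain-vertices. -/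
abbrev SchemeDiagram : Type := Diagram SchemeKind.colour

/-- `S` is obtained from the graph `C` by replacing every maximal chain with a chain-vertex of the
same type. The embedding `φ` sends the half-edges of `S` to those of `C` which are not internal to a
chain. -/
def IsChainReduction (S : SchemeDiagram) (C : Graph) : Prop :=
  ∃ φ : Half S.n ↪ Half C.n,
    (∀ b, φ (Sum.inr b) = Sum.inr b) ∧
    (∀ x, φ (S.pair x) = C.pair (φ x)) ∧
    (∀ x, halfColour Interaction.colour C.kind (φ x) =
      halfColour SchemeKind.colour S.kind x) ∧
    (∀ v k, S.kind v = .bubble k →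
      ∃ u, C.kind u = k ∧ ¬ C.InChain u ∧ ∀ a, φ (Sum.inl (v, a)) = Sum.inl (u, a)) ∧
    (∀ v c ε, S.kind v = .chain c ε →
      ∃ l d, C.IsMaximalChain l ∧ (∀ i, c = some i ↔ ∀ x ∈ l, x.1 = i) ∧ C.IsChainEnds l d ∧
        ∀ a, φ (Sum.inl (v, a)) = Sum.inl (d a)) ∧
    (∀ u, ¬ C.InChain u → ∀ a, Sum.inl (u, a) ∈ Set.range φ) ∧
    (∀ l d, C.IsMaximalChain l → C.IsChainEnds l d → ∀ a, Sum.inl (d a) ∈ Set.range φ)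

/-- `S` is the scheme of the `2`-point graph `G`: first all melonic `2`-point subgraphs are removed,
then all maximal chains are replaced with chain-vertices of the same type. -/
def IsSchemeOf (S : SchemeDiagram) (G : Graph) : Prop :=
  ∃ C : Graph, C.IsCore G ∧ IsChainReduction S C

namespace Diagram

variable {K : Type} {col : K → Leg → ZMod 2}

/-- The map on half-edges which sends the node `v` to `e v` and translates its legs by `t v`. The
translations of `(ℤ/2)²` are the symmetries of every kind of bubble and chain-vertex: for a bubble
they are the permutations of its vertices that preserve its edges of each colour, for a chain-vertex
those that preserve the pairs of legs on the same side, and the pairs of opposite legs. -/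
def isoMap {m n : ℕ} (e : Fin m → Fin n) (t : Fin m → Leg) : Half m → Half n
  | Sum.inl p => Sum.inl (e p.1, p.2 + t p.1)
  | Sum.inr b => Sum.inr b

/-- Isomorphism of diagrams: everything is preserved, the external ends included. -/
def Iso (S T : Diagram col) : Prop :=
  ∃ (e : Fin S.n ≃ Fin T.n) (t : Fin S.n → Leg),
    (∀ v, T.kind (e v) = S.kind v) ∧
    (∀ x, halfColour col T.kind (isoMap e t x) = halfColour col S.kind x) ∧
    (∀ x, isoMap e t (S.pair x) = T.pair (isoMap e t x))

theorem iso_refl (S : Diagram col) : Iso S S := by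
  have h : ∀ x, isoMap (Equiv.refl (Fin S.n)) (fun _ => 0) x = x := by
    rintro (⟨v, a⟩ | b) <;> simp [isoMap]
  exact ⟨Equiv.refl _, fun _ => 0, fun _ => rfl, fun x => by rw [h], fun x => by rw [h, h]⟩

theorem iso_symm {S T : Diagram col} (h : Iso S T) : Iso T S := by
  obtain ⟨e, t, hk, hc, hp⟩ := h
  have h2 : ∀ x, isoMap e t (isoMap e.symm (fun v => - t (e.symm v)) x) = x := by
    rintro (⟨v, a⟩ | b) <;> simp [isoMap]
  have h1 : ∀ x, isoMap e.symm (fun v => - t (e.symm v)) (isoMap e t x) = x := by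
    rintro (⟨v, a⟩ | b) <;> simp [isoMap]
  refine ⟨e.symm, fun v => - t (e.symm v), fun v => ?_, fun x => ?_, fun x => ?_⟩
  · rw [← hk, e.apply_symm_apply]
  · rw [← hc, h2]
  · rw [← h1 (S.pair _), hp, h2]

theorem iso_trans {S T U : Diagram col} (h : Iso S T) (h' : Iso T U) : Iso S U := by
  obtain ⟨e, t, hk, hc, hp⟩ := h
  obtain ⟨e', t', hk', hc', hp'⟩ := h'
  have h2 : ∀ x, isoMap (e.trans e') (fun v => t v + t' (e v)) x = isoMap e' t' (isoMap e t x) := by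
    rintro (⟨v, a⟩ | b) <;> simp [isoMap, add_assoc]
  refine ⟨e.trans e', fun v => t v + t' (e v), fun v => ?_, fun x => ?_, fun x => ?_⟩
  · rw [Equiv.trans_apply, hk', hk]
  · rw [h2, hc', hc]
  · rw [h2, h2, hp, hp']

/-- Diagrams up to isomorphism. -/
def isoSetoid (col : K → Leg → ZMod 2) : Setoid (Diagram col) :=
  ⟨Iso, iso_refl, iso_symm, iso_trans⟩

end Diagram

/-- The set `𝕊_{h,l}` of schemes (up to isomorphism) of genus `h` and grade `l`, i.e. of the schemes
of the `2`-point graphs of genus `h` and grade `l`. -/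
def schemes (h l : ℕ) : Set (Quotient (Diagram.isoSetoid SchemeKind.colour)) :=
  {s | ∃ (S : SchemeDiagram) (G : Graph), s = Quotient.mk _ S ∧ IsSchemeOf S G ∧
    G.genus = h ∧ G.grade = l}

end QuarticMultiMatrix

/-!
The scheme of a graph has boundedly many nodes, once the genus `h` and the grade `l` are fixed;
finiteness follows, since there are finitely many kinds of nodes.

*Degree.* The combination `2 h + l = 6 + 3 n_t + 4 (n_1 + n_2 + n_3b + n_3nb) - 2 (F_1 + F_2 + F_3)`
(`Graph.doubleDegree`) does not increase when melons are removed (`IsCore.doubleDegree_le`), so it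
suffices to study melon-free graphs `C` of bounded degree.

*Cutting dipoles.* In a maximal family of bubble-disjoint dipoles of `C`, every dipole is cut into
its two sides, each of which becomes a two-valent mark on an edge. What remains is a graph made of
tetrahedral bubbles and marks (`MarkedGraph`), without dipoles. All face counts are dimensions of
spaces of functions with values in `ℤ/2` which are constant along faces. Comparing the variations of
such functions across the dipoles, which are orthogonal to those of the functions constant on
components, shows that the cut gains two units of `2 h + l` for each dipole beyond those needed to
reconnect the components (`sum_numOrbits_add_two_mul_numComponents_le`). Hence the defects
`6 + 3 n - 2 F` of the components add up to a bounded quantity, and so does the excess over `2` of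
their numbers of marks (`card_badComponents_le`).

*Components.* In a connected marked graph, every face gives a word, the set of bubbles which it
visits exactly once. Words of different colours are orthogonal, so that the defect is nonnegative
(`defect_nonneg`). A component of defect zero with a bubble has at least three marks
(`three_le_card_marks`). In general, a dipole-free component with few marks and small defect has
boundedly many bubbles (`card_le_bubbleBound`): otherwise there are two pairs of bubbles, far away
from each other, each pair made of two crossings of the same two faces of colour `3` with four
bubbles, whose sum is a word of all colours modulo `2` (`exists_lt_card_fiber_sub_mem`); this forces
a dipole (`exists_partner`).

*Chains.* Therefore, outside a bounded set of bubbles, every bubble of `C` lies in a dipole both of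
whose sides are joined to sides of other dipoles (`exists_unlinked`). Such a dipole is determined by
any of its bubbles (`IsDipole.eq_translate`), so it belongs to a chain. A maximal chain ends next to
the bounded set, as it could be extended otherwise (`IsMaximalChain.exists_unlinked`); it cannot
close up into a ring because `C` is connected to its external ends. So the bubbles and the chains of
`C` which become nodes of the scheme are bounded in number (`IsChainReduction.n_le`).
-/

namespace QuarticMultiMatrix
open Module

/-! ### Orbits of two involutions and invariant functions -/

/-- The equivalence relation whose classes are the orbits of the group generated by `p` and `t`
(for involutions `p` and `t`). -/
def orbitSetoid {H : Type} (p t : H → H) : Setoid H :=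
  Relation.EqvGen.setoid fun x y => y = p x ∨ y = t x

/-- The number of orbits of two involutions. -/
noncomputable def numOrbits {H : Type} (p t : H → H) : ℕ := Nat.card (Quotient (orbitSetoid p t))

/-- The `𝔽₂`-valued functions that are invariant under `p` and `t`. -/
def invariants {H : Type} (p t : H → H) : Submodule (ZMod 2) (H → ZMod 2) where
  carrier := {s | (∀ x, s (p x) = s x) ∧ ∀ x, s (t x) = s x}
  add_mem' ha hb := ⟨fun x => by simp [ha.1 x, hb.1 x], fun x => by simp [ha.2 x, hb.2 x]⟩
  zero_mem' := ⟨fun _ => rfl, fun _ => rfl⟩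
  smul_mem' c s hs := ⟨fun x => by simp [hs.1 x], fun x => by simp [hs.2 x]⟩

theorem eq_of_eqvGen {H α : Type*} {r : H → H → Prop} (s : H → α) (h : ∀ x y, r x y → s x = s y)
    {x y : H} (hxy : Relation.EqvGen r x y) : s x = s y := by
  induction hxy with
  | rel x y hr => exact h x y hr
  | refl x => rfl
  | symm x y _ ih => exact ih.symm
  | trans x y z _ _ ih1 ih2 => exact ih1.trans ih2

theorem orbitSetoid_left {H : Type} (p t : H → H) (x : H) : (orbitSetoid p t) x (p x) :=
  Relation.EqvGen.rel _ _ (Or.inl rfl)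

theorem orbitSetoid_right {H : Type} (p t : H → H) (x : H) : (orbitSetoid p t) x (t x) :=
  Relation.EqvGen.rel _ _ (Or.inr rfl)

theorem eq_of_orbitSetoid {H : Type} {α : Type*} {p t : H → H} (s : H → α)
    (hp : ∀ x, s (p x) = s x) (ht : ∀ x, s (t x) = s x) {x y : H} (hxy : (orbitSetoid p t) x y) :
    s x = s y :=
  eq_of_eqvGen s (by rintro x y (rfl | rfl); exacts [(hp x).symm, (ht x).symm]) hxy

/-- Invariant functions are the functions on the set of orbits. -/
def invariantsEquiv {H : Type} (p t : H → H) :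
    invariants p t ≃ₗ[ZMod 2] (Quotient (orbitSetoid p t) → ZMod 2) where
  toFun s := Quotient.lift s.1 fun _ _ h => eq_of_orbitSetoid s.1 s.2.1 s.2.2 h
  map_add' s s' := by ext q; induction q using Quotient.inductionOn; rfl
  map_smul' c s := by ext q; induction q using Quotient.inductionOn; rfl
  invFun g := ⟨fun x => g (Quotient.mk (orbitSetoid p t) x),
    fun x => congrArg g (Quotient.sound ((orbitSetoid p t).symm (orbitSetoid_left p t x))),
    fun x => congrArg g (Quotient.sound ((orbitSetoid p t).symm (orbitSetoid_right p t x)))⟩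
  left_inv s := rfl
  right_inv g := by ext q; induction q using Quotient.inductionOn; rfl

theorem finrank_invariants {H : Type} [Finite H] (p t : H → H) :
    finrank (ZMod 2) (invariants p t) = numOrbits p t := by
  classical
  have := Fintype.ofFinite (Quotient (orbitSetoid p t))
  rw [(invariantsEquiv p t).finrank_eq, Module.finrank_fintype_fun_eq_card, numOrbits,
    Nat.card_eq_fintype_card]

/-- Orthogonal subspaces of `𝔽₂ⱽ` have complementary dimensions at most. -/
theorem finrank_add_finrank_le_of_orthogonal {V : Type} [Fintype V]
    (A B : Submodule (ZMod 2) (V → ZMod 2)) (h : ∀ a ∈ A, ∀ b ∈ B, ∑ v, a v * b v = 0) :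
    finrank (ZMod 2) A + finrank (ZMod 2) B ≤ Fintype.card V := by
  classical
  have h1 : B.map (dotProductEquiv (ZMod 2) V : (V → ZMod 2) →ₗ[ZMod 2] _) ≤ A.dualAnnihilator := by
    rintro _ ⟨b, hb, rfl⟩
    rw [Submodule.mem_dualAnnihilator]
    intro a ha
    rw [← h a ha b hb]
    simp [dotProduct, mul_comm]
  have h2 := Submodule.finrank_mono h1
  rw [LinearEquiv.finrank_map_eq] at h2
  have h3 := Subspace.finrank_add_finrank_dualAnnihilator_eq A
  rw [Module.finrank_fintype_fun_eq_card] at h3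
  omega

/-- Pigeonhole principle modulo a subspace of small codimension. -/
theorem exists_lt_card_fiber_sub_mem {V ι : Type} [Finite V] [DecidableEq ι]
    (W X : Submodule (ZMod 2) (V → ZMod 2)) (hX : X ≤ W) (D K : ℕ)
    (hD : finrank (ZMod 2) W ≤ finrank (ZMod 2) X + D) (s : Finset ι) (z : ι → V → ZMod 2)
    (hz : ∀ i ∈ s, z i ∈ W) (hs : 2 ^ D * K < s.card) :
    ∃ i ∈ s, ∃ u ⊆ s, i ∈ u ∧ K < u.card ∧ ∀ j ∈ u, z i + z j ∈ X := by
  classical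
  set Q := W.map X.mkQ
  have : Finite ((V → ZMod 2) ⧸ X) := Finite.of_surjective X.mkQ X.mkQ_surjective
  have := Fintype.ofFinite Q
  have hcard : Fintype.card Q ≤ 2 ^ D := by
    have h1 : finrank (ZMod 2) Q + finrank (ZMod 2) X = finrank (ZMod 2) W := by
      have := LinearMap.finrank_range_add_finrank_ker (X.mkQ.domRestrict W)
      rw [LinearMap.range_domRestrict, LinearMap.ker_domRestrict, Submodule.ker_mkQ] at this
      rw [← this, (Submodule.comapSubtypeEquivOfLe hX).finrank_eq]
    rw [Module.card_eq_pow_finrank (K := ZMod 2) (V := Q), ZMod.card]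
    exact Nat.pow_le_pow_right (by norm_num) (by omega)
  let f : ι → (V → ZMod 2) ⧸ X := fun i => X.mkQ (z i)
  let t : Finset ((V → ZMod 2) ⧸ X) := (Finset.univ : Finset Q).map ⟨Subtype.val, Subtype.val_injective⟩
  obtain ⟨y, -, hy⟩ := Finset.exists_lt_card_fiber_of_mul_lt_card_of_maps_to (s := s) (t := t)
    (f := f) (n := K) (fun i hi => by
      simp only [t, Finset.mem_map, Finset.mem_univ, true_and]
      exact ⟨⟨f i, ⟨z i, hz i hi, rfl⟩⟩, rfl⟩)
    (by
      have : t.card = Fintype.card Q := by simp [t]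
      rw [this]
      exact lt_of_le_of_lt (Nat.mul_le_mul_right _ hcard) hs)
  obtain ⟨i, hi⟩ := Finset.card_pos.1 (lt_of_le_of_lt (Nat.zero_le _) hy)
  rw [Finset.mem_filter] at hi
  refine ⟨i, hi.1, _, Finset.filter_subset _ _, Finset.mem_filter.2 hi, hy, fun j hj => ?_⟩
  rw [Finset.mem_filter] at hj
  have h2 : X.mkQ (z i) = X.mkQ (z j) := hi.2.trans hj.2.symm
  have h3 := (Submodule.Quotient.eq X).1 h2
  rwa [ZModModule.sub_eq_add] at h3

end QuarticMultiMatrix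

namespace QuarticMultiMatrix
open Module

/-! ### Tetrahedral graphs with marks and their face words -/

/-- The vertex `a` of the tetrahedral bubble is joined to `a + dir c` by its edge of colour `c`. -/
abbrev dir (c : Fin 3) : Leg := Interaction.tetra.edge c

/-- The half-edges of colour `0` of a graph with four-valent nodes `V` and two-valent nodes `M`. -/
abbrev Ends (V M : Type) : Type := (V × Leg) ⊕ (M × ZMod 2)

/-- A closed graph made of tetrahedral bubbles `V`, joined by edges of colour `0` which may carry
two-valent nodes `M`, the marks. The half-edge `(m, b)` at a mark has colour `tint m + b`. -/
structure MarkedGraph (V M : Type) : Type where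
  pair : Ends V M → Ends V M
  pair_pair : ∀ x, pair (pair x) = x
  tint : M → ZMod 2
  colour_pair : ∀ x, Sum.elim (fun p : V × Leg => p.2.1 + p.2.2) (fun q => tint q.1 + q.2) (pair x) ≠
    Sum.elim (fun p : V × Leg => p.2.1 + p.2.2) (fun q => tint q.1 + q.2) x

namespace MarkedGraph

/-- The faces of colour `c` turn along `dir c` at the bubbles and go straight through the marks. -/
def turn {V M : Type} (c : Fin 3) : Ends V M → Ends V M
  | Sum.inl p => Sum.inl (p.1, p.2 + dir c)
  | Sum.inr q => Sum.inr (q.1, q.2 + 1)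

variable {V M : Type} (G : MarkedGraph V M)

/-- The colour of a half-edge. -/
def colour : Ends V M → ZMod 2 :=
  Sum.elim (fun p => p.2.1 + p.2.2) (fun q => G.tint q.1 + q.2)

/-- A graph is connected if a function which is constant along edges and on nodes is constant. -/
def Connected : Prop :=
  ∀ s : Ends V M → ZMod 2, (∀ x, s (G.pair x) = s x) →
    (∀ v a b, s (Sum.inl (v, a)) = s (Sum.inl (v, b))) →
    (∀ m b b', s (Sum.inr (m, b)) = s (Sum.inr (m, b'))) → ∀ x y, s x = s y

/-- The functions on half-edges which are constant along the faces of colour `c`. -/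
abbrev inv (c : Fin 3) : Submodule (ZMod 2) (Ends V M → ZMod 2) := invariants G.pair (turn c)

/-- The number of faces of colour `c`. -/
noncomputable abbrev numFaces (c : Fin 3) : ℕ := numOrbits G.pair (turn c : Ends V M → Ends V M)

theorem zmod_two_add_one_of_ne {a b : ZMod 2} (h : a ≠ b) : a = b + 1 := by
  revert a b; decide

theorem colour_pair_eq (x : Ends V M) : G.colour (G.pair x) = G.colour x + 1 :=
  zmod_two_add_one_of_ne (G.colour_pair x)

theorem pair_ne (x : Ends V M) : G.pair x ≠ x := fun h => by
  have := G.colour_pair x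
  rw [h] at this
  exact this rfl

theorem pair_injective : Function.Injective G.pair :=
  Function.LeftInverse.injective G.pair_pair

theorem dir_ne_zero (c : Fin 3) : dir c ≠ 0 := by revert c; decide

theorem leg_add_add (a b : Leg) : a + b + b = a := by revert a b; decide

theorem turn_turn (c : Fin 3) (x : Ends V M) : turn c (turn c x) = x := by
  rcases x with ⟨v, a⟩ | ⟨m, b⟩
  · simp only [turn, leg_add_add]
  · have : b + 1 + 1 = b := by revert b; decide
    simp [turn, this]

/-- The word of a function `s` which is constant along the faces of colour `i`: its value at the
bubble `v` is `1` if `s` takes different values on the two strands of colour `i` in `v`. -/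
def jump (i : Fin 3) : (Ends V M → ZMod 2) →ₗ[ZMod 2] (V → ZMod 2) where
  toFun s v := s (Sum.inl (v, 0)) + s (Sum.inl (v, dir (i + 1)))
  map_add' s s' := by ext v; simp only [Pi.add_apply]; ring
  map_smul' c s := by ext v; simp only [Pi.smul_apply, RingHom.id_apply, smul_eq_mul]; ring

theorem leg_function_jump : ∀ (i j : Fin 3), j ≠ i → ∀ a : Leg, ∀ g00 g01 g10 g11 : ZMod 2,
    let g : Leg → ZMod 2 := fun a => if a = (0, 0) then g00 else if a = (0, 1) then g01 else
      if a = (1, 0) then g10 else g11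
    (∀ a, g (a + dir i) = g a) → g (a + dir j) = g a + (g 0 + g (dir (i + 1))) := by
  decide

theorem leg_function_eq (g : Leg → ZMod 2) : g = fun a => if a = (0, 0) then g (0, 0) else
    if a = (0, 1) then g (0, 1) else if a = (1, 0) then g (1, 0) else g (1, 1) := by
  ext a
  have : a = (0, 0) ∨ a = (0, 1) ∨ a = (1, 0) ∨ a = (1, 1) := by revert a; decide
  rcases this with rfl | rfl | rfl | rfl <;> simp

variable {G}

theorem apply_add_dir_self {i : Fin 3} {s : Ends V M → ZMod 2} (hs : s ∈ G.inv i) (v : V) (a : Leg) :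
    s (Sum.inl (v, a + dir i)) = s (Sum.inl (v, a)) := hs.2 (Sum.inl (v, a))

theorem apply_add_dir {i : Fin 3} {s : Ends V M → ZMod 2} (hs : s ∈ G.inv i) {j : Fin 3}
    (hj : j ≠ i) (v : V) (a : Leg) :
    s (Sum.inl (v, a + dir j)) = s (Sum.inl (v, a)) + jump i s v := by
  have key : ∀ g : Leg → ZMod 2, (∀ a, g (a + dir i) = g a) →
      g (a + dir j) = g a + (g 0 + g (dir (i + 1))) := by
    intro g
    rw [leg_function_eq g]
    exact leg_function_jump i j hj a _ _ _ _
  exact key (fun a => s (Sum.inl (v, a))) fun a => apply_add_dir_self hs v a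

theorem leg_eq_add_dir (a b : Leg) : a = b ∨ ∃ j, a = b + dir j := by
  revert a b; decide

/-- At a bubble where its word vanishes, an invariant function is constant. -/
theorem apply_eq_of_jump_eq_zero {i : Fin 3} {s : Ends V M → ZMod 2} (hs : s ∈ G.inv i) {v : V}
    (hv : jump i s v = 0) (a b : Leg) : s (Sum.inl (v, a)) = s (Sum.inl (v, b)) := by
  obtain rfl | ⟨j, rfl⟩ := leg_eq_add_dir a b
  · rfl
  · by_cases hj : j = i
    · subst hj; exact apply_add_dir_self hs v b
    · rw [apply_add_dir hs hj, hv, add_zero]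

theorem mem_inv_mark {i : Fin 3} {s : Ends V M → ZMod 2} (hs : s ∈ G.inv i) (m : M) (b b' : ZMod 2) :
    s (Sum.inr (m, b)) = s (Sum.inr (m, b')) := by
  by_cases h : b = b'
  · rw [h]
  · rw [zmod_two_add_one_of_ne h]; exact hs.2 (Sum.inr (m, b'))

theorem sum_mul_eq_zero_of_pair_invariant [Fintype V] [Fintype M] (s s' : Ends V M → ZMod 2)
    (h : ∀ x, s (G.pair x) = s x) (h' : ∀ x, s' (G.pair x) = s' x) : ∑ x, s x * s' x = 0 := by
  refine Finset.sum_involution (fun x _ => G.pair x) (fun x _ => ?_) (fun x _ _ => G.pair_ne x)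
    (fun x _ => Finset.mem_univ _) (fun x _ => G.pair_pair x)
  rw [h, h']
  exact CharTwo.add_self_eq_zero _

theorem leg_sum (f : Leg → ZMod 2) {i j k : Fin 3} (hij : i ≠ j) (hik : i ≠ k) (hjk : j ≠ k) :
    ∑ a, f a = f 0 + f (dir i) + (f (dir j) + f (dir k)) := by
  have h : ∑ a, f a = f (0, 0) + f (1, 0) + f (0, 1) + f (1, 1) := by
    have h2 : ∀ g : ZMod 2 → ZMod 2, ∑ x, g x = g 0 + g 1 := fun g => Fin.sum_univ_two g
    rw [Fintype.sum_prod_type]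
    simp only [h2]
    ring
  rw [h]
  have h0 : dir 0 = (1, 0) := rfl
  have h1 : dir 1 = (0, 1) := rfl
  have h2 : dir 2 = (1, 1) := rfl
  have h3 : (0 : Leg) = (0, 0) := rfl
  fin_cases i <;> fin_cases j <;> first | exact absurd rfl hij | (fin_cases k <;>
    first | exact absurd rfl hik | exact absurd rfl hjk | (simp only [Fin.zero_eta, Fin.mk_one, Fin.reduceFinMk, h0, h1, h2, h3]; ring))

theorem dir_add_dir {i j k : Fin 3} (hij : i ≠ j) (hik : i ≠ k) (hjk : j ≠ k) :
    dir i + dir j = dir k := by revert i j k; decide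

/-- Words of faces of different colours are orthogonal: the faces, as sets of edges, share an even
number of half-edges. -/
theorem sum_jump_mul_jump [Fintype V] [Fintype M] {i j : Fin 3} (hij : i ≠ j)
    {s s' : Ends V M → ZMod 2} (hs : s ∈ G.inv i) (hs' : s' ∈ G.inv j) :
    ∑ v, jump i s v * jump j s' v = 0 := by
  obtain ⟨k, hik, hjk⟩ : ∃ k, i ≠ k ∧ j ≠ k := by
    clear hs hs'; revert i j; decide
  rw [← sum_mul_eq_zero_of_pair_invariant (G := G) s s' hs.1 hs'.1, Fintype.sum_sum_type,
    Fintype.sum_prod_type, Fintype.sum_prod_type]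
  have h2 : ∑ m : M, ∑ b : ZMod 2, s (Sum.inr (m, b)) * s' (Sum.inr (m, b)) = 0 := by
    refine Finset.sum_eq_zero fun m _ => ?_
    rw [Finset.sum_congr rfl fun b _ => by rw [mem_inv_mark hs m b 0, mem_inv_mark hs' m b 0]]
    rw [Finset.sum_const]
    exact CharTwo.two_nsmul _
  rw [h2, add_zero]
  refine Finset.sum_congr rfl fun v _ => ?_
  rw [leg_sum _ hij hik hjk]
  have e1 := apply_add_dir_self hs v 0
  have e2 := apply_add_dir hs hij.symm v 0
  have e3 := apply_add_dir hs hik.symm v 0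
  have f1 := apply_add_dir hs' hij v 0
  have f2 := apply_add_dir_self hs' v 0
  have f3 := apply_add_dir hs' hjk.symm v 0
  simp only [zero_add] at e1 e2 e3 f1 f2 f3
  rw [e1, e2, e3, f1, f2, f3]
  generalize s (Sum.inl (v, 0)) = x, s' (Sum.inl (v, 0)) = y, jump i s v = z, jump j s' v = w
  revert x y z w; decide

variable (G) in
/-- The space of words of the faces of colour `i`. -/
def words (i : Fin 3) : Submodule (ZMod 2) (V → ZMod 2) := (G.inv i).map (jump i)

theorem words_orthogonal [Fintype V] [Fintype M] {i j : Fin 3} (hij : i ≠ j) {x y : V → ZMod 2}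
    (hx : x ∈ G.words i) (hy : y ∈ G.words j) : ∑ v, x v * y v = 0 := by
  obtain ⟨s, hs, rfl⟩ := hx
  obtain ⟨s', hs', rfl⟩ := hy
  exact sum_jump_mul_jump hij hs hs'

/-- A word of two colours is a word of the third one. -/
theorem words_inf_words_le {i j k : Fin 3} (hij : i ≠ j) (hik : i ≠ k) (hjk : j ≠ k) :
    G.words i ⊓ G.words j ≤ G.words k := by
  rintro x ⟨⟨s, hs, hsx⟩, ⟨s', hs', hsx'⟩⟩
  have hk : s + s' ∈ G.inv k := by
    refine ⟨fun x => by simp [hs.1 x, hs'.1 x], ?_⟩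
    rintro (⟨v, a⟩ | ⟨m, b⟩)
    · simp only [turn, Pi.add_apply]
      rw [apply_add_dir hs hik.symm, apply_add_dir hs' hjk.symm, hsx, hsx']
      generalize s (Sum.inl (v, a)) = x, s' (Sum.inl (v, a)) = y, x v = z
      revert x y z; decide
    · simp only [turn, Pi.add_apply]
      rw [mem_inv_mark hs m (b + 1) b, mem_inv_mark hs' m (b + 1) b]
  refine ⟨s + s', hk, ?_⟩
  ext v
  have h1 := apply_add_dir hk hik v 0
  simp only [Pi.add_apply] at h1
  rw [apply_add_dir_self hs, apply_add_dir hs' hij, hsx'] at h1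
  revert h1
  generalize s (Sum.inl (v, 0)) = x, s' (Sum.inl (v, 0)) = y, jump k (s + s') v = w, x v = z
  revert x y z w; decide

theorem finrank_words_add_one [Finite V] [Finite M] [Nonempty (Ends V M)] (hG : G.Connected)
    (i : Fin 3) : finrank (ZMod 2) (G.words i) + 1 = G.numFaces i := by
  change _ = numOrbits _ _
  rw [← finrank_invariants, words, ← LinearMap.range_domRestrict,
    ← LinearMap.finrank_range_add_finrank_ker ((jump i).domRestrict (G.inv i))]
  congr 1
  obtain ⟨x0⟩ := ‹Nonempty (Ends V M)›
  have h1 : (fun _ => 1 : Ends V M → ZMod 2) ∈ G.inv i := ⟨fun _ => rfl, fun _ => rfl⟩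
  symm
  refine finrank_eq_one (⟨⟨fun _ => 1, h1⟩, ?_⟩ : LinearMap.ker ((jump i).domRestrict (G.inv i)))
    ?_ ?_
  · rw [LinearMap.mem_ker]
    ext v
    exact CharTwo.add_self_eq_zero _
  · intro h
    have := congrFun (congrArg (fun z => z.1.1) h) x0
    exact one_ne_zero this
  · rintro ⟨⟨s, hs⟩, hk⟩
    rw [LinearMap.mem_ker] at hk
    refine ⟨s x0, ?_⟩
    ext x
    have := hG s hs.1 (fun v a b => apply_eq_of_jump_eq_zero hs (congrFun hk v) a b)
      (fun m b b' => mem_inv_mark hs m b b') x0 x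
    simp [this]

end MarkedGraph
end QuarticMultiMatrix

namespace QuarticMultiMatrix
open Module
namespace MarkedGraph
variable {V M : Type} {G : MarkedGraph V M}

/-! ### The defect of a connected graph -/

variable (G) in
/-- Twice the degree `3 + 3/2 n - F` of a connected graph. -/
noncomputable def defect [Fintype V] : ℤ :=
  6 + 3 * Fintype.card V - 2 * (G.numFaces 0 + G.numFaces 1 + G.numFaces 2)

variable (G) in
/-- The vectors orthogonal to the words of colour `k`. -/
def wordsOrth [Fintype V] (k : Fin 3) : Submodule (ZMod 2) (V → ZMod 2) where
  carrier := {z | ∀ u ∈ G.words k, ∑ v, z v * u v = 0}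
  add_mem' ha hb u hu := by
    simp only [Pi.add_apply, add_mul, Finset.sum_add_distrib, ha u hu, hb u hu, add_zero]
  zero_mem' u _ := by simp
  smul_mem' c z hz u hu := by
    simp only [Pi.smul_apply, smul_eq_mul, mul_assoc, ← Finset.mul_sum, hz u hu, mul_zero]

theorem finrank_words_add_le [Fintype V] [Fintype M] {i j : Fin 3} (hij : i ≠ j) :
    finrank (ZMod 2) (G.words i) + finrank (ZMod 2) (G.words j) ≤ Fintype.card V :=
  finrank_add_finrank_le_of_orthogonal _ _ fun _ ha _ hb => words_orthogonal hij ha hb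

theorem defect_eq [Fintype V] [Finite M] [Nonempty (Ends V M)] (hG : G.Connected) {i j k : Fin 3}
    (hij : i ≠ j) (hik : i ≠ k) (hjk : j ≠ k) :
    G.defect = 3 * Fintype.card V - 2 * (finrank (ZMod 2) (G.words i) +
      finrank (ZMod 2) (G.words j) + finrank (ZMod 2) (G.words k)) := by
  rw [defect, ← finrank_words_add_one hG, ← finrank_words_add_one hG, ← finrank_words_add_one hG]
  fin_cases i <;> fin_cases j <;> first | exact absurd rfl hij | (fin_cases k <;>
    first | exact absurd rfl hik | exact absurd rfl hjk | (push_cast; ring))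

theorem defect_nonneg [Fintype V] [Fintype M] [Nonempty (Ends V M)] (hG : G.Connected) :
    0 ≤ G.defect := by
  rw [defect_eq hG (i := 0) (j := 1) (k := 2) (by decide) (by decide) (by decide)]
  have h1 := finrank_words_add_le (G := G) (i := 0) (j := 1) (by decide)
  have h2 := finrank_words_add_le (G := G) (i := 0) (j := 2) (by decide)
  have h3 := finrank_words_add_le (G := G) (i := 1) (j := 2) (by decide)
  omega

theorem inf_words_le_wordsOrth [Fintype V] [Fintype M] {i j k : Fin 3} (hik : i ≠ k) :
    G.words i ⊓ G.words j ≤ G.wordsOrth k := fun _ hx _ hu => words_orthogonal hik hx.1 hu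

theorem finrank_words_add_finrank_words_le [Fintype V] [Fintype M] {i j k : Fin 3}
    (hik : i ≠ k) (hjk : j ≠ k) :
    finrank (ZMod 2) (G.words i) + finrank (ZMod 2) (G.words j) + finrank (ZMod 2) (G.words k) ≤
      finrank (ZMod 2) (G.words i ⊓ G.words j : Submodule _ _) + Fintype.card V := by
  have h1 := Submodule.finrank_sup_add_finrank_inf_eq (G.words i) (G.words j)
  have h2 := finrank_add_finrank_le_of_orthogonal (G.words i ⊔ G.words j) (G.words k)
    fun a ha b hb => by
      obtain ⟨x, hx, y, hy, rfl⟩ := Submodule.mem_sup.1 ha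
      simp only [Pi.add_apply, add_mul, Finset.sum_add_distrib, words_orthogonal hik hx hb,
        words_orthogonal hjk hy hb, add_zero]
  omega

/-- The words common to all colours have codimension at most the defect in the space orthogonal to
the words of one colour. -/
theorem finrank_wordsOrth_le [Fintype V] [Fintype M] [Nonempty (Ends V M)] (hG : G.Connected)
    {D : ℕ} (hD : G.defect ≤ D) {i j k : Fin 3} (hij : i ≠ j) (hik : i ≠ k) (hjk : j ≠ k) :
    finrank (ZMod 2) (G.wordsOrth k) ≤
      finrank (ZMod 2) (G.words i ⊓ G.words j : Submodule _ _) + D := by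
  rw [defect_eq hG hij hik hjk] at hD
  have h1 := finrank_words_add_finrank_words_le (G := G) hik hjk
  have h2 := finrank_add_finrank_le_of_orthogonal (G.wordsOrth k) (G.words k)
    fun a ha b hb => ha b hb
  have h3 := finrank_words_add_le (G := G) hij
  omega

/-- The words common to all colours have codimension at most the defect in the words of one
colour. -/
theorem finrank_words_le [Fintype V] [Fintype M] [Nonempty (Ends V M)] (hG : G.Connected)
    {D : ℕ} (hD : G.defect ≤ D) {i j k : Fin 3} (hij : i ≠ j) (hik : i ≠ k) (hjk : j ≠ k) :
    finrank (ZMod 2) (G.words k) ≤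
      finrank (ZMod 2) (G.words i ⊓ G.words j : Submodule _ _) + D := by
  rw [defect_eq hG hij hik hjk] at hD
  have h1 := finrank_words_add_finrank_words_le (G := G) hik hjk
  have h2 := finrank_words_add_le (G := G) hik
  have h3 := finrank_words_add_le (G := G) hjk
  omega

end MarkedGraph
end QuarticMultiMatrix

namespace QuarticMultiMatrix
open Module
namespace MarkedGraph
variable {V M : Type} (G : MarkedGraph V M)

/-! ### Faces and their lengths -/

/-- The faces of colour `c`. -/
abbrev Face (c : Fin 3) : Type := Quotient (orbitSetoid G.pair (turn c : Ends V M → Ends V M))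

/-- The face of colour `c` through a half-edge. -/
abbrev face (c : Fin 3) (x : Ends V M) : G.Face c := Quotient.mk _ x

noncomputable instance [Finite V] [Finite M] (c : Fin 3) : Fintype (G.Face c) := Fintype.ofFinite _

theorem face_pair (c : Fin 3) (x : Ends V M) : G.face c (G.pair x) = G.face c x :=
  Quotient.sound ((orbitSetoid G.pair (turn c)).symm (orbitSetoid_left _ _ x))

theorem face_turn (c : Fin 3) (x : Ends V M) : G.face c (turn c x) = G.face c x :=
  Quotient.sound ((orbitSetoid G.pair (turn c)).symm (orbitSetoid_right _ _ x))

theorem face_add_dir (c : Fin 3) (v : V) (a : Leg) :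
    G.face c (Sum.inl (v, a + dir c)) = G.face c (Sum.inl (v, a)) := G.face_turn c (Sum.inl (v, a))

theorem face_mark (c : Fin 3) (m : M) (b b' : ZMod 2) :
    G.face c (Sum.inr (m, b)) = G.face c (Sum.inr (m, b')) := by
  by_cases h : b = b'
  · rw [h]
  · rw [zmod_two_add_one_of_ne h]; exact G.face_turn c (Sum.inr (m, b'))

open Classical in
/-- The indicator function of a face. -/
noncomputable def indicator {c : Fin 3} (f : G.Face c) (x : Ends V M) : ZMod 2 :=
  if G.face c x = f then 1 else 0

variable {G}

theorem indicator_mem {c : Fin 3} (f : G.Face c) : G.indicator f ∈ G.inv c :=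
  ⟨fun x => by rw [indicator, indicator, face_pair], fun x => by rw [indicator, indicator, face_turn]⟩

theorem apply_eq_of_face_eq {c : Fin 3} {s : Ends V M → ZMod 2} (hs : s ∈ G.inv c) {x y : Ends V M}
    (h : G.face c x = G.face c y) : s x = s y :=
  eq_of_orbitSetoid s hs.1 hs.2 (Quotient.exact h)

variable (G) in
/-- The word of a face. -/
noncomputable def faceWord {c : Fin 3} (f : G.Face c) : V → ZMod 2 := jump c (G.indicator f)

theorem faceWord_mem {c : Fin 3} (f : G.Face c) : G.faceWord f ∈ G.words c :=
  ⟨_, indicator_mem f, rfl⟩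

open Classical in
variable (G) in
/-- The legs of tetrahedral bubbles on a face: twice as many as the bubbles visited by the face,
with multiplicity. -/
noncomputable def legs [Fintype V] {c : Fin 3} (f : G.Face c) : Finset (V × Leg) :=
  Finset.univ.filter fun p => G.face c (Sum.inl p) = f

theorem mem_legs [Fintype V] {c : Fin 3} {f : G.Face c} {p : V × Leg} :
    p ∈ G.legs f ↔ G.face c (Sum.inl p) = f := by
  simp [legs]

theorem sum_card_legs [Fintype V] [Finite M] (c : Fin 3) :
    ∑ f : G.Face c, (G.legs f).card = 4 * Fintype.card V := by
  classical
  have h := Finset.card_eq_sum_card_fiberwise (s := (Finset.univ : Finset (V × Leg)))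
    (t := (Finset.univ : Finset (G.Face c))) (f := fun p => G.face c (Sum.inl p))
    (fun _ _ => Finset.mem_univ _)
  have h4 : Fintype.card Leg = 4 := rfl
  rw [Finset.card_univ, Fintype.card_prod, h4] at h
  rw [mul_comm, h]
  rfl

theorem numFaces_eq_card [Finite V] [Finite M] (c : Fin 3) :
    G.numFaces c = Fintype.card (G.Face c) := Nat.card_eq_fintype_card

/-- A set of half-edges closed under the edges and the turns of colour `c` contains the whole face
of each of its elements. -/
theorem mem_of_face_eq {c : Fin 3} (P : Ends V M → Prop) (hp : ∀ x, P x → P (G.pair x))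
    (ht : ∀ x, P x → P (turn c x)) {x y : Ends V M} (h : G.face c x = G.face c y) (hx : P x) :
    P y := by
  have := eq_of_orbitSetoid (p := G.pair) (t := turn c) P
    (fun x => propext ⟨fun h => by have := hp _ h; rwa [G.pair_pair] at this, hp x⟩)
    (fun x => propext ⟨fun h => by have := ht _ h; rwa [turn_turn] at this, ht x⟩)
    (Quotient.exact h)
  exact this.mp hx

theorem legs_nonempty [Fintype V] [Nonempty V] (hG : G.Connected) {c : Fin 3} (f : G.Face c) :
    (G.legs f).Nonempty := by
  by_contra hne
  rw [Finset.not_nonempty_iff_eq_empty] at hne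
  have h0 : ∀ v a, G.indicator f (Sum.inl (v, a)) = 0 := fun v a => by
    rw [indicator, if_neg]
    intro h
    have := mem_legs.2 h
    rw [hne] at this
    simp at this
  obtain ⟨x, hx⟩ := Quotient.exists_rep f
  have h1 : G.indicator f x = 1 := by rw [indicator, if_pos]; exact hx
  obtain ⟨v⟩ := ‹Nonempty V›
  have := hG (G.indicator f) (indicator_mem f).1 (fun v a b => by rw [h0, h0])
    (fun m b b' => mem_inv_mark (indicator_mem f) m b b') x (Sum.inl (v, 0))
  rw [h0, h1] at this
  exact one_ne_zero this

variable (G) in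
/-- The two strands of colour `c` in the bubble `v` belong to the same face. -/
def IsLoop (c : Fin 3) (v : V) : Prop := ∀ a b, G.face c (Sum.inl (v, a)) = G.face c (Sum.inl (v, b))

theorem face_eq_of_not_loop {c : Fin 3} {v : V} (hv : ¬ G.IsLoop c v) {a b : Leg}
    (h : G.face c (Sum.inl (v, a)) = G.face c (Sum.inl (v, b))) : b = a ∨ b = a + dir c := by
  by_contra hb
  refine hv fun a' b' => ?_
  have key : ∀ a', G.face c (Sum.inl (v, a')) = G.face c (Sum.inl (v, a)) := by
    intro a'
    have h4 : a' = a ∨ a' = a + dir c ∨ a' = b ∨ a' = b + dir c := by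
      clear h hv; revert a b a' c; decide
    rcases h4 with rfl | rfl | rfl | rfl
    · rfl
    · exact G.face_add_dir _ _ _
    · exact h.symm
    · rw [G.face_add_dir]; exact h.symm
  rw [key a', key b']

theorem jump_eq_zero_of_isLoop {c : Fin 3} {v : V} (hv : G.IsLoop c v) {s : Ends V M → ZMod 2}
    (hs : s ∈ G.inv c) : jump c s v = 0 := by
  have h := apply_eq_of_face_eq hs (hv 0 (dir (c + 1)))
  change s (Sum.inl (v, 0)) + s (Sum.inl (v, dir (c + 1))) = 0
  rw [h]
  exact CharTwo.add_self_eq_zero _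

theorem word_eq_zero_of_isLoop {c : Fin 3} {v : V} (hv : G.IsLoop c v) {u : V → ZMod 2}
    (hu : u ∈ G.words c) : u v = 0 := by
  obtain ⟨s, hs, rfl⟩ := hu
  exact jump_eq_zero_of_isLoop hv hs

theorem single_mem_wordsOrth [Fintype V] [DecidableEq V] {c : Fin 3} {v : V} (hv : G.IsLoop c v) :
    Pi.single v 1 ∈ G.wordsOrth c := by
  intro u hu
  refine Finset.sum_eq_zero fun w _ => ?_
  by_cases h : w = v
  · subst h; rw [word_eq_zero_of_isLoop hv hu, mul_zero]
  · rw [Pi.single_eq_of_ne h, zero_mul]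

theorem faceWord_eq_one_iff {c : Fin 3} {f : G.Face c} {v : V} (hv : ¬ G.IsLoop c v) :
    G.faceWord f v = 1 ↔ ∃ a, G.face c (Sum.inl (v, a)) = f := by
  classical
  have hne : G.face c (Sum.inl (v, 0)) ≠ G.face c (Sum.inl (v, dir (c + 1))) := fun h => by
    have := face_eq_of_not_loop hv h
    revert this
    clear h hv f
    revert c; decide
  have e : G.faceWord f v = (if G.face c (Sum.inl (v, 0)) = f then 1 else 0) +
      (if G.face c (Sum.inl (v, dir (c + 1))) = f then 1 else 0) := by
    simp [faceWord, jump, indicator]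
  rw [e]
  constructor
  · intro h
    by_cases h0 : G.face c (Sum.inl (v, 0)) = f
    · exact ⟨_, h0⟩
    · by_cases h1 : G.face c (Sum.inl (v, dir (c + 1))) = f
      · exact ⟨_, h1⟩
      · rw [if_neg h0, if_neg h1] at h; simp at h
  · rintro ⟨a, ha⟩
    have h4 : a = 0 ∨ a = 0 + dir c ∨ a = dir (c + 1) ∨ a = dir (c + 1) + dir c := by
      clear ha hne hv e f; revert a c; decide
    have h5 : G.face c (Sum.inl (v, 0)) = f ∨ G.face c (Sum.inl (v, dir (c + 1))) = f := by
      rcases h4 with rfl | rfl | rfl | rfl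
      · exact Or.inl ha
      · rw [face_add_dir] at ha; exact Or.inl ha
      · exact Or.inr ha
      · rw [face_add_dir] at ha; exact Or.inr ha
    rcases h5 with h | h
    · rw [if_pos h, if_neg (fun h' => hne (h.trans h'.symm)), add_zero]
    · rw [if_pos h, if_neg (fun h' => hne (h'.trans h.symm)), zero_add]

variable (G) in
/-- No two bubbles are joined by two edges without marks which form a face of length two. -/
def NoDipole : Prop := ∀ (i : Fin 3) (v w : V) (a b : Leg), v ≠ w →
  G.pair (Sum.inl (v, a)) = Sum.inl (w, b) →
    G.pair (Sum.inl (v, a + dir i)) ≠ Sum.inl (w, b + dir i)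

end MarkedGraph
end QuarticMultiMatrix

namespace QuarticMultiMatrix
open Module
namespace MarkedGraph
variable {V M : Type} {G : MarkedGraph V M}

/-! ### Graphs of defect zero -/

theorem exists_others (k : Fin 3) : ∃ i j, i ≠ j ∧ i ≠ k ∧ j ≠ k := by revert k; decide

theorem wordsOrth_le_of_defect_eq_zero [Fintype V] [Fintype M] [Nonempty (Ends V M)]
    (hG : G.Connected) (hD : G.defect = 0) {i j k : Fin 3} (hij : i ≠ j) (hik : i ≠ k)
    (hjk : j ≠ k) : G.wordsOrth k ≤ G.words i ⊓ G.words j := by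
  refine (Submodule.eq_of_le_of_finrank_le (inf_words_le_wordsOrth (j := j) hik) ?_).ge
  simpa using finrank_wordsOrth_le hG (D := 0) (by simp [hD]) hij hik hjk

theorem not_isLoop_of_defect_eq_zero [Fintype V] [Fintype M] [Nonempty (Ends V M)]
    (hG : G.Connected) (hD : G.defect = 0) (k : Fin 3) (v : V) : ¬ G.IsLoop k v := fun h => by
  classical
  obtain ⟨i, j, hij, hik, hjk⟩ := exists_others k
  have h1 := wordsOrth_le_of_defect_eq_zero hG hD hij hik hjk (single_mem_wordsOrth h)
  have h2 := word_eq_zero_of_isLoop h (words_inf_words_le hij hik hjk h1)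
  simp at h2

theorem card_legs_eq [Fintype V] {k : Fin 3} (hl : ∀ v, ¬ G.IsLoop k v) (f : G.Face k) :
    (G.legs f).card = 2 * (Finset.univ.filter fun v => G.faceWord f v = 1).card := by
  classical
  rw [Finset.card_eq_sum_card_fiberwise (t := Finset.univ.filter fun v => G.faceWord f v = 1)
    (f := Prod.fst)]
  · rw [Finset.sum_const_nat (m := 2), mul_comm]
    intro v hv
    obtain ⟨a, ha⟩ := (faceWord_eq_one_iff (hl v)).1 (Finset.mem_filter.1 hv).2
    have : (G.legs f).filter (fun p => p.1 = v) = {(v, a), (v, a + dir k)} := by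
      ext ⟨w, b⟩
      simp only [Finset.mem_filter, mem_legs, Finset.mem_insert, Finset.mem_singleton,
        Prod.mk.injEq]
      constructor
      · rintro ⟨h, rfl⟩
        rcases face_eq_of_not_loop (hl w) (ha.trans h.symm) with rfl | rfl <;> simp
      · rintro (⟨rfl, rfl⟩ | ⟨rfl, rfl⟩)
        · exact ⟨ha, rfl⟩
        · exact ⟨by rw [face_add_dir]; exact ha, rfl⟩
    rw [this, Finset.card_pair]
    intro h
    have := (Prod.mk.inj h).2
    exact dir_ne_zero k (by simpa using this)
  · rintro ⟨v, a⟩ hp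
    simp only [Finset.coe_filter, Finset.mem_univ, true_and, Set.mem_ofPred_eq]
    exact (faceWord_eq_one_iff (hl v)).2 ⟨a, mem_legs.1 hp⟩

theorem four_dvd_card_legs_of_defect_eq_zero [Fintype V] [Fintype M] [Nonempty (Ends V M)]
    (hG : G.Connected) (hD : G.defect = 0) {k : Fin 3} (f : G.Face k) : 4 ∣ (G.legs f).card := by
  classical
  obtain ⟨i, j, hij, hik, hjk⟩ := exists_others k
  rw [card_legs_eq (fun v => not_isLoop_of_defect_eq_zero hG hD k v)]
  -- the words of colour `k` are words of all colours, hence they are orthogonal to each other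
  have h1 : G.words i ⊓ G.words j = G.words k :=
    Submodule.eq_of_le_of_finrank_le (words_inf_words_le hij hik hjk)
      (by simpa using finrank_words_le hG (D := 0) (by simp [hD]) hij hik hjk)
  have h2 : G.faceWord f ∈ G.words i := by
    have := faceWord_mem f
    rw [← h1] at this
    exact this.1
  have h3 := words_orthogonal hik h2 (faceWord_mem f)
  have h4 : ∀ x : ZMod 2, x * x = if x = 1 then 1 else 0 := by decide
  simp only [h4, Finset.sum_boole] at h3
  rw [ZMod.natCast_eq_zero_iff] at h3
  obtain ⟨r, hr⟩ := h3
  exact ⟨r, by omega⟩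

/-- A face with two strands and no mark is a dipole. -/
theorem exists_mark_of_card_legs_eq_four [Fintype V] [Finite M] (hN : G.NoDipole) {k : Fin 3}
    {f : G.Face k} (hl : ∀ v a, G.face k (Sum.inl (v, a)) = f → ¬ G.IsLoop k v)
    (hf : (G.legs f).card = 4) : ∃ m, G.face k (Sum.inr (m, 0)) = f := by
  classical
  by_contra hm
  push Not at hm
  have hleg : ∀ x, G.face k x = f → ∃ p, x = Sum.inl p ∧ p ∈ G.legs f := by
    rintro (p | ⟨m, b⟩) hx
    · exact ⟨p, rfl, mem_legs.2 hx⟩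
    · exact absurd ((G.face_mark k m 0 b).trans hx) (hm m)
  obtain ⟨⟨v, a⟩, hva⟩ := Finset.card_pos.1 (by rw [hf]; norm_num)
  have hva' := mem_legs.1 hva
  obtain ⟨⟨w, b⟩, hwb, hwb'⟩ := hleg (G.pair (Sum.inl (v, a))) (by rw [G.face_pair, hva'])
  have hwbf := mem_legs.1 hwb'
  have hd : ∀ x : Leg, x + dir k ≠ x := fun x h => dir_ne_zero k (by simpa using h)
  by_cases hvw : v = w
  · subst hvw
    rcases face_eq_of_not_loop (hl v a hva') (hva'.trans hwbf.symm) with rfl | rfl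
    · exact G.pair_ne _ hwb
    · -- the two ends of one strand are joined, and the face has length one
      obtain ⟨⟨w, c⟩, hc, hc'⟩ : ∃ p ∈ G.legs f, p ∉ ({(v, a), (v, a + dir k)} : Finset _) := by
        by_contra h
        push Not at h
        have := Finset.card_le_card h
        rw [hf] at this
        have h2 := Finset.card_le_two (a := (v, a)) (b := (v, a + dir k))
        omega
      let s : Ends V M → Prop := fun x => x = Sum.inl (v, a) ∨ x = Sum.inl (v, a + dir k)
      have h1 : s (Sum.inl (w, c)) := by
        refine mem_of_face_eq s ?_ ?_ (hva'.trans (mem_legs.1 hc).symm) (Or.inl rfl)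
        · rintro x (rfl | rfl)
          · rw [hwb]; exact Or.inr rfl
          · rw [← hwb, G.pair_pair]; exact Or.inl rfl
        · rintro x (rfl | rfl)
          · exact Or.inr rfl
          · refine Or.inl ?_
            simp only [turn, leg_add_add]
      rcases h1 with h1 | h1 <;> exact hc' (by simp [Sum.inl.inj h1])
  · have h4 : G.legs f = {(v, a), (v, a + dir k), (w, b), (w, b + dir k)} := by
      symm
      refine Finset.eq_of_subset_of_card_le ?_ ?_
      · intro p hp
        simp only [Finset.mem_insert, Finset.mem_singleton] at hp
        rcases hp with rfl | rfl | rfl | rfl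
        · exact hva
        · exact mem_legs.2 ((G.face_add_dir _ _ _).trans hva')
        · exact hwb'
        · exact mem_legs.2 ((G.face_add_dir _ _ _).trans hwbf)
      · rw [hf]
        have hd' : ∀ x : Leg, x ≠ x + dir k := fun x => (hd x).symm
        rw [Finset.card_insert_of_notMem, Finset.card_insert_of_notMem,
          Finset.card_insert_of_notMem, Finset.card_singleton]
        all_goals simp [hvw, hd']
    obtain ⟨q, hq, hq'⟩ := hleg (G.pair (Sum.inl (v, a + dir k)))
      (by rw [G.face_pair, G.face_add_dir, hva'])
    rw [h4] at hq'
    simp only [Finset.mem_insert, Finset.mem_singleton] at hq'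
    rcases hq' with rfl | rfl | rfl | rfl
    · rw [← hq, G.pair_pair] at hwb
      exact hvw (Prod.mk.inj (Sum.inl.inj hwb)).1
    · exact G.pair_ne _ hq
    · have := G.pair_injective (hwb.trans hq.symm)
      exact hd a (Prod.mk.inj (Sum.inl.inj this)).2.symm
    · exact hN k v w a b hvw hwb hq

theorem exists_two_short_faces [Fintype V] [Fintype M] [Nonempty V] (hG : G.Connected)
    (hD : G.defect = 0) (k : Fin 3) :
    ∃ f f' : G.Face k, f ≠ f' ∧ (G.legs f).card = 4 ∧ (G.legs f').card = 4 := by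
  classical
  obtain ⟨i, j, hij, hik, hjk⟩ := exists_others k
  have h1 := defect_eq hG hij hik hjk
  have h2 := finrank_words_add_le (G := G) hij
  have h3 := finrank_words_add_le (G := G) hik
  have h4 := finrank_words_add_le (G := G) hjk
  have h5 := finrank_words_add_one hG k
  rw [numFaces_eq_card] at h5
  have h6 : ∑ f : G.Face k, 8 ≤ ∑ f : G.Face k, ((G.legs f).card +
      if (G.legs f).card = 4 then 4 else 0) := Finset.sum_le_sum fun f _ => by
    obtain ⟨r, hr⟩ := four_dvd_card_legs_of_defect_eq_zero hG hD f
    have := Finset.card_pos.2 (legs_nonempty hG f)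
    split_ifs <;> omega
  rw [Finset.sum_add_distrib, sum_card_legs, ← Finset.sum_filter] at h6
  simp only [Finset.sum_const, Finset.card_univ, smul_eq_mul] at h6
  rw [hD] at h1
  obtain ⟨f, hf, f', hf', hne⟩ := Finset.one_lt_card.1 (show 1 < (Finset.univ.filter
    fun f : G.Face k => (G.legs f).card = 4).card by omega)
  exact ⟨f, f', hne, (Finset.mem_filter.1 hf).2, (Finset.mem_filter.1 hf').2⟩

/-- A connected graph of defect zero with at least one bubble, whose dipoles all carry marks, has at
least three marks: there are two faces of length two of every colour, each with a mark. -/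
theorem three_le_card_marks [Fintype V] [Fintype M] [Nonempty V] (hG : G.Connected)
    (hD : G.defect = 0) (hN : G.NoDipole) : 3 ≤ Fintype.card M := by
  classical
  by_contra hM
  have hl := not_isLoop_of_defect_eq_zero hG hD
  have key : ∀ k, ∃ m m', m ≠ m' ∧ G.face k (Sum.inr (m, 0)) ≠ G.face k (Sum.inr (m', 0)) ∧
      (G.legs (G.face k (Sum.inr (m, 0)))).card = 4 ∧
      (G.legs (G.face k (Sum.inr (m', 0)))).card = 4 := by
    intro k
    obtain ⟨f, f', hne, hf, hf'⟩ := exists_two_short_faces hG hD k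
    obtain ⟨m, rfl⟩ := exists_mark_of_card_legs_eq_four hN (fun v _ _ => hl k v) hf
    obtain ⟨m', rfl⟩ := exists_mark_of_card_legs_eq_four hN (fun v _ _ => hl k v) hf'
    exact ⟨m, m', fun h => hne (by rw [h]), hne, hf, hf'⟩
  obtain ⟨m1, m2, h12, -⟩ := key 0
  have hall : ∀ m, m = m1 ∨ m = m2 := by
    intro m
    by_contra h
    push Not at h
    refine hM ?_
    rw [← Finset.card_eq_three.2 ⟨m, m1, m2, h.1, h.2, h12, rfl⟩]
    exact Finset.card_le_univ _
  have key' : ∀ k, G.face k (Sum.inr (m1, 0)) ≠ G.face k (Sum.inr (m2, 0)) ∧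
      (G.legs (G.face k (Sum.inr (m1, 0)))).card = 4 := by
    intro k
    obtain ⟨m, m', h, h1, h2, h3⟩ := key k
    rcases hall m with rfl | rfl <;> rcases hall m' with rfl | rfl
    · exact absurd rfl h
    · exact ⟨h1, h2⟩
    · exact ⟨h1.symm, h3⟩
    · exact absurd rfl h
  -- the two half-edges at the mark `m1` are joined to bubbles
  have hout : ∀ b, ∃ p, G.pair (Sum.inr (m1, b)) = Sum.inl p := by
    intro b
    rcases hx : G.pair (Sum.inr (m1, b)) with p | ⟨m, b'⟩
    · exact ⟨p, rfl⟩
    · exfalso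
      rcases hall m with rfl | rfl
      · have hb : b' = b + 1 := by
          refine zmod_two_add_one_of_ne fun h => ?_
          subst h
          exact G.pair_ne _ hx
        subst hb
        obtain ⟨p, hp⟩ := Finset.card_pos.1 (by rw [(key' 0).2]; norm_num)
        have : ∃ b', (Sum.inl p : Ends V M) = Sum.inr (m, b') := by
          refine mem_of_face_eq (c := 0) (fun x => ∃ b', x = Sum.inr (m, b')) ?_ ?_
            (mem_legs.1 hp).symm ⟨0, rfl⟩
          · rintro x ⟨b', rfl⟩
            by_cases h : b' = b
            · exact ⟨_, by rw [h]; exact hx⟩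
            · refine ⟨b, ?_⟩
              rw [zmod_two_add_one_of_ne h, ← hx, G.pair_pair]
          · rintro x ⟨b', rfl⟩
            exact ⟨_, rfl⟩
        simp at this
      · refine (key' 0).1 ?_
        rw [G.face_mark 0 m1 0 b, G.face_mark 0 m 0 b', ← hx, G.face_pair]
  obtain ⟨⟨v, a⟩, hva⟩ := hout 0
  obtain ⟨⟨w, b⟩, hwb⟩ := hout 1
  have hfv : ∀ k, G.face k (Sum.inl (v, a)) = G.face k (Sum.inr (m1, 0)) := fun k => by
    rw [← hva, G.face_pair]
  have hfw : ∀ k, G.face k (Sum.inl (w, b)) = G.face k (Sum.inr (m1, 0)) := fun k => by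
    rw [← hwb, G.face_pair, G.face_mark k m1 1 0]
  have hva' : G.pair (Sum.inl (v, a)) = Sum.inr (m1, 0) := by rw [← hva, G.pair_pair]
  have hwb' : G.pair (Sum.inl (w, b)) = Sum.inr (m1, 1) := by rw [← hwb, G.pair_pair]
  have hd : ∀ (x : Leg) k, x + dir k ≠ x := fun x k h => dir_ne_zero k (by simpa using h)
  have hvw : v ≠ w := by
    rintro rfl
    have h0 := face_eq_of_not_loop (hl 0 v) ((hfv 0).trans (hfw 0).symm)
    have h1 := face_eq_of_not_loop (hl 1 v) ((hfv 1).trans (hfw 1).symm)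
    have : b = a := by
      clear hva hwb hva' hwb' hfv hfw; revert a b; decide
    subst this
    have := hva'.symm.trans hwb'
    simp at this
  -- the face of colour `k` through `m1` has length two
  have hedge : ∀ k, G.pair (Sum.inl (v, a + dir k)) = Sum.inl (w, b + dir k) := by
    intro k
    have h4 : G.legs (G.face k (Sum.inr (m1, 0))) =
        {(v, a), (v, a + dir k), (w, b), (w, b + dir k)} := by
      symm
      refine Finset.eq_of_subset_of_card_le ?_ ?_
      · intro p hp
        simp only [Finset.mem_insert, Finset.mem_singleton] at hp
        rcases hp with rfl | rfl | rfl | rfl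
        · exact mem_legs.2 (hfv k)
        · exact mem_legs.2 ((G.face_add_dir _ _ _).trans (hfv k))
        · exact mem_legs.2 (hfw k)
        · exact mem_legs.2 ((G.face_add_dir _ _ _).trans (hfw k))
      · rw [(key' k).2]
        have hd' : ∀ x : Leg, x ≠ x + dir k := fun x => (hd x k).symm
        rw [Finset.card_insert_of_notMem, Finset.card_insert_of_notMem,
          Finset.card_insert_of_notMem, Finset.card_singleton]
        all_goals simp [hvw, hd']
    have hf : G.face k (G.pair (Sum.inl (v, a + dir k))) = G.face k (Sum.inr (m1, 0)) := by
      rw [G.face_pair, G.face_add_dir, hfv]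
    rcases hx : G.pair (Sum.inl (v, a + dir k)) with q | ⟨m, c⟩
    · rw [hx] at hf
      have hq := mem_legs.2 hf
      rw [h4] at hq
      simp only [Finset.mem_insert, Finset.mem_singleton] at hq
      rcases hq with rfl | rfl | rfl | rfl
      · rw [← hx, G.pair_pair] at hva'; simp at hva'
      · exact absurd hx (G.pair_ne _)
      · rw [← hx, G.pair_pair] at hwb'; simp at hwb'
      · rfl
    · exfalso
      rcases hall m with rfl | rfl
      · have h2 : c = 0 ∨ c = 1 := by clear hx; revert c; decide
        rcases h2 with rfl | rfl
        · have := G.pair_injective (hva'.trans hx.symm)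
          exact hd a k (Prod.mk.inj (Sum.inl.inj this)).2.symm
        · have := G.pair_injective (hwb'.trans hx.symm)
          exact hvw (Prod.mk.inj (Sum.inl.inj this)).1.symm
      · refine (key' k).1 ?_
        rw [← hf, hx, G.face_mark k m c 0]
  refine hN 2 v w (a + dir 0) (b + dir 0) hvw (hedge 0) ?_
  have h2 : ∀ x : Leg, x + dir 0 + dir 2 = x + dir 1 := by decide
  rw [h2, h2]
  exact hedge 1

end MarkedGraph
end QuarticMultiMatrix

namespace QuarticMultiMatrix
open Module
namespace MarkedGraph
variable {V M : Type} {G : MarkedGraph V M}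

/-! ### Straight faces of length four -/

/-- The leg on the other end of the strand of colour `3`. -/
abbrev opp (p : V × Leg) : V × Leg := (p.1, p.2 + dir 2)

/-- A straight face (of colour `3`) is regular if it carries no mark, goes through four bubbles, and
does not cross itself. -/
structure Regular [Fintype V] (f : G.Face 2) : Prop where
  mark : ∀ m b, G.face 2 (Sum.inr (m, b)) ≠ f
  card : (G.legs f).card = 8
  loop : ∀ v a, G.face 2 (Sum.inl (v, a)) = f → ¬ G.IsLoop 2 v

theorem opp_opp (p : V × Leg) : opp (opp p) = p := by
  simp only [opp, leg_add_add]

theorem face_opp (p : V × Leg) : G.face 2 (Sum.inl (opp p)) = G.face 2 (Sum.inl p) :=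
  G.face_add_dir 2 p.1 p.2

theorem colour_opp (p : V × Leg) : G.colour (Sum.inl (opp p)) = G.colour (Sum.inl p) := by
  obtain ⟨v, a⟩ := p
  simp only [colour, opp, Sum.elim_inl]
  revert a; decide

theorem exists_leg_pair {f : G.Face 2} (hm : ∀ m b, G.face 2 (Sum.inr (m, b)) ≠ f) {p : V × Leg}
    (hp : G.face 2 (Sum.inl p) = f) :
    ∃ q : V × Leg, G.pair (Sum.inl p) = Sum.inl (opp q) ∧ G.face 2 (Sum.inl q) = f := by
  have h := G.face_pair 2 (Sum.inl p)
  rcases hx : G.pair (Sum.inl p) with q | ⟨m, b⟩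
  · refine ⟨opp q, by rw [opp_opp], ?_⟩
    rw [face_opp, ← hx, h, hp]
  · rw [hx, hp] at h
    exact absurd h (hm m b)

/-- The straight cycle of a regular face, starting from any of its legs. -/
theorem Regular.exists_cycle [Fintype V] {f : G.Face 2} (hf : Regular f) {p0 : V × Leg}
    (h0 : G.face 2 (Sum.inl p0) = f) : ∃ p1 p2 p3 : V × Leg,
      G.pair (Sum.inl p0) = Sum.inl (opp p1) ∧ G.pair (Sum.inl p1) = Sum.inl (opp p2) ∧
      G.pair (Sum.inl p2) = Sum.inl (opp p3) ∧ G.pair (Sum.inl p3) = Sum.inl (opp p0) ∧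
      G.face 2 (Sum.inl p1) = f ∧ G.face 2 (Sum.inl p2) = f ∧ G.face 2 (Sum.inl p3) = f ∧
      p0.1 ≠ p1.1 ∧ p0.1 ≠ p2.1 ∧ p0.1 ≠ p3.1 ∧ p1.1 ≠ p2.1 ∧ p1.1 ≠ p3.1 ∧ p2.1 ≠ p3.1 ∧
      ∀ q : V × Leg, G.face 2 (Sum.inl q) = f →
        q.1 = p0.1 ∨ q.1 = p1.1 ∨ q.1 = p2.1 ∨ q.1 = p3.1 := by
  classical
  -- legs of `f` at the same bubble are equal or opposite
  have hsame : ∀ {p q : V × Leg}, G.face 2 (Sum.inl p) = f → G.face 2 (Sum.inl q) = f →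
      p.1 = q.1 → q = p ∨ q = opp p := by
    rintro ⟨v, a⟩ ⟨w, b⟩ hp hq h
    obtain rfl : v = w := h
    rcases face_eq_of_not_loop (hf.loop v a hp) (hp.trans hq.symm) with rfl | rfl
    · exact Or.inl rfl
    · exact Or.inr rfl
  have hcol : ∀ {p q : V × Leg}, G.pair (Sum.inl p) = Sum.inl (opp q) →
      G.colour (Sum.inl q) = G.colour (Sum.inl p) + 1 := by
    intro p q h
    rw [← colour_opp q, ← h, colour_pair_eq]
  have hstep : ∀ {p q : V × Leg}, G.face 2 (Sum.inl p) = f → G.face 2 (Sum.inl q) = f →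
      G.pair (Sum.inl p) = Sum.inl (opp q) → p.1 ≠ q.1 := by
    intro p q hp hq h hpq
    have hc := hcol h
    rcases hsame hp hq hpq with rfl | rfl
    · exact absurd hc (by generalize G.colour _ = z; revert z; decide)
    · rw [colour_opp] at hc
      exact absurd hc (by generalize G.colour _ = z; revert z; decide)
  have htwo : ∀ {p q r : V × Leg}, G.face 2 (Sum.inl p) = f → G.face 2 (Sum.inl q) = f →
      G.face 2 (Sum.inl r) = f → G.pair (Sum.inl p) = Sum.inl (opp q) →
      G.pair (Sum.inl q) = Sum.inl (opp r) → p.1 ≠ r.1 := by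
    intro p q r hp hq hr h1 h2 hpr
    have h1' : G.pair (Sum.inl (opp q)) = Sum.inl p := by rw [← h1, G.pair_pair]
    rcases hsame hp hr hpr with rfl | rfl
    · -- the face closes up after two steps
      have h2' : G.pair (Sum.inl (opp r)) = Sum.inl q := by rw [← h2, G.pair_pair]
      have hall : G.legs f ⊆ {r, opp r, q, opp q} := by
        intro x hx
        have := mem_of_face_eq (c := 2) (fun y : Ends V M => y = Sum.inl r ∨ y = Sum.inl (opp r) ∨
          y = Sum.inl q ∨ y = Sum.inl (opp q)) ?_ ?_ (hp.trans (mem_legs.1 hx).symm) (Or.inl rfl)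
        · simpa using this
        · rintro y (rfl | rfl | rfl | rfl)
          · exact Or.inr (Or.inr (Or.inr h1))
          · exact Or.inr (Or.inr (Or.inl h2'))
          · exact Or.inr (Or.inl h2)
          · exact Or.inl h1'
        · have ht : ∀ p : V × Leg, (turn 2 (Sum.inl p) : Ends V M) = Sum.inl (opp p) := fun _ => rfl
          rintro y (rfl | rfl | rfl | rfl)
          · exact Or.inr (Or.inl (ht _))
          · exact Or.inl (by rw [ht, opp_opp])
          · exact Or.inr (Or.inr (Or.inr (ht _)))
          · exact Or.inr (Or.inr (Or.inl (by rw [ht, opp_opp])))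
      have h4 := (Finset.card_le_card hall).trans Finset.card_le_four
      rw [hf.card] at h4
      omega
    · rw [opp_opp] at h2
      have := G.pair_injective (h2.trans h1'.symm)
      have h3 := (Prod.mk.inj (Sum.inl.inj this)).2
      exact dir_ne_zero 2 (by simpa using h3)
  obtain ⟨p1, h01, h1⟩ := exists_leg_pair hf.mark h0
  obtain ⟨p2, h12, h2⟩ := exists_leg_pair hf.mark h1
  obtain ⟨p3, h23, h3⟩ := exists_leg_pair hf.mark h2
  have n01 := hstep h0 h1 h01
  have n12 := hstep h1 h2 h12
  have n23 := hstep h2 h3 h23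
  have n02 := htwo h0 h1 h2 h01 h12
  have n13 := htwo h1 h2 h3 h12 h23
  have n03 : p0.1 ≠ p3.1 := by
    intro h
    have hc : G.colour (Sum.inl p3) ≠ G.colour (Sum.inl p0) := by
      rw [hcol h23, hcol h12, hcol h01]
      generalize G.colour _ = z; revert z; decide
    rcases hsame h0 h3 h with rfl | rfl
    · exact hc rfl
    · exact hc (colour_opp _)
  have hlegs : G.legs f = {p0, opp p0, p1, opp p1, p2, opp p2, p3, opp p3} := by
    symm
    refine Finset.eq_of_subset_of_card_le ?_ ?_
    · intro q hq
      simp only [Finset.mem_insert, Finset.mem_singleton] at hq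
      rw [mem_legs]
      rcases hq with rfl | rfl | rfl | rfl | rfl | rfl | rfl | rfl <;>
        first | assumption | (rw [face_opp]; assumption)
    · have hd : ∀ p : V × Leg, p ≠ opp p := fun p h => by
        have h3 := (Prod.mk.inj h).2
        exact dir_ne_zero 2 (by simpa using h3)
      have hne : ∀ {p q : V × Leg}, p.1 ≠ q.1 → p ≠ q ∧ p ≠ opp q ∧ opp p ≠ q ∧ opp p ≠ opp q :=
        fun h => ⟨fun e => h (Prod.ext_iff.1 e).1, fun e => h (Prod.ext_iff.1 e).1,
          fun e => h (Prod.ext_iff.1 e).1, fun e => h (Prod.ext_iff.1 e).1⟩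
      rw [hf.card, Finset.card_insert_of_notMem, Finset.card_insert_of_notMem,
        Finset.card_insert_of_notMem, Finset.card_insert_of_notMem, Finset.card_insert_of_notMem,
        Finset.card_insert_of_notMem, Finset.card_insert_of_notMem, Finset.card_singleton] <;>
      simp only [Finset.mem_insert, Finset.mem_singleton, hd, hne n01, hne n02, hne n03, hne n12,
        hne n13, hne n23, not_false_eq_true, or_self]
  have hq : ∀ q, G.face 2 (Sum.inl q) = f → q = p0 ∨ q = opp p0 ∨ q = p1 ∨ q = opp p1 ∨
      q = p2 ∨ q = opp p2 ∨ q = p3 ∨ q = opp p3 := fun q hq => by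
    have := mem_legs.2 hq
    rw [hlegs] at this
    simpa using this
  refine ⟨p1, p2, p3, h01, h12, h23, ?_, h1, h2, h3, n01, n02, n03, n12, n13, n23, ?_⟩
  · obtain ⟨q, hq1, hq2⟩ := exists_leg_pair hf.mark h3
    have m3 := hstep h3 hq2 hq1
    have m2 := htwo h2 h3 hq2 h23 hq1
    rcases hq q hq2 with rfl | rfl | rfl | rfl | rfl | rfl | rfl | rfl
    · exact hq1
    · rw [opp_opp] at hq1
      rw [hq1]
      -- the leg `p0` is already joined to `opp p1`
      have := G.pair_injective (a₁ := Sum.inl p3) (a₂ := Sum.inl (opp p1))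
        (by rw [hq1, ← h01, G.pair_pair])
      exact absurd (congrArg Prod.fst (Sum.inl.inj this)) n13.symm
    · have := G.pair_injective (h01.trans hq1.symm)
      exact absurd (congrArg Prod.fst (Sum.inl.inj this)) n03
    · rw [opp_opp] at hq1
      have := G.pair_injective (a₁ := Sum.inl p3) (a₂ := Sum.inl (opp p2))
        (by rw [hq1, ← h12, G.pair_pair])
      exact absurd (congrArg Prod.fst (Sum.inl.inj this)) n23.symm
    · exact absurd rfl m2
    · exact absurd rfl m2
    · exact absurd rfl m3
    · exact absurd rfl m3
  · intro q hq'
    rcases hq q hq' with rfl | rfl | rfl | rfl | rfl | rfl | rfl | rfl <;> simp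

end MarkedGraph
end QuarticMultiMatrix

namespace QuarticMultiMatrix
open Module
namespace MarkedGraph
variable {V M : Type} {G : MarkedGraph V M}

/-! ### Crossings of straight faces -/

variable (G) in
/-- The straight face which crosses the straight face through the leg `p` at its bubble. -/
abbrev cross (p : V × Leg) : G.Face 2 := G.face 2 (Sum.inl (p.1, p.2 + dir 0))

variable (G) in
/-- Two bubbles lie on a common straight face. -/
def Near (u v : V) : Prop := ∃ a b, G.face 2 (Sum.inl (u, a)) = G.face 2 (Sum.inl (v, b))

/-- A straight face is even if it is regular, and the faces which it crosses are regular and cross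
it an even number of times. -/
structure Even [Fintype V] (f : G.Face 2) : Prop where
  regular : Regular f
  cross : ∀ p : V × Leg, G.face 2 (Sum.inl p) = f → Regular (G.cross p) ∧
    ∑ v, G.faceWord f v * G.faceWord (G.cross p) v = 0

theorem face_eq_or_eq_cross {p q : V × Leg} (h : q.1 = p.1) :
    G.face 2 (Sum.inl q) = G.face 2 (Sum.inl p) ∨ G.face 2 (Sum.inl q) = G.cross p := by
  obtain ⟨v, a⟩ := p
  obtain ⟨w, b⟩ := q
  obtain rfl : w = v := h
  have h4 : b = a ∨ b = a + dir 2 ∨ b = a + dir 0 ∨ b = a + dir 0 + dir 2 := by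
    revert a b; decide
  rcases h4 with rfl | rfl | rfl | rfl
  · exact Or.inl rfl
  · exact Or.inl (G.face_add_dir _ _ _)
  · exact Or.inr rfl
  · exact Or.inr (G.face_add_dir _ _ _)

theorem cross_ne {p : V × Leg} (h : ¬ G.IsLoop 2 p.1) : G.cross p ≠ G.face 2 (Sum.inl p) := by
  intro h'
  have h2 : ∀ a : Leg, ¬ (a + dir 0 = a ∨ a + dir 0 = a + dir 2) := by decide
  exact h2 _ (face_eq_of_not_loop h h'.symm)

theorem cross_cross (p : V × Leg) : G.cross (p.1, p.2 + dir 0) = G.face 2 (Sum.inl p) := by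
  simp only [cross, leg_add_add]

theorem cross_opp (p : V × Leg) : G.cross (opp p) = G.cross p := by
  have h : ∀ a : Leg, a + dir 2 + dir 0 = a + dir 0 + dir 2 := by decide
  simp only [cross, h]
  exact G.face_add_dir _ _ _

theorem jump_two_eq {s : Ends V M → ZMod 2} (hs : s ∈ G.inv 2) (p : V × Leg) :
    jump 2 s p.1 = s (Sum.inl p) + s (Sum.inl (p.1, p.2 + dir 0)) := by
  rw [apply_add_dir hs (by decide)]
  generalize s (Sum.inl (p.1, p.2)) = x, jump 2 s p.1 = y
  revert x y; decide

/-- Bubbles which are crossings of the same two straight faces are not told apart by the words of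
straight faces. -/
theorem single_add_single_mem_wordsOrth [Fintype V] [DecidableEq V] {p q : V × Leg}
    (h : G.face 2 (Sum.inl p) = G.face 2 (Sum.inl q)) (h' : G.cross p = G.cross q) :
    Pi.single p.1 1 + Pi.single q.1 1 ∈ G.wordsOrth 2 := by
  rintro _ ⟨s, hs, rfl⟩
  simp only [Pi.add_apply, add_mul, Finset.sum_add_distrib, Pi.single_apply, ite_mul, one_mul,
    zero_mul, Finset.sum_ite_eq', Finset.mem_univ, if_true]
  rw [jump_two_eq hs p, jump_two_eq hs q, apply_eq_of_face_eq hs h, apply_eq_of_face_eq hs h']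
  exact CharTwo.add_self_eq_zero _

/-- Four objects, each of which occurs an even number of times, are matched in pairs. -/
theorem pairs_of_even {α : Type*} [DecidableEq α] {g0 g1 g2 g3 : α}
    (e0 : (if g0 = g0 then 1 else 0) + ((if g1 = g0 then 1 else 0) +
      ((if g2 = g0 then 1 else 0) + (if g3 = g0 then 1 else 0))) = (0 : ZMod 2))
    (e1 : (if g0 = g1 then 1 else 0) + ((if g1 = g1 then 1 else 0) +
      ((if g2 = g1 then 1 else 0) + (if g3 = g1 then 1 else 0))) = (0 : ZMod 2))
    (e2 : (if g0 = g2 then 1 else 0) + ((if g1 = g2 then 1 else 0) +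
      ((if g2 = g2 then 1 else 0) + (if g3 = g2 then 1 else 0))) = (0 : ZMod 2)) :
    (g0 = g2 ∧ g1 = g3) ∨ (g0 = g1 ∧ g2 = g3) ∨ (g0 = g3 ∧ g1 = g2) := by
  have hz : (1 : ZMod 2) + 1 = 0 := rfl
  by_cases c01 : g0 = g1
  · subst c01
    refine Or.inr (Or.inl ⟨rfl, ?_⟩)
    by_contra h
    rw [if_neg (Ne.symm h), if_pos rfl] at e2
    split_ifs at e2 <;> exact absurd e2 (by decide)
  by_cases c02 : g0 = g2
  · subst c02
    refine Or.inl ⟨rfl, ?_⟩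
    by_contra h
    rw [if_neg (Ne.symm h), if_pos rfl] at e1
    split_ifs at e1
    exact absurd e1 (by decide)
  by_cases c03 : g0 = g3
  · subst c03
    refine Or.inr (Or.inr ⟨rfl, ?_⟩)
    by_contra h
    rw [if_neg c01, if_pos rfl, if_neg (Ne.symm h)] at e1
    revert e1; decide
  · rw [if_pos rfl, if_neg (Ne.symm c01), if_neg (Ne.symm c02), if_neg (Ne.symm c03)] at e0
    exact absurd e0 (by decide)

theorem Even.cross_eq [Fintype V] {f : G.Face 2} (hf : Even f) {p0 p1 p2 p3 : V × Leg}
    (h0 : G.face 2 (Sum.inl p0) = f) (h1 : G.face 2 (Sum.inl p1) = f)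
    (h2 : G.face 2 (Sum.inl p2) = f) (h3 : G.face 2 (Sum.inl p3) = f)
    (n01 : p0.1 ≠ p1.1) (n02 : p0.1 ≠ p2.1) (n03 : p0.1 ≠ p3.1) (n12 : p1.1 ≠ p2.1)
    (n13 : p1.1 ≠ p3.1) (n23 : p2.1 ≠ p3.1)
    (hall : ∀ q : V × Leg, G.face 2 (Sum.inl q) = f →
        q.1 = p0.1 ∨ q.1 = p1.1 ∨ q.1 = p2.1 ∨ q.1 = p3.1) :
    (G.cross p0 = G.cross p2 ∧ G.cross p1 = G.cross p3) ∨
    (G.cross p0 = G.cross p1 ∧ G.cross p2 = G.cross p3) ∨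
    (G.cross p0 = G.cross p3 ∧ G.cross p1 = G.cross p2) := by
  classical
  have hloop : ∀ {p : V × Leg}, G.face 2 (Sum.inl p) = f → ¬ G.IsLoop 2 p.1 :=
    fun {p} hp => hf.regular.loop p.1 p.2 hp
  have hw : ∀ {p q : V × Leg}, G.face 2 (Sum.inl p) = f → G.face 2 (Sum.inl q) = f →
      G.faceWord (G.cross q) p.1 = if G.cross p = G.cross q then 1 else 0 := by
    intro p q hp hq
    split_ifs with h
    · exact (faceWord_eq_one_iff (hloop hp)).2 ⟨_, h⟩
    · by_contra h'
      have h1 : ∀ z : ZMod 2, z ≠ 0 → z = 1 := by decide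
      obtain ⟨a, ha⟩ := (faceWord_eq_one_iff (hloop hp)).1 (h1 _ h')
      rcases face_eq_or_eq_cross (G := G) (p := p) (q := (p.1, a)) rfl with h2 | h2
      · exact cross_ne (hloop hq) (ha.symm.trans (h2.trans (hp.trans hq.symm)))
      · exact h (h2.symm.trans ha)
  have hsum : ∀ {q : V × Leg}, G.face 2 (Sum.inl q) = f →
      (if G.cross p0 = G.cross q then 1 else 0) + ((if G.cross p1 = G.cross q then 1 else 0) +
      ((if G.cross p2 = G.cross q then 1 else 0) + (if G.cross p3 = G.cross q then 1 else 0))) =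
        (0 : ZMod 2) := by
    intro q hq
    refine Eq.trans (Eq.symm ?_) (hf.cross q hq).2
    rw [← Finset.sum_subset (Finset.subset_univ {p0.1, p1.1, p2.1, p3.1}),
      Finset.sum_insert, Finset.sum_insert, Finset.sum_insert, Finset.sum_singleton, hw h0 hq,
      hw h1 hq, hw h2 hq, hw h3 hq, (faceWord_eq_one_iff (hloop h0)).2 ⟨_, h0⟩,
      (faceWord_eq_one_iff (hloop h1)).2 ⟨_, h1⟩, (faceWord_eq_one_iff (hloop h2)).2 ⟨_, h2⟩,
      (faceWord_eq_one_iff (hloop h3)).2 ⟨_, h3⟩]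
    · simp only [one_mul]
    · simp [n23]
    · simp [n12, n13]
    · simp [n01, n02, n03]
    · intro v _ hv
      have : G.faceWord f v ≠ 1 := by
        intro h
        by_cases hl : G.IsLoop 2 v
        · rw [word_eq_zero_of_isLoop hl (faceWord_mem f)] at h
          exact zero_ne_one h
        · obtain ⟨a, ha⟩ := (faceWord_eq_one_iff hl).1 h
          exact hv (by simpa using hall (v, a) ha)
      have h1 : ∀ z : ZMod 2, z ≠ 1 → z = 0 := by decide
      rw [h1 _ this, zero_mul]
  exact pairs_of_even (hsum h0) (hsum h1) (hsum h2)

/-- Two straight faces whose four crossings alternate along one of them would be told apart: the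
word supported by two opposite bubbles of a straight face is not a word of colour `1`, nor when it
is modified far away. -/
theorem not_mem_words_of_alternating [Fintype V] [DecidableEq V] {f : G.Face 2}
    {p0 p1 p2 p3 : V × Leg} (h1 : G.face 2 (Sum.inl p1) = f)
    (e12 : G.pair (Sum.inl p1) = Sum.inl (opp p2))
    (e23 : G.pair (Sum.inl p2) = Sum.inl (opp p3))
    (n01 : p0.1 ≠ p1.1) (n02 : p0.1 ≠ p2.1) (n03 : p0.1 ≠ p3.1) (n12 : p1.1 ≠ p2.1)
    (n23 : p2.1 ≠ p3.1) (hc13 : G.cross p1 = G.cross p3) (hc0 : G.cross p1 ≠ G.cross p0)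
    (hc2 : G.cross p1 ≠ G.cross p2) (hf0 : G.face 2 (Sum.inl p0) = f)
    (hf2 : G.face 2 (Sum.inl p2) = f) (hl : ¬ G.IsLoop 2 p1.1) {y : V → ZMod 2}
    (y1 : y p1.1 = 0) (y2 : y p2.1 = 0) (y3 : y p3.1 = 0)
    (yc : ∀ u a, G.face 2 (Sum.inl (u, a)) = G.cross p1 → y u = 0) :
    Pi.single p0.1 1 + Pi.single p2.1 1 + y ∉ G.words 0 := by
  rintro ⟨s, hs, hx⟩
  have hxv : ∀ v, jump 0 s v = (Pi.single p0.1 1 + Pi.single p2.1 1 + y : V → ZMod 2) v :=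
    fun v => congrFun hx v
  have j1 : jump 0 s p1.1 = 0 := by simp [hxv, n01.symm, n12, y1]
  have j3 : jump 0 s p3.1 = 0 := by simp [hxv, n03.symm, n23.symm, y3]
  have j2 : jump 0 s p2.1 = 1 := by simp [hxv, n02.symm, y2]
  -- `s` is constant along the face that crosses `f` at `p1` and `p3`
  have hcross : s (Sum.inl (p1.1, p1.2 + dir 0)) = s (Sum.inl (p3.1, p3.2 + dir 0)) := by
    have hP := mem_of_face_eq (c := 2) (fun z : Ends V M => G.face 2 z = G.cross p1 ∧
      s z = s (Sum.inl (p1.1, p1.2 + dir 0))) ?_ ?_ hc13 ⟨rfl, rfl⟩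
    · exact hP.2.symm
    · rintro z ⟨hz, hz'⟩
      exact ⟨(G.face_pair 2 z).trans hz, (hs.1 z).trans hz'⟩
    · rintro z ⟨hz, hz'⟩
      refine ⟨(G.face_turn 2 z).trans hz, ?_⟩
      rw [← hz']
      rcases z with ⟨v, a⟩ | ⟨m, b⟩
      · have hv : ∀ p : V × Leg, G.face 2 (Sum.inl p) = f → G.cross p1 ≠ G.cross p → v ≠ p.1 := by
          rintro p hp hne rfl
          rcases face_eq_or_eq_cross (G := G) (p := p) (q := (p.1, a)) rfl with h | h
          · exact cross_ne hl (hz.symm.trans (h.trans (hp.trans h1.symm)))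
          · exact hne (hz.symm.trans h)
        refine apply_eq_of_jump_eq_zero hs ?_ _ _
        rw [hxv]
        simp [hv p0 hf0 hc0, hv p2 hf2 hc2, yc v a hz]
      · exact mem_inv_mark hs m _ _
  have k1 := apply_eq_of_jump_eq_zero hs j1 p1.2 (p1.2 + dir 0)
  have k3 := apply_eq_of_jump_eq_zero hs j3 (p3.2 + dir 0) (p3.2 + dir 2)
  have k2 := apply_add_dir hs (j := 2) (by decide) p2.1 p2.2
  have m1 := hs.1 (Sum.inl p1)
  have m2 := hs.1 (Sum.inl p2)
  rw [e12] at m1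
  rw [e23] at m2
  rw [← m1] at k1
  rw [← k3, ← hcross, ← k1] at m2
  rw [j2, ← m2] at k2
  change s (Sum.inl (opp p2)) = _ at k2
  generalize s (Sum.inl (opp p2)) = z at k2
  revert z; decide

/-- Two parallel edges between the crossings of two straight faces would form a dipole if the word
supported by these crossings were a word of the colours `1` and `2`. -/
theorem not_mem_words_of_parallel [DecidableEq V] (hN : G.NoDipole) {v w : V} (hvw : v ≠ w)
    {a b c d : Leg} (h : G.pair (Sum.inl (v, a)) = Sum.inl (w, b))
    (h' : G.pair (Sum.inl (v, c)) = Sum.inl (w, d)) (hc : c ≠ a ∧ c ≠ a + dir 2)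
    (hd : d ≠ b ∧ d ≠ b + dir 2) {y : V → ZMod 2} (yw : y w = 0) :
    Pi.single v 1 + Pi.single w 1 + y ∉ G.words 0 ⊓ G.words 1 := by
  intro hx
  have hxw : (Pi.single v 1 + Pi.single w 1 + y : V → ZMod 2) w = 1 := by
    simp [hvw.symm, yw]
  have key : ∀ i j : Fin 3, i ≠ j → c = a + dir i → d = b + dir j →
      Pi.single v 1 + Pi.single w 1 + y ∉ G.words i := by
    rintro i j hij rfl rfl ⟨s, hs, hsx⟩
    have h1 := hs.1 (Sum.inl (v, a))
    have h2 := hs.1 (Sum.inl (v, a + dir i))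
    rw [h] at h1
    rw [h', apply_add_dir_self hs, apply_add_dir hs hij.symm, hsx, hxw, h1] at h2
    generalize s (Sum.inl (v, a)) = z at h2
    revert z; decide
  have h01 : ∀ x z : Leg, x ≠ z ∧ x ≠ z + dir 2 → x = z + dir 0 ∨ x = z + dir 1 := by decide
  rcases h01 _ _ hc with hc | hc <;> rcases h01 _ _ hd with hd | hd
  · subst hc hd; exact hN 0 v w a b hvw h h'
  · exact key 0 1 (by decide) hc hd hx.1
  · exact key 1 0 (by decide) hc hd hx.2
  · subst hc hd; exact hN 1 v w a b hvw h h'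

end MarkedGraph
end QuarticMultiMatrix

namespace QuarticMultiMatrix
open Module
namespace MarkedGraph
variable {V M : Type} {G : MarkedGraph V M}

theorem Near.refl (v : V) : G.Near v v := ⟨0, 0, rfl⟩

theorem near_of_face_eq {p q : V × Leg} (h : G.face 2 (Sum.inl p) = G.face 2 (Sum.inl q)) :
    G.Near p.1 q.1 := ⟨p.2, q.2, h⟩

/-- The case of two bubbles joined by two edges which lie on distinct straight faces. -/
theorem exists_partner_of_parallel [Fintype V] [DecidableEq V] (hN : G.NoDipole) {v w : V}
    (hvw : v ≠ w) {a b c d : Leg} (h : G.pair (Sum.inl (v, a)) = Sum.inl (w, b))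
    (h' : G.pair (Sum.inl (v, c)) = Sum.inl (w, d))
    (hne : G.face 2 (Sum.inl (v, a)) ≠ G.face 2 (Sum.inl (v, c))) :
    ∃ w, w ≠ v ∧ G.Near v w ∧ Pi.single v 1 + Pi.single w 1 ∈ G.wordsOrth 2 ∧
      ∀ y : V → ZMod 2, (∀ u u', G.Near v u' → G.Near u' u → y u = 0) →
        Pi.single v 1 + Pi.single w 1 + y ∉ G.words 0 ⊓ G.words 1 := by
  have hb : G.face 2 (Sum.inl (w, b)) = G.face 2 (Sum.inl (v, a)) := by rw [← h, G.face_pair]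
  have hd : G.face 2 (Sum.inl (w, d)) = G.face 2 (Sum.inl (v, c)) := by rw [← h', G.face_pair]
  have hne' : G.face 2 (Sum.inl (w, d)) ≠ G.face 2 (Sum.inl (w, b)) := by
    rw [hb, hd]; exact hne.symm
  have hnear : G.Near v w := near_of_face_eq (p := (v, a)) (q := (w, b)) hb.symm
  have hca := (face_eq_or_eq_cross (G := G) (p := (v, a)) (q := (v, c)) rfl).resolve_left hne.symm
  have hdb := (face_eq_or_eq_cross (G := G) (p := (w, b)) (q := (w, d)) rfl).resolve_left hne'
  have hleg : ∀ {v : V} {a c : Leg}, G.face 2 (Sum.inl (v, c)) ≠ G.face 2 (Sum.inl (v, a)) →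
      c ≠ a ∧ c ≠ a + dir 2 := by
    refine fun {v a c} h => ⟨?_, ?_⟩
    · rintro rfl; exact h rfl
    · rintro rfl; exact h (G.face_add_dir _ _ _)
  refine ⟨w, hvw.symm, hnear, single_add_single_mem_wordsOrth (p := (v, a)) (q := (w, b)) hb.symm ?_,
    fun y hy => not_mem_words_of_parallel hN hvw h h' (hleg hne.symm) (hleg hne')
      (hy w w hnear (Near.refl w))⟩
  rw [← hca, ← hdb, hd]

/-- Around a bubble on two even straight faces there is a word orthogonal to the straight faces
which is not a word of the colours `1` and `2`, even when it is modified far away. -/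
theorem exists_partner [Fintype V] [DecidableEq V] (hN : G.NoDipole) {v : V}
    (hv : ∀ a, Even (G.face 2 (Sum.inl (v, a)))) :
    ∃ w, w ≠ v ∧ G.Near v w ∧ Pi.single v 1 + Pi.single w 1 ∈ G.wordsOrth 2 ∧
      ∀ y : V → ZMod 2, (∀ u u', G.Near v u' → G.Near u' u → y u = 0) →
        Pi.single v 1 + Pi.single w 1 + y ∉ G.words 0 ⊓ G.words 1 := by
  have halt : ∀ {p0 p1 p2 p3 : V × Leg}, p0.1 = v →
      G.pair (Sum.inl p1) = Sum.inl (opp p2) → G.pair (Sum.inl p2) = Sum.inl (opp p3) →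
      G.face 2 (Sum.inl p1) = G.face 2 (Sum.inl p0) →
      G.face 2 (Sum.inl p2) = G.face 2 (Sum.inl p0) →
      G.face 2 (Sum.inl p3) = G.face 2 (Sum.inl p0) →
      p0.1 ≠ p1.1 → p0.1 ≠ p2.1 → p0.1 ≠ p3.1 → p1.1 ≠ p2.1 → p2.1 ≠ p3.1 →
      G.cross p0 = G.cross p2 → G.cross p1 = G.cross p3 → G.cross p1 ≠ G.cross p0 →
      ∃ w, w ≠ v ∧ G.Near v w ∧ Pi.single v 1 + Pi.single w 1 ∈ G.wordsOrth 2 ∧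
        ∀ y : V → ZMod 2, (∀ u u', G.Near v u' → G.Near u' u → y u = 0) →
          Pi.single v 1 + Pi.single w 1 + y ∉ G.words 0 ⊓ G.words 1 := by
    rintro p0 p1 p2 p3 rfl e12 e23 h1 h2 h3 n01 n02 n03 n12 n23 hc02 hc13 hc10
    refine ⟨p2.1, n02.symm, near_of_face_eq h2.symm,
      single_add_single_mem_wordsOrth h2.symm hc02, fun y hy hx => ?_⟩
    have hy' : ∀ {p : V × Leg}, G.face 2 (Sum.inl p) = G.face 2 (Sum.inl p0) → y p.1 = 0 :=
      fun {p} hp => hy p.1 p.1 (near_of_face_eq hp.symm) (Near.refl _)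
    exact not_mem_words_of_alternating h1 e12 e23 n01 n02 n03 n12 n23 hc13 hc10
      (by rwa [← hc02]) rfl h2 ((hv p0.2).regular.loop p1.1 p1.2 h1) (hy' h1) (hy' h2) (hy' h3)
      (fun u a hu => hy u p1.1 (near_of_face_eq h1.symm) ⟨_, a, hu.symm⟩) hx.1
  -- either the crossings alternate along the face, or two consecutive ones belong to the same face
  have hstart : (∃ w, w ≠ v ∧ G.Near v w ∧ Pi.single v 1 + Pi.single w 1 ∈ G.wordsOrth 2 ∧
      ∀ y : V → ZMod 2, (∀ u u', G.Near v u' → G.Near u' u → y u = 0) →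
        Pi.single v 1 + Pi.single w 1 + y ∉ G.words 0 ⊓ G.words 1) ∨
      ∃ p0 p1 : V × Leg, p0.1 = v ∧ G.pair (Sum.inl p0) = Sum.inl (opp p1) ∧
        G.cross p0 = G.cross p1 := by
    have hf := hv 0
    obtain ⟨p1, p2, p3, e01, e12, e23, e30, h1, h2, h3, n01, n02, n03, n12, n13, n23, hall⟩ :=
      hf.regular.exists_cycle (p0 := (v, 0)) rfl
    have hT := hf.cross_eq rfl h1 h2 h3 n01 n02 n03 n12 n13 n23 hall
    by_cases h01 : G.cross (v, 0) = G.cross p1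
    · exact Or.inr ⟨(v, 0), p1, rfl, e01, h01⟩
    · rcases hT with ⟨hc02, hc13⟩ | ⟨h, -⟩ | ⟨hc03, -⟩
      · exact Or.inl (halt rfl e12 e23 h1 h2 h3 n01 n02 n03 n12 n23 hc02 hc13 (Ne.symm h01))
      · exact absurd h h01
      · refine Or.inr ⟨opp (v, 0), opp p3, rfl, ?_, ?_⟩
        · rw [opp_opp, ← e30, G.pair_pair]
        · rw [cross_opp, cross_opp, hc03]
  rcases hstart with h | ⟨p0, p1, rfl, e01, h01⟩
  · exact h
  have hf := hv p0.2
  obtain ⟨p1', p2, p3, e01', e12, e23, e30, h1, h2, h3, n01, n02, n03, n12, n13, n23, hall⟩ :=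
    hf.regular.exists_cycle (p0 := p0) rfl
  obtain rfl : p1' = p1 := by
    have := Sum.inl.inj (e01'.symm.trans e01)
    rw [← opp_opp p1', this, opp_opp]
  have hT := hf.cross_eq rfl h1 h2 h3 n01 n02 n03 n12 n13 n23 hall
  have hfl : ∀ {p : V × Leg}, G.face 2 (Sum.inl p) = G.face 2 (Sum.inl p0) →
      G.cross p ≠ G.face 2 (Sum.inl p0) := fun {p} hp h =>
    cross_ne (hf.regular.loop p.1 p.2 hp) (h.trans hp.symm)
  have hg := hv (p0.2 + dir 0)
  obtain ⟨q1, q2, q3, f01, f12, f23, f30, k1, k2, k3, m01, m02, m03, m12, m13, m23, gall⟩ :=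
    hg.regular.exists_cycle (p0 := (p0.1, p0.2 + dir 0)) rfl
  -- the edges of `f` and of the face across it which join `p0` to neighbouring bubbles
  have hdig : ∀ {r : V × Leg} {a b : Leg}, G.pair (Sum.inl (p0.1, a)) = Sum.inl (r.1, b) →
      G.face 2 (Sum.inl (p0.1, a)) = G.face 2 (Sum.inl p0) → p0.1 ≠ r.1 →
      (r.1 = q1.1 ∨ r.1 = q3.1) →
      ∃ w, w ≠ p0.1 ∧ G.Near p0.1 w ∧ Pi.single p0.1 1 + Pi.single w 1 ∈ G.wordsOrth 2 ∧
        ∀ y : V → ZMod 2, (∀ u u', G.Near p0.1 u' → G.Near u' u → y u = 0) →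
          Pi.single p0.1 1 + Pi.single w 1 + y ∉ G.words 0 ⊓ G.words 1 := by
    intro r a b hab hfa hr hrq
    rcases hrq with h | h
    · refine exists_partner_of_parallel hN hr hab (c := p0.2 + dir 0) (d := (opp q1).2)
        (by rw [f01, h]) ?_
      rw [hfa]; exact (hfl rfl).symm
    · refine exists_partner_of_parallel hN hr hab (c := p0.2 + dir 0 + dir 2) (d := q3.2) ?_ ?_
      · rw [h, ← G.pair_pair (Sum.inl (q3.1, q3.2)), f30]
      · rw [hfa, G.face_add_dir]; exact (hfl rfl).symm
  rcases gall (p1'.1, p1'.2 + dir 0) h01.symm with h | h | h | h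
  · exact absurd h.symm n01
  · exact hdig e01 rfl n01 (Or.inl h)
  · by_cases h03 : G.cross p0 = G.cross p3
    · refine hdig (r := p3) (a := p0.2 + dir 2) (b := p3.2)
        (by rw [← G.pair_pair (Sum.inl (p3.1, p3.2)), e30]) (G.face_add_dir _ _ _) n03 ?_
      rcases gall (p3.1, p3.2 + dir 0) h03.symm with h' | h' | h' | h'
      · exact absurd h'.symm n03
      · exact Or.inl h'
      · exact absurd (h.trans h'.symm) n13
      · exact Or.inr h'
    · -- the two faces cross at `p0` and `p1` only, which are opposite on the second face
      have h02 : G.cross p0 ≠ G.cross p2 := by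
        rcases hT with ⟨-, h'⟩ | ⟨-, h'⟩ | ⟨h', -⟩
        · exact absurd (h01.trans h') h03
        · exact fun h => h03 (h.trans h')
        · exact absurd h' h03
      have hq0 : G.cross (p0.1, p0.2 + dir 0) = G.face 2 (Sum.inl p0) := cross_cross p0
      have hq2 : G.cross q2 = G.face 2 (Sum.inl p0) := by
        rcases face_eq_or_eq_cross (G := G) (p := q2) (q := p1') h with h' | h'
        · exact absurd (k2.symm.trans (h'.symm.trans h1)) (hfl rfl)
        · exact h'.symm.trans h1
      have hqne : ∀ {q : V × Leg}, G.face 2 (Sum.inl q) = G.cross p0 → p0.1 ≠ q.1 → q.1 ≠ p1'.1 →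
          G.cross q ≠ G.face 2 (Sum.inl p0) := by
        intro q hq hq0 hq1 hqf
        have hbad : ∀ {p : V × Leg}, q.1 = p.1 → G.face 2 (Sum.inl p) = G.face 2 (Sum.inl p0) →
            G.cross p0 = G.cross p := by
          intro p hqp hp
          rcases face_eq_or_eq_cross (G := G) hqp with h' | h'
          · exact absurd (hq.symm.trans (h'.trans hp)) (hfl rfl)
          · exact hq.symm.trans h'
        rcases hall _ hqf with h' | h' | h' | h'
        · exact hq0 h'.symm
        · exact hq1 h'
        · exact h02 (hbad h' h2)
        · exact h03 (hbad h' h3)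
      have hc1 := hqne k1 m01 (fun h' => m12 (h'.trans h))
      have hc3 := hqne k3 m03 (fun h' => m23 (h.symm.trans h'.symm))
      have hc13 : G.cross q1 = G.cross q3 := by
        rcases hg.cross_eq rfl k1 k2 k3 m01 m02 m03 m12 m13 m23 gall with ⟨-, h'⟩ | ⟨h', -⟩ | ⟨h', -⟩
        · exact h'
        · exact absurd (h'.symm.trans hq0) hc1
        · exact absurd (h'.symm.trans hq0) hc3
      exact halt (p0 := (p0.1, p0.2 + dir 0)) rfl f12 f23 k1 k2 k3 m01 m02 m03 m12 m23
        (hq0.trans hq2.symm) hc13 (by rw [hq0]; exact hc1)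
  · exact hdig e01 rfl n01 (Or.inr h)

end MarkedGraph
end QuarticMultiMatrix

namespace QuarticMultiMatrix
open Module
namespace MarkedGraph
variable {V M : Type} {G : MarkedGraph V M}

/-! ### A connected graph without dipoles has a bounded number of bubbles -/

/-- Straight faces go through an even number of bubbles, since the edges join half-edges of opposite
colours while the strands of colour `3` join half-edges of the same colour. -/
theorem four_dvd_card_legs [Fintype V] [Fintype M] (f : G.Face 2) : 4 ∣ (G.legs f).card := by
  classical
  let A : ZMod 2 → Finset (V × Leg) := fun c => (G.legs f).filter fun p => G.colour (Sum.inl p) = c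
  let B : ZMod 2 → Finset (M × ZMod 2) := fun c =>
    Finset.univ.filter fun q => G.face 2 (Sum.inr q) = f ∧ G.colour (Sum.inr q) = c
  let W : ZMod 2 → Finset (Ends V M) := fun c =>
    Finset.univ.filter fun x => G.face 2 x = f ∧ G.colour x = c
  have hW : ∀ c, (W c).card = (A c).card + (B c).card := by
    intro c
    rw [← Finset.card_disjSum]
    congr 1
    ext x
    rcases x with p | q <;> simp [W, A, B, mem_legs]
  have hW01 : (W 0).card = (W 1).card := by
    refine Finset.card_nbij' G.pair G.pair ?_ ?_ (fun x _ => G.pair_pair x) (fun x _ => G.pair_pair x)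
    all_goals
      intro x hx
      simp only [W, Finset.coe_filter, Finset.mem_univ, true_and, Set.mem_ofPred_eq] at hx ⊢
      refine ⟨(G.face_pair 2 x).trans hx.1, ?_⟩
      rw [colour_pair_eq, hx.2]
      decide
  have hmark : ∀ q : M × ZMod 2, G.colour (Sum.inr (q.1, q.2 + 1)) = G.colour (Sum.inr q) + 1 := by
    intro q
    simp only [colour, Sum.elim_inr]
    ring
  have hz : ∀ b : ZMod 2, b + 1 + 1 = b := by decide
  have hB01 : (B 0).card = (B 1).card := by
    refine Finset.card_nbij' (fun q => (q.1, q.2 + 1)) (fun q => (q.1, q.2 + 1)) ?_ ?_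
      (fun q _ => by simp [hz]) (fun q _ => by simp [hz])
    all_goals
      intro q hq
      simp only [B, Finset.coe_filter, Finset.mem_univ, true_and, Set.mem_ofPred_eq] at hq ⊢
      refine ⟨(G.face_turn 2 (Sum.inr q)).trans hq.1, ?_⟩
      rw [hmark, hq.2]
      decide
  have hA : ∀ c, 2 ∣ (A c).card := by
    intro c
    have h : ∑ p ∈ A c, (1 : ZMod 2) = 0 := by
      refine Finset.sum_involution (fun p _ => opp p) (fun _ _ => rfl) (fun p _ _ h => ?_)
        (fun p hp => ?_) (fun p _ => opp_opp p)
      · have h3 := (Prod.ext_iff.1 h).2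
        exact dir_ne_zero 2 (by simpa using h3)
      · simp only [A, Finset.mem_filter, mem_legs] at hp ⊢
        rw [face_opp, colour_opp]
        exact hp
    rw [Finset.sum_const, nsmul_one, ZMod.natCast_eq_zero_iff] at h
    exact h
  have hsplit : (G.legs f).card = (A 0).card + (A 1).card := by
    rw [← Finset.card_filter_add_card_filter_not (s := G.legs f)
      (fun p => G.colour (Sum.inl p) = 0)]
    congr 2
    have h01 : ∀ z : ZMod 2, ¬ z = 0 ↔ z = 1 := by decide
    simp only [h01]
    rfl
  have h0 := hA 0
  have h1 := hW 0
  have h2 := hW 1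
  omega

open Classical in
variable (G) in
/-- The bubbles where the two straight strands belong to the same face. -/
noncomputable def loops [Fintype V] : Finset V := Finset.univ.filter fun v => G.IsLoop 2 v

theorem card_loops_le [Fintype V] [Fintype M] [Nonempty (Ends V M)] (hG : G.Connected) {D : ℕ}
    (hD : G.defect ≤ D) : G.loops.card ≤ 2 ^ D := by
  classical
  by_contra hlt
  push Not at hlt
  obtain ⟨v, hv, u, hu, -, hu1, hX⟩ := exists_lt_card_fiber_sub_mem (G.wordsOrth 2)
    (G.words 0 ⊓ G.words 1) (inf_words_le_wordsOrth (by decide)) D 1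
    (finrank_wordsOrth_le hG hD (by decide) (by decide) (by decide)) G.loops
    (fun v => Pi.single v 1) (fun v hv => single_mem_wordsOrth (Finset.mem_filter.1 hv).2)
    (by omega)
  obtain ⟨w, hw, hwv⟩ := Finset.exists_mem_ne hu1 v
  have h2 := words_inf_words_le (i := 0) (j := 1) (k := 2) (by decide) (by decide) (by decide)
    (hX w hw)
  have h3 := word_eq_zero_of_isLoop (Finset.mem_filter.1 hv).2 h2
  simp [hwv.symm] at h3

open Classical in
variable (G) in
/-- The bubbles on the straight faces which are not regular. -/
noncomputable def irregular [Fintype V] : Finset V :=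
  (Finset.univ.filter fun p : V × Leg => ¬ Regular (G.face 2 (Sum.inl p))).image Prod.fst

theorem regular_of_notMem_irregular [Fintype V] {v : V} (hv : v ∉ G.irregular) (a : Leg) :
    Regular (G.face 2 (Sum.inl (v, a))) := by
  classical
  by_contra h
  exact hv (Finset.mem_image.2 ⟨(v, a), Finset.mem_filter.2 ⟨Finset.mem_univ _, h⟩, rfl⟩)

/-- The total length of the irregular straight faces is bounded: the average length of a straight
face is about four, and the faces shorter than this are loops or carry marks. -/
theorem card_irregular_le [Fintype V] [Fintype M] [Nonempty V] (hG : G.Connected)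
    (hN : G.NoDipole) {D : ℕ} (hD : G.defect ≤ D) :
    G.irregular.card ≤ 12 * D + 20 * (Fintype.card M + 2 ^ D) := by
  classical
  let Q : Finset (G.Face 2) := Finset.univ.filter fun f =>
    (∃ m b, G.face 2 (Sum.inr (m, b)) = f) ∨ ∃ v a, G.face 2 (Sum.inl (v, a)) = f ∧ G.IsLoop 2 v
  have hQ : Q.card ≤ Fintype.card M + 2 ^ D := by
    have hsub : Q ⊆ (Finset.univ.image fun m : M => G.face 2 (Sum.inr (m, 0))) ∪
        (G.loops.image fun v => G.face 2 (Sum.inl (v, 0))) := by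
      intro f hf
      rw [Finset.mem_union, Finset.mem_image, Finset.mem_image]
      rcases (Finset.mem_filter.1 hf).2 with ⟨m, b, h⟩ | ⟨v, a, h, hl⟩
      · exact Or.inl ⟨m, Finset.mem_univ _, (G.face_mark 2 m 0 b).trans h⟩
      · exact Or.inr ⟨v, Finset.mem_filter.2 ⟨Finset.mem_univ _, hl⟩, (hl 0 a).trans h⟩
    refine (Finset.card_le_card hsub).trans ((Finset.card_union_le _ _).trans ?_)
    exact Nat.add_le_add Finset.card_image_le (Finset.card_image_le.trans (card_loops_le hG hD))
  have hpt : ∀ f : G.Face 2, ((if ¬ Regular f then (G.legs f).card else 0 : ℕ) : ℤ) ≤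
      3 * ((G.legs f).card - 8) + if f ∈ Q then 20 else 0 := by
    intro f
    obtain ⟨r, hr⟩ := four_dvd_card_legs f
    have hpos := Finset.card_pos.2 (legs_nonempty hG f)
    by_cases hfQ : f ∈ Q
    · rw [if_pos hfQ]
      split_ifs <;> push_cast <;> omega
    · rw [if_neg hfQ]
      have hmark : ∀ m b, G.face 2 (Sum.inr (m, b)) ≠ f := fun m b h =>
        hfQ (Finset.mem_filter.2 ⟨Finset.mem_univ _, Or.inl ⟨m, b, h⟩⟩)
      have hloop : ∀ v a, G.face 2 (Sum.inl (v, a)) = f → ¬ G.IsLoop 2 v := fun v a h hl =>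
        hfQ (Finset.mem_filter.2 ⟨Finset.mem_univ _, Or.inr ⟨v, a, h, hl⟩⟩)
      have h4 : (G.legs f).card ≠ 4 := fun h => by
        obtain ⟨m, hm⟩ := exists_mark_of_card_legs_eq_four hN hloop h
        exact hmark m 0 hm
      by_cases hR : Regular f
      · rw [if_neg (not_not.2 hR), hR.card]; norm_num
      · have h8 : (G.legs f).card ≠ 8 := fun h => hR ⟨hmark, h, hloop⟩
        rw [if_pos hR]
        omega
  have hsum := Finset.sum_le_sum fun f (_ : f ∈ (Finset.univ : Finset (G.Face 2))) => hpt f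
  rw [Finset.sum_add_distrib, ← Finset.mul_sum, Finset.sum_sub_distrib, ← Finset.sum_filter,
    Finset.filter_mem_eq_inter, Finset.univ_inter] at hsum
  rw [← Nat.cast_sum, ← Nat.cast_sum, sum_card_legs] at hsum
  simp only [Finset.sum_const, Finset.card_univ, nsmul_eq_mul] at hsum
  have hirr : G.irregular.card ≤ ∑ f : G.Face 2, if ¬ Regular f then (G.legs f).card else 0 := by
    refine Finset.card_image_le.trans ?_
    rw [Finset.card_eq_sum_card_fiberwise (t := Finset.univ) (f := fun p => G.face 2 (Sum.inl p))
      (fun _ _ => Finset.mem_univ _)]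
    refine Finset.sum_le_sum fun f _ => ?_
    split_ifs with h
    · rw [Finset.card_eq_zero.2]
      · ext p
        simp only [Finset.mem_filter, Finset.mem_univ, true_and, Finset.notMem_empty, iff_false,
          not_and]
        rintro h1 rfl
        exact h1 h
    · refine Finset.card_le_card fun p hp => ?_
      rw [mem_legs]
      exact (Finset.mem_filter.1 hp).2
  have h1 := defect_eq hG (i := 0) (j := 1) (k := 2) (by decide) (by decide) (by decide)
  have h2 := finrank_words_add_le (G := G) (i := 0) (j := 1) (by decide)
  have h3 := finrank_words_add_one hG 2
  rw [numFaces_eq_card] at h3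
  push_cast at hsum
  zify at hirr hQ h2 h3 ⊢
  linarith

open Classical in
variable (G) in
/-- The bubbles which lie on a common regular straight face with one of the bubbles of `S`. -/
noncomputable def grow [Fintype V] [Finite M] (S : Finset V) : Finset V :=
  S ∪ ((S ×ˢ Finset.univ).image fun p : V × Leg => G.face 2 (Sum.inl p)).biUnion fun f =>
    if Regular f then (G.legs f).image Prod.fst else ∅

theorem card_grow_le [Fintype V] [Finite M] (S : Finset V) : (G.grow S).card ≤ 33 * S.card := by
  classical
  refine (Finset.card_union_le _ _).trans ?_
  have h1 := Finset.card_biUnion_le_card_mul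
    ((S ×ˢ Finset.univ).image fun p : V × Leg => G.face 2 (Sum.inl p))
    (fun f => if Regular f then (G.legs f).image Prod.fst else ∅) 8 (fun f _ => by
      split_ifs with h
      · exact Finset.card_image_le.trans h.card.le
      · simp)
  have h2 : ((S ×ˢ Finset.univ).image fun p : V × Leg => G.face 2 (Sum.inl p)).card ≤
      S.card * 4 := by
    refine Finset.card_image_le.trans ?_
    rw [Finset.card_product]
    exact le_rfl
  omega

theorem mem_grow [Fintype V] [Finite M] {S : Finset V} {u v : V} (hu : u ∈ S)
    (h : G.Near u v) (hR : ∀ a, Regular (G.face 2 (Sum.inl (v, a)))) : v ∈ G.grow S := by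
  classical
  obtain ⟨a, b, hab⟩ := h
  refine Finset.mem_union_right _ (Finset.mem_biUnion.2 ⟨G.face 2 (Sum.inl (v, b)),
    Finset.mem_image.2 ⟨(u, a), Finset.mem_product.2 ⟨hu, Finset.mem_univ _⟩, hab⟩, ?_⟩)
  rw [if_pos (hR b)]
  exact Finset.mem_image.2 ⟨(v, b), mem_legs.2 rfl, rfl⟩

theorem mem_grow' [Fintype V] [Finite M] {S : Finset V} {u v : V} (hu : u ∈ S)
    (h : G.Near u v) (hR : ∀ a, Regular (G.face 2 (Sum.inl (u, a)))) : v ∈ G.grow S := by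
  classical
  obtain ⟨a, b, hab⟩ := h
  refine Finset.mem_union_right _ (Finset.mem_biUnion.2 ⟨G.face 2 (Sum.inl (v, b)),
    Finset.mem_image.2 ⟨(u, a), Finset.mem_product.2 ⟨hu, Finset.mem_univ _⟩, hab⟩, ?_⟩)
  rw [if_pos (hab ▸ hR a)]
  exact Finset.mem_image.2 ⟨(v, b), mem_legs.2 rfl, rfl⟩

open Classical in
variable (G) in
/-- The regular straight faces which cross another regular straight face an odd number of times. -/
noncomputable def oddFaces [Fintype V] [Fintype M] : Finset (G.Face 2) :=
  Finset.univ.filter fun f => Regular f ∧ ∃ g : G.Face 2, Regular g ∧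
    ∑ v, G.faceWord f v * G.faceWord g v ≠ 0

theorem card_oddFaces_le [Fintype V] [Fintype M] [Nonempty (Ends V M)] (hG : G.Connected) {D : ℕ}
    (hD : G.defect ≤ D) : G.oddFaces.card ≤ 2 ^ D * 32 := by
  classical
  by_contra hlt
  push Not at hlt
  obtain ⟨f, hf, u, hu, -, hu32, hX⟩ := exists_lt_card_fiber_sub_mem (G.words 2)
    (G.words 0 ⊓ G.words 1) (words_inf_words_le (by decide) (by decide) (by decide)) D 32
    (finrank_words_le hG hD (by decide) (by decide) (by decide)) G.oddFaces
    (fun f => G.faceWord f) (fun f _ => faceWord_mem f) hlt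
  obtain ⟨-, -, g, hg, hfg⟩ := Finset.mem_filter.1 hf
  -- all the faces of the class of `f` cross the face `g`, which has only four crossings
  have hsub : u ⊆ ((G.legs g).image Prod.fst ×ˢ Finset.univ).image
      fun p : V × Leg => G.face 2 (Sum.inl p) := by
    intro j hj
    have h0 : ∑ v, (G.faceWord f + G.faceWord j) v * G.faceWord g v = 0 :=
      words_orthogonal (i := 0) (j := 2) (by decide) (hX j hj).1 (faceWord_mem g)
    simp only [Pi.add_apply, add_mul, Finset.sum_add_distrib] at h0
    have h1 : ∑ v, G.faceWord j v * G.faceWord g v ≠ 0 := fun h => hfg (by rwa [h, add_zero] at h0)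
    obtain ⟨v, -, hv⟩ := Finset.exists_ne_zero_of_sum_ne_zero h1
    have h2 : ∀ z : ZMod 2, z ≠ 0 → z = 1 := by decide
    have hl : ¬ G.IsLoop 2 v := fun hl => right_ne_zero_of_mul hv
      (word_eq_zero_of_isLoop hl (faceWord_mem g))
    obtain ⟨a, ha⟩ := (faceWord_eq_one_iff hl).1 (h2 _ (right_ne_zero_of_mul hv))
    obtain ⟨b, hb⟩ := (faceWord_eq_one_iff hl).1 (h2 _ (left_ne_zero_of_mul hv))
    exact Finset.mem_image.2 ⟨(v, b), Finset.mem_product.2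
      ⟨Finset.mem_image.2 ⟨(v, a), mem_legs.2 ha, rfl⟩, Finset.mem_univ _⟩, hb⟩
  have h1 := (Finset.card_le_card hsub).trans Finset.card_image_le
  rw [Finset.card_product] at h1
  have h2 := (Finset.card_image_le (s := G.legs g) (f := Prod.fst)).trans hg.card.le
  have h3 : (Finset.univ : Finset Leg).card = 4 := rfl
  rw [h3] at h1
  omega

/-- A bound on the number of bubbles of a connected graph without dipoles, in terms of its defect
`D` and of its number `m` of marks. The first term counts the bubbles near irregular faces
(`card_irregular_le`, `card_grow_le`); `36193 = 8 * 32 + 33 ^ 3` accounts for the bubbles on odd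
faces, and for the bubbles at distance at most three from a given one, once for each class modulo
the words common to all colours. -/
def bubbleBound (D m : ℕ) : ℕ := 33 * (12 * D + 20 * (m + 2 ^ D)) + 36193 * 2 ^ D

theorem bubbleBound_mono {D D' m m' : ℕ} (hD : D ≤ D') (hm : m ≤ m') :
    bubbleBound D m ≤ bubbleBound D' m' := by
  have := Nat.pow_le_pow_right (show 0 < 2 by norm_num) hD
  unfold bubbleBound
  omega

/-- A connected graph whose dipoles all carry marks has a bounded number of bubbles. If there were
more, many of them would be surrounded by regular straight faces which cross each other evenly, and
the words given by `exists_partner` would be too many to be distinguished modulo the words common to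
all colours. -/
theorem card_le_bubbleBound [Fintype V] [Fintype M] [Nonempty V] (hG : G.Connected)
    (hN : G.NoDipole) {D : ℕ} (hD : G.defect ≤ D) :
    Fintype.card V ≤ bubbleBound D (Fintype.card M) := by
  classical
  let S : Finset V := G.grow G.irregular ∪
    G.oddFaces.biUnion fun f => if Regular f then (G.legs f).image Prod.fst else ∅
  have hS : S.card ≤ 33 * (12 * D + 20 * (Fintype.card M + 2 ^ D)) + 2 ^ D * 32 * 8 := by
    refine (Finset.card_union_le _ _).trans (Nat.add_le_add ?_ ?_)
    · exact (card_grow_le _).trans (Nat.mul_le_mul_left _ (card_irregular_le hG hN hD))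
    · refine (Finset.card_biUnion_le_card_mul _ _ 8 fun f _ => ?_).trans
        (Nat.mul_le_mul_right _ (card_oddFaces_le hG hD))
      split_ifs with h
      · exact Finset.card_image_le.trans h.card.le
      · simp
  -- outside of `S`, the bubbles and their neighbours only lie on regular faces
  have hreg : ∀ v ∉ S, ∀ a, Regular (G.face 2 (Sum.inl (v, a))) := fun v hv =>
    regular_of_notMem_irregular fun h =>
      hv (Finset.mem_union_left _ (Finset.mem_union_left _ h))
  have hreg' : ∀ v ∉ S, ∀ u, G.Near v u → ∀ a, Regular (G.face 2 (Sum.inl (u, a))) := by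
    intro v hv u hvu
    refine regular_of_notMem_irregular fun h => hv (Finset.mem_union_left _ ?_)
    obtain ⟨a, b, hab⟩ := hvu
    exact mem_grow h ⟨b, a, hab.symm⟩ (hreg v hv)
  have heven : ∀ v ∉ S, ∀ a, Even (G.face 2 (Sum.inl (v, a))) := by
    intro v hv a
    refine ⟨hreg v hv a, fun p hp => ?_⟩
    have hc : Regular (G.cross p) := hreg' v hv p.1 ⟨a, p.2, hp.symm⟩ _
    refine ⟨hc, ?_⟩
    by_contra hne
    refine hv (Finset.mem_union_right _ (Finset.mem_biUnion.2 ⟨_, Finset.mem_filter.2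
      ⟨Finset.mem_univ _, hreg v hv a, _, hc, hne⟩, ?_⟩))
    rw [if_pos (hreg v hv a)]
    exact Finset.mem_image.2 ⟨(v, a), mem_legs.2 rfl, rfl⟩
  have hpart : ∀ v, ∃ w, v ∉ S → w ≠ v ∧ G.Near v w ∧
      Pi.single v 1 + Pi.single w 1 ∈ G.wordsOrth 2 ∧
      ∀ y : V → ZMod 2, (∀ u u', G.Near v u' → G.Near u' u → y u = 0) →
        Pi.single v 1 + Pi.single w 1 + y ∉ G.words 0 ⊓ G.words 1 := by
    intro v
    by_cases hv : v ∈ S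
    · exact ⟨v, fun h => absurd hv h⟩
    · obtain ⟨w, hw⟩ := exists_partner hN (heven v hv)
      exact ⟨w, fun _ => hw⟩
  choose w hw using hpart
  by_contra hlt
  push Not at hlt
  obtain ⟨v, hv, u, hu, -, huc, hX⟩ := exists_lt_card_fiber_sub_mem (G.wordsOrth 2)
    (G.words 0 ⊓ G.words 1) (inf_words_le_wordsOrth (by decide)) D 35937
    (finrank_wordsOrth_le hG hD (by decide) (by decide) (by decide)) Sᶜ
    (fun v => Pi.single v 1 + Pi.single (w v) 1)
    (fun v hv => (hw v (Finset.mem_compl.1 hv)).2.2.1) (by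
      rw [Finset.card_compl]
      unfold bubbleBound at hlt
      omega)
  have hvS := Finset.mem_compl.1 hv
  have hgrow : (G.grow (G.grow (G.grow {v}))).card ≤ 35937 := by
    have h1 := card_grow_le (G := G) {v}
    have h2 := card_grow_le (G := G) (G.grow {v})
    have h3 := card_grow_le (G := G) (G.grow (G.grow {v}))
    rw [Finset.card_singleton] at h1
    omega
  obtain ⟨j, hj, hjv⟩ : ∃ j ∈ u, j ∉ G.grow (G.grow (G.grow {v})) := by
    by_contra h
    push Not at h
    have := Finset.card_le_card h
    omega
  have hjS := Finset.mem_compl.1 (hu hj)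
  refine (hw v hvS).2.2.2 _ (fun x x' hx' hx => ?_) (hX j hj)
  -- the word of `j` vanishes near `v`, because `j` is far from `v`
  have hx'1 : x' ∈ G.grow {v} := mem_grow' (Finset.mem_singleton_self v) hx' (hreg v hvS)
  have hx2 : x ∈ G.grow (G.grow {v}) := mem_grow' hx'1 hx (hreg' v hvS x' hx')
  have hxj : x ≠ j := by
    rintro rfl
    exact hjv (Finset.mem_union_left _ hx2)
  have hxw : x ≠ w j := by
    rintro rfl
    obtain ⟨a, b, hab⟩ := (hw j hjS).2.1
    exact hjv (mem_grow hx2 ⟨b, a, hab.symm⟩ (hreg j hjS))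
  simp [hxj, hxw]

end MarkedGraph
end QuarticMultiMatrix

namespace QuarticMultiMatrix
open Module

/-! ### The degree of a graph and the removal of melons -/

/-- The class of a half-edge under two involutions. -/
abbrev orbit {H : Type} (p t : H → H) (x : H) : Quotient (orbitSetoid p t) := Quotient.mk _ x

theorem orbit_left {H : Type} (p t : H → H) (x : H) : orbit p t (p x) = orbit p t x :=
  Quotient.sound ((orbitSetoid p t).symm (orbitSetoid_left p t x))

theorem orbit_right {H : Type} (p t : H → H) (x : H) : orbit p t (t x) = orbit p t x :=
  Quotient.sound ((orbitSetoid p t).symm (orbitSetoid_right p t x))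

/-- A map of half-edges which respects orbits, and misses only those of finitely many half-edges,
bounds the number of orbits of its target. -/
theorem numOrbits_le_add {H H' E : Type} [Finite H'] [Finite E] {p t : H → H} {p' t' : H' → H'}
    (φ : H' → H) (ψ : E → H) (hp : ∀ x, orbit p t (φ (p' x)) = orbit p t (φ x))
    (ht : ∀ x, orbit p t (φ (t' x)) = orbit p t (φ x))
    (hcover : ∀ y, (∃ x, orbit p t y = orbit p t (φ x)) ∨ ∃ e, orbit p t y = orbit p t (ψ e)) :
    numOrbits p t ≤ numOrbits p' t' + Nat.card E := by
  let F : Quotient (orbitSetoid p' t') ⊕ E → Quotient (orbitSetoid p t) := Sum.elim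
    (Quotient.lift (fun x => orbit p t (φ x)) fun _ _ h =>
      eq_of_orbitSetoid (fun x => orbit p t (φ x)) hp ht h) fun e => orbit p t (ψ e)
  have hF : Function.Surjective F := by
    intro q
    obtain ⟨y, rfl⟩ := Quotient.exists_rep q
    rcases hcover y with ⟨x, hx⟩ | ⟨e, he⟩
    · exact ⟨Sum.inl (Quotient.mk _ x), hx.symm⟩
    · exact ⟨Sum.inr e, he.symm⟩
  have := Nat.card_le_card_of_surjective F hF
  rwa [Nat.card_sum] at this

/-- The contribution of a bubble to `2 h + l`. -/
def Interaction.weight : Interaction → ℕ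
  | .tetra => 3
  | _ => 4

namespace Graph
variable (G : Graph)

/-- Twice the degree `h + l / 2 = 3 + 3/2 n_t + 2 (n_1 + n_2 + n_3b + n_3nb) - F`. -/
noncomputable def doubleDegree : ℤ :=
  6 + (∑ v, (G.kind v).weight : ℕ) - 2 * (G.numFaces 0 + G.numFaces 1 + G.numFaces 2 : ℕ)

theorem doubleDegree_eq {h l : ℕ} (hh : G.genus = h) (hl : G.grade = l) :
    G.doubleDegree = 2 * h + l := by
  have hcount : ∀ k, (G.count k : ℚ) = ∑ v, if G.kind v = k then (1 : ℚ) else 0 := by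
    intro k
    rw [count, Finset.sum_boole]
  have hn : (G.n : ℚ) = ∑ v : Fin G.n, 1 := by simp
  have hw : ((∑ v, (G.kind v).weight : ℕ) : ℚ) = 3 * G.count .tetra + 4 * G.count .pillow1 +
      4 * G.count .pillow2 + 4 * G.count .pillow3b + 4 * G.count .pillow3nb := by
    push_cast
    simp only [hcount, Finset.mul_sum, ← Finset.sum_add_distrib]
    refine Finset.sum_congr rfl fun v _ => ?_
    cases G.kind v <;> simp [Interaction.weight]
  have hn' : (G.n : ℚ) = G.count .tetra + G.count .pillow1 +
      G.count .pillow2 + G.count .pillow3b + G.count .pillow3nb := by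
    simp only [hcount, hn, ← Finset.sum_add_distrib]
    refine Finset.sum_congr rfl fun v _ => ?_
    cases G.kind v <;> simp
  have hq : (G.doubleDegree : ℚ) = 2 * h + l := by
    rw [doubleDegree]
    push_cast [numEdges] at *
    rw [hw, ← hl, ← hh, grade, genus]
    push_cast [numEdges]
    linarith
  exact_mod_cast hq

theorem numFaces_eq (c : Fin 3) : G.numFaces c = numOrbits G.pair (G.turn c) := rfl

theorem pillowColour_eq_none {k : Interaction} (h : k ≠ .tetra) : ∃ i, k.pillowColour = some i := by
  cases k <;> simp_all [Interaction.pillowColour]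

theorem weight_eq_four {k : Interaction} (h : k ≠ .tetra) : k.weight = 4 := by
  cases k <;> simp_all [Interaction.weight]

theorem turn_tetra {v : Fin G.n} (hv : G.kind v = .tetra) (c : Fin 3) (a : Leg) :
    G.turn c (Sum.inl (v, a)) = Sum.inl (v, a + dir c) := by
  simp only [turn, hv]

theorem edge_pillow {k : Interaction} {i : Fin 3} (h : k.pillowColour = some i) (c : Fin 3) :
    k.edge c = if c = i then (1, 0) else (0, 1) := by
  simp only [Interaction.edge, h]

variable {G} {H : Graph}

theorem turn_mapHalf {f : Fin H.n → Fin G.n} (hk : ∀ v, G.kind (f v) = H.kind v) (c : Fin 3)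
    (y : Half H.n) : mapHalf f (H.turn c y) = G.turn c (mapHalf f y) := by
  rcases y with p | b
  · simp only [mapHalf, turn, hk]
  · rfl

theorem sum_weight_eq {f : Fin H.n ↪ Fin G.n} {u v : Fin G.n}
    (hr : ∀ w, w ∈ Set.range f ↔ w ≠ u ∧ w ≠ v) (hk : ∀ v, G.kind (f v) = H.kind v) :
    ∑ w, (G.kind w).weight = ∑ w, (H.kind w).weight + ∑ w ∈ {u, v}, (G.kind w).weight := by
  rw [← Finset.sum_compl_add_sum {u, v}]
  congr 1
  have : ({u, v} : Finset (Fin G.n))ᶜ = Finset.univ.map f := by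
    ext w
    have := hr w
    simp only [Set.mem_range] at this
    simp only [Finset.mem_compl, Finset.mem_insert, Finset.mem_singleton, not_or, Finset.mem_map,
      Finset.mem_univ, true_and]
    exact this.symm
  rw [this, Finset.sum_map]
  simp only [hk]

/-- The removal of an elementary melon does not increase the degree. -/
theorem MelonInsertion.doubleDegree_le (h : MelonInsertion H G) :
    H.doubleDegree ≤ G.doubleDegree := by
  obtain ⟨f, x, p, q, hm, hr, hk, hx, hx', hy⟩ := h
  have hw := sum_weight_eq hr hk
  have hleft : ∀ c y, orbit G.pair (G.turn c) (G.pair y) = orbit G.pair (G.turn c) y :=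
    fun c => orbit_left _ _
  have hright : ∀ c y, orbit G.pair (G.turn c) (G.turn c y) = orbit G.pair (G.turn c) y :=
    fun c => orbit_right _ _
  have hturn : ∀ c y, orbit G.pair (G.turn c) (mapHalf f (H.turn c y)) =
      orbit G.pair (G.turn c) (mapHalf f y) := fun c y => by
    rw [turn_mapHalf hk, hright]
  have hp : ∀ c, orbit G.pair (G.turn c) (mapHalf f x) = orbit G.pair (G.turn c) (Sum.inl p) :=
    fun c => by rw [← hx, hleft]
  have hq : ∀ c, orbit G.pair (G.turn c) (mapHalf f (H.pair x)) =
      orbit G.pair (G.turn c) (Sum.inl q) := fun c => by rw [← hx', hleft]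
  have hpair : ∀ c, orbit G.pair (G.turn c) (Sum.inl p) = orbit G.pair (G.turn c) (Sum.inl q) →
      ∀ y, orbit G.pair (G.turn c) (mapHalf f (H.pair y)) =
        orbit G.pair (G.turn c) (mapHalf f y) := by
    intro c hpq y
    by_cases h1 : y = x
    · subst h1; rw [hq, hp, hpq]
    · by_cases h2 : y = H.pair x
      · subst h2; rw [H.pair_pair, hq, hp, hpq]
      · rw [← hy y h1 h2, hleft]
  have hold : ∀ (c : Fin 3) (v : Fin G.n) (a : Leg), v ≠ p.1 → v ≠ q.1 →
      ∃ y, orbit G.pair (G.turn c) (Sum.inl (v, a)) = orbit G.pair (G.turn c) (mapHalf f y) := by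
    intro c v a h1 h2
    obtain ⟨w, rfl⟩ := (hr v).2 ⟨h1, h2⟩
    exact ⟨Sum.inl (w, a), rfl⟩
  rcases hm with ⟨hpq, kp, kq, hedge⟩ | ⟨hpq, kp, hq2, hedge⟩
  · -- each colour has one face inside the melon
    have hF : ∀ c, G.numFaces c ≤ H.numFaces c + 1 := by
      intro c
      have hqa : ∀ a : Leg, a ≠ 0 → orbit G.pair (G.turn c) (Sum.inl (q.1, q.2 + a)) =
          orbit G.pair (G.turn c) (Sum.inl (p.1, p.2 + a)) := by
        intro a ha
        have e : ∀ a p q : Leg, p + a + (p + q) = q + a := by decide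
        rw [← e a p.2 q.2, ← hedge (p.2 + a) (by simpa using ha), hleft]
      have hpc : ∀ a, orbit G.pair (G.turn c) (Sum.inl (p.1, a + dir c)) =
          orbit G.pair (G.turn c) (Sum.inl (p.1, a)) := fun a => by
        rw [← turn_tetra G kp, hright]
      have hqc : ∀ a, orbit G.pair (G.turn c) (Sum.inl (q.1, a + dir c)) =
          orbit G.pair (G.turn c) (Sum.inl (q.1, a)) := fun a => by
        rw [← turn_tetra G kq, hright]
      have hpq' : orbit G.pair (G.turn c) (Sum.inl p) = orbit G.pair (G.turn c) (Sum.inl q) := by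
        have h1 := hpc p.2
        rw [← hqa _ (MarkedGraph.dir_ne_zero c), hqc] at h1
        exact h1.symm
      have := numOrbits_le_add (E := Unit) (p := G.pair) (t := G.turn c) (p' := H.pair)
        (t' := H.turn c) (mapHalf f) (fun _ => Sum.inl (p.1, p.2 + dir (c + 1)))
        (hpair c hpq') (hturn c) ?_
      · simpa [numFaces_eq] using this
      · rintro (⟨v, a⟩ | b)
        · have hcase : ∀ (c : Fin 3) (a p : Leg), a = p ∨ a = p + dir c ∨ a = p + dir (c + 1) ∨
              a = p + dir (c + 1) + dir c := by decide
          by_cases h1 : v = p.1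
          · subst h1
            rcases hcase c a p.2 with rfl | rfl | rfl | rfl
            · exact Or.inl ⟨x, (hp c).symm⟩
            · exact Or.inl ⟨x, (hpc _).trans (hp c).symm⟩
            · exact Or.inr ⟨(), rfl⟩
            · exact Or.inr ⟨(), hpc _⟩
          · by_cases h2 : v = q.1
            · subst h2
              rcases hcase c a q.2 with rfl | rfl | rfl | rfl
              · exact Or.inl ⟨_, (hq c).symm⟩
              · exact Or.inl ⟨_, (hqc _).trans (hq c).symm⟩
              · exact Or.inr ⟨(), hqa _ (MarkedGraph.dir_ne_zero _)⟩
              · exact Or.inr ⟨(), (hqc _).trans (hqa _ (MarkedGraph.dir_ne_zero _))⟩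
            · exact Or.inl (hold c v a h1 h2)
        · exact Or.inl ⟨Sum.inr b, rfl⟩
    rw [Finset.sum_pair hpq, kp, kq] at hw
    have h0 := hF 0
    have h1 := hF 1
    have h2 := hF 2
    have h3 : Interaction.tetra.weight = 3 := rfl
    rw [h3] at hw
    unfold doubleDegree
    omega
  · obtain ⟨i, hi⟩ := pillowColour_eq_none kp
    obtain ⟨v0, a0⟩ := p
    obtain ⟨w0, b0⟩ := q
    obtain rfl : v0 = w0 := hpq
    obtain rfl : b0 = a0 + (0, 1) := hq2
    have hcase : ∀ a p : Leg, a = p ∨ a = p + (0, 1) ∨ a = p + (1, 0) ∨ a = p + (1, 1) := by decide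
    have hint : ∀ c, orbit G.pair (G.turn c) (Sum.inl (v0, a0 + (1, 1))) =
        orbit G.pair (G.turn c) (Sum.inl (v0, a0 + (1, 0))) := fun c => by
      have := hleft c (Sum.inl (v0, a0 + (1, 0)))
      rwa [hedge] at this
    have hedge' : ∀ c a, orbit G.pair (G.turn c) (Sum.inl (v0, a +
        if c = i then (1, 0) else (0, 1))) = orbit G.pair (G.turn c) (Sum.inl (v0, a)) := by
      intro c a
      rw [← edge_pillow hi c]
      exact hright c (Sum.inl (v0, a))
    have e2 : ∀ a : Leg, a + (0, 1) + (1, 0) = a + (1, 1) := by decide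
    -- the faces of colour `i` go through the melon, the two other colours have one inner face
    have hFi : G.numFaces i ≤ H.numFaces i := by
      have ht : ∀ a, orbit G.pair (G.turn i) (Sum.inl (v0, a + (1, 0))) =
          orbit G.pair (G.turn i) (Sum.inl (v0, a)) := fun a => by simpa using hedge' i a
      have hpq' : orbit G.pair (G.turn i) (Sum.inl (v0, a0)) =
          orbit G.pair (G.turn i) (Sum.inl (v0, a0 + (0, 1))) := by
        rw [← ht a0, ← ht (a0 + (0, 1)), e2, hint]
      have := numOrbits_le_add (E := Empty) (p := G.pair) (t := G.turn i) (p' := H.pair)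
        (t' := H.turn i) (mapHalf f) (fun e => nomatch e) (hpair i hpq') (hturn i) ?_
      · simpa [numFaces_eq] using this
      · rintro (⟨v, a⟩ | b)
        · by_cases h1 : v = v0
          · subst h1
            refine Or.inl ⟨x, ?_⟩
            rw [hp]
            rcases hcase a a0 with rfl | rfl | rfl | rfl
            · rfl
            · exact hpq'.symm
            · exact ht _
            · rw [hint]; exact ht _
          · exact Or.inl (hold i v a h1 h1)
        · exact Or.inl ⟨Sum.inr b, rfl⟩
    have hFc : ∀ c ≠ i, G.numFaces c ≤ H.numFaces c + 1 := by
      intro c hc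
      have ht : ∀ a, orbit G.pair (G.turn c) (Sum.inl (v0, a + (0, 1))) =
          orbit G.pair (G.turn c) (Sum.inl (v0, a)) := fun a => by simpa [hc] using hedge' c a
      have := numOrbits_le_add (E := Unit) (p := G.pair) (t := G.turn c) (p' := H.pair)
        (t' := H.turn c) (mapHalf f) (fun _ => Sum.inl (v0, a0 + (1, 0)))
        (hpair c (ht a0).symm) (hturn c) ?_
      · simpa [numFaces_eq] using this
      · rintro (⟨v, a⟩ | b)
        · by_cases h1 : v = v0
          · subst h1
            rcases hcase a a0 with rfl | rfl | rfl | rfl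
            · exact Or.inl ⟨x, (hp c).symm⟩
            · exact Or.inl ⟨x, (ht _).trans (hp c).symm⟩
            · exact Or.inr ⟨(), rfl⟩
            · exact Or.inr ⟨(), hint c⟩
          · exact Or.inl (hold c v a h1 h1)
        · exact Or.inl ⟨Sum.inr b, rfl⟩
    rw [Finset.pair_eq_singleton, Finset.sum_singleton, weight_eq_four kp] at hw
    have hsum : G.numFaces 0 + G.numFaces 1 + G.numFaces 2 ≤
        H.numFaces 0 + H.numFaces 1 + H.numFaces 2 + 2 := by
      have h3 : i = 0 ∨ i = 1 ∨ i = 2 := by clear * - ; revert i; decide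
      rcases h3 with rfl | rfl | rfl
      · have h1 := hFc 1 (by decide)
        have h2 := hFc 2 (by decide)
        omega
      · have h1 := hFc 0 (by decide)
        have h2 := hFc 2 (by decide)
        omega
      · have h1 := hFc 0 (by decide)
        have h2 := hFc 1 (by decide)
        omega
    unfold doubleDegree
    omega

theorem IsCore.doubleDegree_le {C : Graph} (h : IsCore C G) : C.doubleDegree ≤ G.doubleDegree := by
  have h1 := h.1
  clear h
  induction h1 with
  | refl => exact le_rfl
  | tail _ h ih => exact ih.trans h.doubleDegree_le

end Graph
end QuarticMultiMatrix

namespace QuarticMultiMatrix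
open Module

/-! ### Cutting dipoles -/

/-- The functions which are constant on the classes of an equivalence relation. -/
def constantsOn {H : Type} (r : Setoid H) : Submodule (ZMod 2) (H → ZMod 2) where
  carrier := {s | ∀ x y, r x y → s x = s y}
  add_mem' ha hb x y h := by simp [ha x y h, hb x y h]
  zero_mem' _ _ _ := rfl
  smul_mem' c s hs x y h := by simp [hs x y h]

theorem finrank_constantsOn {H : Type} [Finite H] (r : Setoid H) :
    finrank (ZMod 2) (constantsOn r) = Nat.card (Quotient r) := by
  classical
  have := Fintype.ofFinite (Quotient r)
  let e : constantsOn r ≃ₗ[ZMod 2] (Quotient r → ZMod 2) :=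
    { toFun := fun s => Quotient.lift s.1 s.2
      map_add' := fun s s' => by ext q; induction q using Quotient.inductionOn; rfl
      map_smul' := fun c s => by ext q; induction q using Quotient.inductionOn; rfl
      invFun := fun g => ⟨fun x => g (Quotient.mk r x), fun x y h => congrArg g (Quotient.sound h)⟩
      left_inv := fun s => rfl
      right_inv := fun g => by ext q; induction q using Quotient.inductionOn; rfl }
  rw [e.finrank_eq, Module.finrank_fintype_fun_eq_card, Nat.card_eq_fintype_card]

theorem finrank_map_add_finrank_inf_ker {E F : Type*} [AddCommGroup E] [Module (ZMod 2) E]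
    [FiniteDimensional (ZMod 2) E] [AddCommGroup F] [Module (ZMod 2) F]
    (A : Submodule (ZMod 2) E) (J : E →ₗ[ZMod 2] F) :
    finrank (ZMod 2) (A.map J) + finrank (ZMod 2) (A ⊓ LinearMap.ker J : Submodule _ _) =
      finrank (ZMod 2) A := by
  have h := LinearMap.finrank_range_add_finrank_ker (J.domRestrict A)
  rw [LinearMap.range_domRestrict, LinearMap.ker_domRestrict] at h
  rw [← h, ← Submodule.map_comap_subtype, Submodule.finrank_map_subtype_eq]

namespace MarkedGraph

/-- The marks obtained by cutting the dipoles `D`: the two sides of every dipole, and the root, which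
joins the two external ends. -/
abbrev Marks (D : Type) : Type := (D × ZMod 2) ⊕ Unit

/-- The turns of the faces of colour `c` before the dipoles are cut: at a dipole of colour `c` they
go from one side to the other one. -/
def dipoleTurn {V D : Type} (κ : D → Fin 3) (c : Fin 3) : Ends V (Marks D) → Ends V (Marks D)
  | Sum.inl p => Sum.inl (p.1, p.2 + dir c)
  | Sum.inr (Sum.inl d, u) =>
    if κ d.1 = c then Sum.inr (Sum.inl (d.1, d.2 + 1), u) else Sum.inr (Sum.inl d, u + 1)
  | Sum.inr (Sum.inr r, u) => Sum.inr (Sum.inr r, u + 1)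

/-- The node which carries a half-edge. -/
def node {V M : Type} : Ends V M → V ⊕ M
  | Sum.inl p => Sum.inl p.1
  | Sum.inr q => Sum.inr q.1

/-- The connected components of a graph, as classes of half-edges. -/
def compSetoid {V M : Type} (G : MarkedGraph V M) : Setoid (Ends V M) :=
  Relation.EqvGen.setoid fun x y => y = G.pair x ∨ node x = node y

/-- A graph is connected once the two sides of every dipole are glued together. -/
def DipoleConnected {V D : Type} (G : MarkedGraph V (Marks D)) : Prop :=
  ∀ s : Ends V (Marks D) → ZMod 2, (∀ x, s (G.pair x) = s x) → (∀ x y, node x = node y → s x = s y) →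
    (∀ d, s (Sum.inr (Sum.inl (d, 0), 0)) = s (Sum.inr (Sum.inl (d, 1), 0))) → ∀ x y, s x = s y

variable {V D : Type} {G : MarkedGraph V (Marks D)} {κ : D → Fin 3}

theorem constantsOn_comp_le {M : Type} (G : MarkedGraph V M) (c : Fin 3) :
    constantsOn G.compSetoid ≤ G.inv c := by
  intro s hs
  refine ⟨fun x => (hs _ _ (Relation.EqvGen.rel _ _ (Or.inl rfl))).symm, fun x => ?_⟩
  refine (hs _ _ (Relation.EqvGen.rel _ _ (Or.inr ?_))).symm
  rcases x with p | q <;> rfl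

theorem constantsOn_comp_node {M : Type} {G : MarkedGraph V M} {s : Ends V M → ZMod 2}
    (hs : s ∈ constantsOn G.compSetoid) {x y : Ends V M} (h : node x = node y) : s x = s y :=
  hs _ _ (Relation.EqvGen.rel _ _ (Or.inr h))

/-- For a function along uncut faces of colour `i`: the variation between the two strands of colour
`i` across a dipole of colour `i`. -/
def levelJump (κ : D → Fin 3) (i : Fin 3) :
    (Ends V (Marks D) → ZMod 2) →ₗ[ZMod 2] ({d // κ d = i} → ZMod 2) where
  toFun s d := s (Sum.inr (Sum.inl (d.1, 0), 0)) + s (Sum.inr (Sum.inl (d.1, 0), 1))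
  map_add' s s' := by ext d; simp only [Pi.add_apply]; ring
  map_smul' c s := by ext d; simp only [Pi.smul_apply, RingHom.id_apply, smul_eq_mul]; ring

/-- For a function along cut faces of colour `i`: the variation between the two sides of a dipole of
colour `i`. -/
def sideJump (κ : D → Fin 3) (i : Fin 3) :
    (Ends V (Marks D) → ZMod 2) →ₗ[ZMod 2] ({d // κ d = i} → ZMod 2) where
  toFun s d := s (Sum.inr (Sum.inl (d.1, 0), 0)) + s (Sum.inr (Sum.inl (d.1, 1), 0))
  map_add' s s' := by ext d; simp only [Pi.add_apply]; ring
  map_smul' c s := by ext d; simp only [Pi.smul_apply, RingHom.id_apply, smul_eq_mul]; ring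

theorem zmod_two_cases (b : ZMod 2) : b = 0 ∨ b = 1 := by revert b; decide

theorem zmod_two_sum (f : ZMod 2 → ZMod 2) : ∑ b, f b = f 0 + f 1 := Fin.sum_univ_two f

theorem add_eq_zero_iff_eq_zmod {a b : ZMod 2} : a + b = 0 ↔ a = b := by revert a b; decide

/-- Both kinds of faces have the same functions without variation across the dipoles. -/
theorem invariants_inf_ker (κ : D → Fin 3) (i : Fin 3) :
    invariants G.pair (dipoleTurn κ i) ⊓ LinearMap.ker (levelJump κ i) =
      G.inv i ⊓ LinearMap.ker (sideJump κ i) := by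
  ext s
  simp only [Submodule.mem_inf, LinearMap.mem_ker]
  constructor
  · rintro ⟨⟨hp, ht⟩, hk⟩
    have hl : ∀ d, s (Sum.inr (Sum.inl (d, 0), 0)) = s (Sum.inr (Sum.inl (d, 0), 1)) := by
      intro d
      by_cases hd : κ d = i
      · exact add_eq_zero_iff_eq_zmod.1 (congrFun hk ⟨d, hd⟩)
      · have := ht (Sum.inr (Sum.inl (d, 0), 0))
        simp only [dipoleTurn, hd, if_false, zero_add] at this
        exact this.symm
    have hside : ∀ d, κ d = i → ∀ u, s (Sum.inr (Sum.inl (d, 1), u)) =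
        s (Sum.inr (Sum.inl (d, 0), u)) := by
      intro d hd u
      have := ht (Sum.inr (Sum.inl (d, 0), u))
      simp only [dipoleTurn, hd, if_true, zero_add] at this
      exact this
    refine ⟨⟨hp, ?_⟩, ?_⟩
    · rintro (⟨v, a⟩ | ⟨⟨d, e⟩ | r, u⟩)
      · exact ht (Sum.inl (v, a))
      · by_cases hd : κ d = i
        · simp only [turn]
          rcases zmod_two_cases e with rfl | rfl <;> rcases zmod_two_cases u with rfl | rfl
          · exact (hl d).symm
          · exact hl d
          · rw [hside d hd, hside d hd]; exact (hl d).symm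
          · rw [hside d hd, hside d hd]; exact hl d
        · have := ht (Sum.inr (Sum.inl (d, e), u))
          simp only [dipoleTurn, hd, if_false] at this
          exact this
      · exact ht (Sum.inr (Sum.inr r, u))
    · ext d
      refine add_eq_zero_iff_eq_zmod.2 ?_
      exact (hside d.1 d.2 0).symm
  · rintro ⟨⟨hp, ht⟩, hk⟩
    have hmark : ∀ m u u', s (Sum.inr (m, u)) = s (Sum.inr (m, u')) :=
      fun m u u' => mem_inv_mark (G := G) (i := i) ⟨hp, ht⟩ m u u'
    have hside : ∀ d, κ d = i → ∀ e u, s (Sum.inr (Sum.inl (d, e + 1), u)) =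
        s (Sum.inr (Sum.inl (d, e), u)) := by
      intro d hd e u
      have := add_eq_zero_iff_eq_zmod.1 (congrFun hk ⟨d, hd⟩)
      rw [hmark _ u 0, hmark (Sum.inl (d, e)) u 0]
      rcases zmod_two_cases e with rfl | rfl
      · exact this.symm
      · exact this
    refine ⟨⟨hp, ?_⟩, ?_⟩
    · rintro (⟨v, a⟩ | ⟨⟨d, e⟩ | r, u⟩)
      · exact ht (Sum.inl (v, a))
      · simp only [dipoleTurn]
        split_ifs with hd
        · exact hside d hd e u
        · exact hmark _ _ _
      · exact ht (Sum.inr (Sum.inr r, u))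
    · ext d
      exact add_eq_zero_iff_eq_zmod.2 (hmark _ _ _)

/-- The variations of the functions along uncut faces are orthogonal to those of the functions which
are constant on the components of the cut graph. -/
theorem sum_levelJump_mul_sideJump [Fintype V] [Fintype D] {i : Fin 3}
    {s g : Ends V (Marks D) → ZMod 2} (hs : s ∈ invariants G.pair (dipoleTurn κ i))
    (hg : g ∈ constantsOn G.compSetoid) : ∑ d, levelJump κ i s d * sideJump κ i g d = 0 := by
  classical
  have h0 := sum_mul_eq_zero_of_pair_invariant (G := G) s g hs.1 (constantsOn_comp_le G i hg).1
  rw [Fintype.sum_sum_type, Fintype.sum_prod_type] at h0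
  have hV : ∑ v : V, ∑ a : Leg, s (Sum.inl (v, a)) * g (Sum.inl (v, a)) = 0 := by
    refine Finset.sum_eq_zero fun v _ => ?_
    have hgv : ∀ a, g (Sum.inl (v, a)) = g (Sum.inl (v, 0)) := fun a =>
      constantsOn_comp_node hg rfl
    simp only [hgv, ← Finset.sum_mul]
    obtain ⟨j, k, hjk, hji, hki⟩ := exists_others i
    have ht : ∀ a, s (Sum.inl (v, a + dir i)) = s (Sum.inl (v, a)) := fun a =>
      hs.2 (Sum.inl (v, a))
    rw [leg_sum _ hji.symm hki.symm hjk]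
    have e1 := ht 0
    have e2 := ht (dir j)
    rw [zero_add] at e1
    have e3 : dir j + dir i = dir k := dir_add_dir hji hjk hki.symm
    rw [e3] at e2
    rw [e1, e2]
    generalize s (Sum.inl (v, 0)) = x, s (Sum.inl (v, dir j)) = y, g (Sum.inl (v, 0)) = z
    revert x y z; decide
  rw [hV, zero_add, Fintype.sum_prod_type, Fintype.sum_sum_type, Fintype.sum_prod_type] at h0
  have hgm : ∀ m u, g (Sum.inr (m, u)) = g (Sum.inr (m, 0)) := fun m u =>
    constantsOn_comp_node hg rfl
  have hroot : ∑ r : Unit, ∑ u : ZMod 2, s (Sum.inr (Sum.inr r, u)) * g (Sum.inr (Sum.inr r, u)) =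
      0 := by
    refine Finset.sum_eq_zero fun r _ => ?_
    have ht := hs.2 (Sum.inr (Sum.inr r, 0))
    simp only [dipoleTurn, zero_add] at ht
    rw [zmod_two_sum, ht, hgm _ 1]
    exact CharTwo.add_self_eq_zero _
  rw [hroot, add_zero] at h0
  have hf : ∀ d, κ d ≠ i → ∑ e : ZMod 2, ∑ u : ZMod 2,
      s (Sum.inr (Sum.inl (d, e), u)) * g (Sum.inr (Sum.inl (d, e), u)) = 0 := by
    intro d hd
    refine Finset.sum_eq_zero fun e _ => ?_
    have ht := hs.2 (Sum.inr (Sum.inl (d, e), 0))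
    simp only [dipoleTurn, hd, if_false, zero_add] at ht
    rw [zmod_two_sum, ht, hgm _ 1]
    exact CharTwo.add_self_eq_zero _
  have hsub := Finset.sum_subtype (p := fun d => κ d = i) (F := inferInstance) (Finset.univ.filter fun d => κ d = i) (by simp)
    (fun d => ∑ e : ZMod 2, ∑ u : ZMod 2,
      s (Sum.inr (Sum.inl (d, e), u)) * g (Sum.inr (Sum.inl (d, e), u)))
  rw [Finset.sum_filter_of_ne fun d _ h => by by_contra hd; exact h (hf d hd), h0] at hsub
  rw [hsub]
  refine Finset.sum_congr rfl fun d _ => ?_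
  have ht : ∀ u, s (Sum.inr (Sum.inl (d.1, 1), u)) = s (Sum.inr (Sum.inl (d.1, 0), u)) := by
    intro u
    have ht := hs.2 (Sum.inr (Sum.inl (d.1, 0), u))
    simp only [dipoleTurn, d.2, if_true, zero_add] at ht
    exact ht
  rw [zmod_two_sum, zmod_two_sum, zmod_two_sum, ht, ht, hgm _ 1, hgm _ 1]
  simp only [levelJump, sideJump, LinearMap.coe_mk, AddHom.coe_mk]
  ring

/-- The number of connected components. -/
noncomputable def numComponents {M : Type} (G : MarkedGraph V M) : ℕ :=
  Nat.card (Quotient G.compSetoid)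

/-- The number of dipoles of colour `i`. -/
def dipoleCount [Fintype D] (κ : D → Fin 3) (i : Fin 3) : ℕ := Fintype.card {d // κ d = i}

theorem sum_dipoleCount [Fintype D] (κ : D → Fin 3) :
    ∑ i, dipoleCount κ i = Fintype.card D := by
  rw [← Fintype.card_congr (Equiv.sigmaFiberEquiv κ), Fintype.card_sigma]
  rfl

/-- The dimension of the space of variations across the dipoles of colour `i` of the functions which
are constant on the components. -/
noncomputable def sideRank (G : MarkedGraph V (Marks D)) (κ : D → Fin 3) (i : Fin 3) : ℕ :=
  finrank (ZMod 2) ((constantsOn G.compSetoid).map (sideJump κ i))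

theorem sideRank_le [Fintype D] (i : Fin 3) :
    G.sideRank κ i ≤ dipoleCount κ i := by
  have := Submodule.finrank_le ((constantsOn G.compSetoid).map (sideJump κ i))
  rwa [Module.finrank_fintype_fun_eq_card] at this

theorem numOrbits_add_two_mul_sideRank_le [Fintype V] [Fintype D] (i : Fin 3) :
    numOrbits G.pair (dipoleTurn κ i) + 2 * G.sideRank κ i ≤
      G.numFaces i + dipoleCount κ i := by
  have hA := finrank_map_add_finrank_inf_ker (invariants G.pair (dipoleTurn κ i)) (levelJump κ i)
  have hB := finrank_map_add_finrank_inf_ker (G.inv i) (sideJump κ i)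
  rw [invariants_inf_ker] at hA
  rw [finrank_invariants] at hA hB
  have hJ : G.sideRank κ i ≤ finrank (ZMod 2) ((G.inv i).map (sideJump κ i)) :=
    Submodule.finrank_mono (Submodule.map_mono (constantsOn_comp_le G i))
  have ho := finrank_add_finrank_le_of_orthogonal
    ((invariants G.pair (dipoleTurn κ i)).map (levelJump κ i))
    ((constantsOn G.compSetoid).map (sideJump κ i)) (by
      rintro _ ⟨s, hs, rfl⟩ _ ⟨g, hg, rfl⟩
      exact sum_levelJump_mul_sideJump hs hg)
  change _ + G.sideRank κ i ≤ dipoleCount κ i at ho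
  change _ = G.numFaces i at hB
  omega

theorem numComponents_le_sum_sideRank [Finite V] [Finite D] (hG : G.DipoleConnected) :
    G.numComponents ≤ ∑ i, G.sideRank κ i + 1 := by
  rw [numComponents, ← finrank_constantsOn]
  set A := constantsOn G.compSetoid
  let Ψ : A →ₗ[ZMod 2] ∀ i, A.map (sideJump κ i) :=
    LinearMap.pi fun i => (sideJump κ i).submoduleMap A
  rw [← LinearMap.finrank_range_add_finrank_ker Ψ]
  refine Nat.add_le_add ?_ ?_
  · refine (Submodule.finrank_le _).trans ?_
    rw [Module.finrank_pi_fintype]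
    rfl
  · refine finrank_le_one ⟨⟨fun _ => 1, fun _ _ _ => rfl⟩, ?_⟩ ?_
    · rw [LinearMap.mem_ker]
      ext i d
      exact CharTwo.add_self_eq_zero _
    · rintro ⟨⟨s, hs⟩, hk⟩
      rw [LinearMap.mem_ker] at hk
      have hc := hG s (fun x => (hs _ _ (Relation.EqvGen.rel _ _ (Or.inl rfl))).symm)
        (fun x y h => constantsOn_comp_node hs h) (fun d => by
          have := congrFun (congrArg Subtype.val (congrFun hk (κ d))) ⟨d, rfl⟩
          exact add_eq_zero_iff_eq_zmod.1 this)
      refine ⟨s (Sum.inr (Sum.inr (), 0)), ?_⟩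
      ext x
      simp [hc (Sum.inr (Sum.inr (), 0)) x]

/-- Cutting the dipoles creates one face for each new component, up to the number of dipoles. -/
theorem sum_numOrbits_add_two_mul_numComponents_le [Fintype V] [Fintype D]
    (hG : G.DipoleConnected) (κ : D → Fin 3) :
    numOrbits G.pair (dipoleTurn κ 0) + numOrbits G.pair (dipoleTurn κ 1) +
      numOrbits G.pair (dipoleTurn κ 2) + 2 * G.numComponents ≤
      G.numFaces 0 + G.numFaces 1 + G.numFaces 2 + Fintype.card D + 2 := by
  have h0 := numOrbits_add_two_mul_sideRank_le (G := G) (κ := κ) 0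
  have h1 := numOrbits_add_two_mul_sideRank_le (G := G) (κ := κ) 1
  have h2 := numOrbits_add_two_mul_sideRank_le (G := G) (κ := κ) 2
  have h := numComponents_le_sum_sideRank (κ := κ) hG
  have hm := sum_dipoleCount κ
  rw [Fin.sum_univ_three] at h hm
  omega

theorem numComponents_le [Fintype V] [Fintype D] (hG : G.DipoleConnected) :
    G.numComponents ≤ Fintype.card D + 1 := by
  -- any colouring of the dipoles serves here
  have h := numComponents_le_sum_sideRank (κ := fun _ => 0) hG
  have hm := sum_dipoleCount (fun _ : D => 0)
  have hs := Finset.sum_le_sum fun i (_ : i ∈ Finset.univ) =>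
    sideRank_le (G := G) (κ := fun _ : D => 0) i
  omega

end MarkedGraph
end QuarticMultiMatrix

namespace QuarticMultiMatrix
open Module

/-! ### Connected components -/

namespace MarkedGraph
section components
variable {V M : Type} (G : MarkedGraph V M)

/-- The component of a half-edge. -/
abbrev comp (x : Ends V M) : Quotient G.compSetoid := Quotient.mk _ x

theorem comp_pair (x : Ends V M) : G.comp (G.pair x) = G.comp x :=
  Quotient.sound (Relation.EqvGen.symm _ _ (Relation.EqvGen.rel _ _ (Or.inl rfl)))

theorem comp_eq_of_node {x y : Ends V M} (h : node x = node y) : G.comp x = G.comp y :=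
  Quotient.sound (Relation.EqvGen.rel _ _ (Or.inr h))

theorem comp_inl (v : V) (a b : Leg) : G.comp (Sum.inl (v, a)) = G.comp (Sum.inl (v, b)) :=
  G.comp_eq_of_node rfl

theorem comp_inr (m : M) (a b : ZMod 2) : G.comp (Sum.inr (m, a)) = G.comp (Sum.inr (m, b)) :=
  G.comp_eq_of_node rfl

variable (q : Quotient G.compSetoid)

/-- The bubbles of a component. -/
abbrev CompBubble : Type := {v : V // G.comp (Sum.inl (v, 0)) = q}

/-- The marks of a component. -/
abbrev CompMark : Type := {m : M // G.comp (Sum.inr (m, 0)) = q}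

variable {G q} in
/-- The inclusion of the half-edges of a component. -/
def lift : Ends (G.CompBubble q) (G.CompMark q) → Ends V M
  | Sum.inl p => Sum.inl (p.1, p.2)
  | Sum.inr p => Sum.inr (p.1, p.2)

variable {G q} in
/-- The half-edges of a component. -/
def lower : ∀ x, G.comp x = q → Ends (G.CompBubble q) (G.CompMark q)
  | Sum.inl p, h => Sum.inl (⟨p.1, (G.comp_inl _ _ _).trans h⟩, p.2)
  | Sum.inr p, h => Sum.inr (⟨p.1, (G.comp_inr _ _ _).trans h⟩, p.2)

variable {G q}

theorem comp_lift (x : Ends (G.CompBubble q) (G.CompMark q)) : G.comp (lift x) = q := by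
  rcases x with ⟨⟨v, hv⟩, a⟩ | ⟨⟨m, hm⟩, b⟩
  · exact (G.comp_inl _ _ _).trans hv
  · exact (G.comp_inr _ _ _).trans hm

theorem lift_lower (x : Ends V M) (h : G.comp x = q) : lift (lower x h) = x := by
  rcases x with p | p <;> rfl

theorem lower_lift (x : Ends (G.CompBubble q) (G.CompMark q)) : lower (lift x) (comp_lift x) = x := by
  rcases x with p | p <;> rfl

theorem lift_injective : Function.Injective (lift (G := G) (q := q)) := by
  intro x y h
  have := lower_lift x
  simp only [h] at this
  exact this.symm.trans (lower_lift y)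

variable (G q) in
/-- A connected component. -/
def component : MarkedGraph (G.CompBubble q) (G.CompMark q) where
  pair x := lower (G.pair (lift x)) ((G.comp_pair _).trans (comp_lift x))
  pair_pair x := lift_injective (by simp only [lift_lower, G.pair_pair])
  tint m := G.tint m.1
  colour_pair x := by
    have h : ∀ y : Ends (G.CompBubble q) (G.CompMark q),
        Sum.elim (fun p : G.CompBubble q × Leg => p.2.1 + p.2.2) (fun p => G.tint p.1.1 + p.2) y =
          G.colour (lift y) := by
      rintro (p | p) <;> rfl
    rw [h, h, lift_lower]
    exact G.colour_pair _

theorem lift_pair (x : Ends (G.CompBubble q) (G.CompMark q)) :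
    lift ((G.component q).pair x) = G.pair (lift x) := lift_lower _ _

theorem connected_component : (G.component q).Connected := by
  classical
  intro s hp hv hm x y
  let S : Ends V M → ZMod 2 := fun z => if h : G.comp z = q then s (lower z h) else 0
  have hS : ∀ z, S (lift z) = s z := fun z => by simp only [S, comp_lift, dif_pos, lower_lift]
  have hnode : ∀ z z' : Ends (G.CompBubble q) (G.CompMark q),
      node (lift z) = node (lift z') → s z = s z' := by
    rintro (⟨v, a⟩ | ⟨m, b⟩) (⟨v', a'⟩ | ⟨m', b'⟩) h
    · obtain rfl : v = v' := Subtype.ext (Sum.inl_injective h)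
      exact hv _ _ _
    · cases h
    · cases h
    · obtain rfl : m = m' := Subtype.ext (Sum.inr_injective h)
      exact hm _ _ _
  rw [← hS, ← hS]
  refine eq_of_eqvGen S ?_ (Quotient.exact ((comp_lift x).trans (comp_lift y).symm))
  intro z z' h
  have hc : G.comp z = G.comp z' := Quotient.sound (Relation.EqvGen.rel _ _ h)
  by_cases hz : G.comp z = q
  · have hz' := hc.symm.trans hz
    simp only [S, hz, hz', dif_pos]
    rcases h with rfl | h
    · rw [← hp]
      congr 1
      apply lift_injective
      simp only [lift_pair, lift_lower]
    · exact hnode _ _ (by simpa only [lift_lower] using h)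
  · simp only [S, hz, hc ▸ hz, dif_neg, not_false_iff]

theorem nonempty_ends_component : Nonempty (Ends (G.CompBubble q) (G.CompMark q)) := by
  obtain ⟨x, rfl⟩ := Quotient.exists_rep q
  exact ⟨lower x rfl⟩

theorem NoDipole.component (h : G.NoDipole) : (G.component q).NoDipole := by
  intro i v w a b hvw h1 h2
  have e1 := lift_pair (G := G) (Sum.inl (v, a))
  have e2 := lift_pair (G := G) (Sum.inl (v, a + dir i))
  rw [h1] at e1
  rw [h2] at e2
  exact h i v.1 w.1 a b (fun e => hvw (Subtype.ext e)) e1.symm e2.symm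

theorem numFaces_le_sum_component [Finite V] [Finite M] [Fintype (Quotient G.compSetoid)]
    (c : Fin 3) : G.numFaces c ≤ ∑ q, (G.component q).numFaces c := by
  let F : (Σ q, Quotient (orbitSetoid (G.component q).pair (turn c))) →
      Quotient (orbitSetoid G.pair (turn c)) := fun z =>
    Quotient.lift (fun x => (orbit G.pair (turn c) (lift x))) (fun _ _ h =>
      eq_of_orbitSetoid (fun x => orbit G.pair (turn c) (lift x))
        (fun x => by rw [lift_pair, orbit_left])
        (fun x => by
          rw [← orbit_right G.pair (turn c) (lift x)]
          rcases x with p | p <;> rfl) h) z.2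
  have hF : Function.Surjective F := by
    intro z
    obtain ⟨x, rfl⟩ := Quotient.exists_rep z
    refine ⟨⟨G.comp x, Quotient.mk _ (lower x rfl)⟩, ?_⟩
    change orbit G.pair (turn c) (lift (lower x rfl)) = _
    rw [lift_lower]
  have := Nat.card_le_card_of_surjective F hF
  rwa [Nat.card_sigma] at this

end components

open Classical in
theorem sum_defect_component_le {V M : Type} [Fintype V] [Fintype M] (G : MarkedGraph V M) :
    ∑ q, (G.component q).defect ≤ 6 * G.numComponents + 3 * Fintype.card V -
      2 * (G.numFaces 0 + G.numFaces 1 + G.numFaces 2 : ℕ) := by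
  have h0 := numFaces_le_sum_component (G := G) 0
  have h1 := numFaces_le_sum_component (G := G) 1
  have h2 := numFaces_le_sum_component (G := G) 2
  have hV : Fintype.card V = ∑ q, Fintype.card (G.CompBubble q) := by
    rw [← Fintype.card_sigma]
    exact Fintype.card_congr (Equiv.sigmaFiberEquiv fun v => G.comp (Sum.inl (v, 0))).symm
  have hQ : G.numComponents = Fintype.card (Quotient G.compSetoid) := Nat.card_eq_fintype_card
  simp only [defect, Finset.sum_sub_distrib, Finset.sum_add_distrib, ← Finset.mul_sum,
    Finset.sum_const, Finset.card_univ, hV, hQ]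
  push_cast
  zify at h0 h1 h2
  simp only [nsmul_eq_mul]
  linarith

section cut
variable {V D : Type} {G : MarkedGraph V (Marks D)}

/-- The component of the root is reached from every component through dipoles, so that every
component has a mark. -/
theorem DipoleConnected.nonempty_compMark (hG : G.DipoleConnected) (q : Quotient G.compSetoid) :
    Nonempty (G.CompMark q) := by
  classical
  by_contra hq
  have hm : ∀ m u, G.comp (Sum.inr (m, u)) ≠ q := fun m u h =>
    hq ⟨⟨m, (G.comp_inr _ _ _).trans h⟩⟩
  obtain ⟨x, rfl⟩ := Quotient.exists_rep q
  have := hG (fun y => if G.comp y = G.comp x then 1 else 0) (fun y => by rw [comp_pair])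
    (fun y z h => by rw [G.comp_eq_of_node h]) (fun d => by rw [if_neg (hm _ _), if_neg (hm _ _)])
    x (Sum.inr (Sum.inr (), 0))
  rw [if_pos rfl, if_neg (hm _ _)] at this
  exact one_ne_zero this

variable {q : Quotient G.compSetoid}

theorem exists_pair_mark [IsEmpty (G.CompBubble q)]
    (hloop : ∀ m, G.pair (Sum.inr (m, 0)) ≠ Sum.inr (m, 1)) (m : G.CompMark q) (u : ZMod 2) :
    ∃ m' : G.CompMark q, m' ≠ m ∧ ∃ u', G.pair (Sum.inr (m.1, u)) = Sum.inr (m'.1, u') := by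
  have hq : G.comp (G.pair (Sum.inr (m.1, u))) = q :=
    (G.comp_pair _).trans ((G.comp_inr _ _ _).trans m.2)
  rcases h : G.pair (Sum.inr (m.1, u)) with ⟨v, a⟩ | ⟨m', u'⟩
  · rw [h] at hq
    exact isEmptyElim (⟨v, (G.comp_inl _ _ _).trans hq⟩ : G.CompBubble q)
  · rw [h] at hq
    refine ⟨⟨m', (G.comp_inr _ _ _).trans hq⟩, ?_, u', rfl⟩
    rintro rfl
    have hne : u' ≠ u := fun e => G.pair_ne _ (h.trans (by subst e; rfl))
    rcases zmod_two_cases u with rfl | rfl <;> rcases zmod_two_cases u' with rfl | rfl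
    · exact hne rfl
    · exact hloop m' h
    · exact hloop m' (by rw [← h, G.pair_pair])
    · exact hne rfl

open Classical in
/-- The contribution of a component to the degree is nonnegative, and positive if the component has
a bubble. -/
theorem excess_component [Fintype V] [Fintype D] (hG : G.DipoleConnected) (hN : G.NoDipole)
    (hloop : ∀ m, G.pair (Sum.inr (m, 0)) ≠ Sum.inr (m, 1)) (q : Quotient G.compSetoid) :
    0 ≤ (G.component q).defect ∧
      2 ≤ 2 * (G.component q).defect + Fintype.card (G.CompMark q) ∧
      (Nonempty (G.CompBubble q) →
        3 ≤ 2 * (G.component q).defect + Fintype.card (G.CompMark q)) := by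
  have := nonempty_ends_component (q := q)
  have hD := defect_nonneg (connected_component (q := q))
  obtain ⟨m⟩ := hG.nonempty_compMark q
  have h1 : 0 < Fintype.card (G.CompMark q) := Fintype.card_pos_iff.2 ⟨m⟩
  have h3 : Nonempty (G.CompBubble q) →
        3 ≤ 2 * (G.component q).defect + Fintype.card (G.CompMark q) := by
    intro hne
    rcases hD.eq_or_lt with h | h
    · have := three_le_card_marks (connected_component (q := q)) h.symm hN.component
      omega
    · omega
  refine ⟨hD, ?_, h3⟩
  rcases isEmpty_or_nonempty (G.CompBubble q) with he | hne
  · obtain ⟨m', hm, -⟩ := exists_pair_mark hloop m 0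
    have : 1 < Fintype.card (G.CompMark q) := Fintype.one_lt_card_iff.2 ⟨m', m, hm⟩
    omega
  · have := h3 hne
    omega

open Classical in
/-- The components which are not a cycle of edges with exactly two marks, or contain the root. -/
noncomputable def badComponents [Finite V] [Finite D] (G : MarkedGraph V (Marks D)) :
    Finset (Quotient G.compSetoid) :=
  have := Fintype.ofFinite (Quotient G.compSetoid)
  Finset.univ.filter fun q => Nonempty (G.CompBubble q) ∨ 3 ≤ Nat.card (G.CompMark q) ∨
    q = G.comp (Sum.inr (Sum.inr (), 0))

theorem mem_badComponents [Finite V] [Finite D] : q ∈ G.badComponents ↔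
    Nonempty (G.CompBubble q) ∨ 3 ≤ Nat.card (G.CompMark q) ∨
      q = G.comp (Sum.inr (Sum.inr (), 0)) := by
  simp [badComponents]

open Classical in
theorem card_badComponents_le [Fintype V] [Fintype D] (hG : G.DipoleConnected) (hN : G.NoDipole)
    (hloop : ∀ m, G.pair (Sum.inr (m, 0)) ≠ Sum.inr (m, 1)) {κ : D → Fin 3} {W : ℕ}
    (hW : (6 + 3 * Fintype.card V + 4 * Fintype.card D : ℤ) -
      2 * (numOrbits G.pair (dipoleTurn κ 0) + numOrbits G.pair (dipoleTurn κ 1) +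
        numOrbits G.pair (dipoleTurn κ 2) : ℕ) ≤ W) :
    (∀ q, (G.component q).defect ≤ W) ∧ G.badComponents.card ≤ 2 * W ∧
      ∑ q ∈ G.badComponents, Fintype.card (G.CompMark q) ≤ 6 * W := by
  have hex := excess_component hG hN hloop
  have hA := sum_numOrbits_add_two_mul_numComponents_le hG κ
  have hB := numComponents_le hG
  have hS := sum_defect_component_le G
  have hQ : G.numComponents = Fintype.card (Quotient G.compSetoid) := Nat.card_eq_fintype_card
  have hM : ∑ q, Fintype.card (G.CompMark q) = 2 * Fintype.card D + 1 := by
    rw [← Fintype.card_sigma,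
      Fintype.card_congr (Equiv.sigmaFiberEquiv fun m => G.comp (Sum.inr (m, 0)))]
    simp only [Marks, Fintype.card_sum, Fintype.card_prod, ZMod.card, Fintype.card_unit]
    ring
  have hdef : ∑ q, (G.component q).defect ≤ W := by
    zify at hA hB
    push_cast at hW hS
    linarith
  let e : Quotient G.compSetoid → ℤ := fun q =>
    2 * (G.component q).defect + Fintype.card (G.CompMark q) - 2
  have he0 : ∀ q, 0 ≤ e q := fun q => by have := (hex q).2.1; simp only [e]; omega
  have he : ∑ q, e q ≤ 2 * W - 1 := by
    simp only [e, Finset.sum_sub_distrib, Finset.sum_add_distrib, ← Finset.mul_sum,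
      Finset.sum_const, Finset.card_univ, ← hQ, nsmul_eq_mul]
    rw [← Nat.cast_sum, hM]
    zify at hA hB
    push_cast at hW hS ⊢
    linarith
  have hbad : ∑ q ∈ G.badComponents, e q ≤ 2 * W - 1 :=
    (Finset.sum_le_univ_sum_of_nonneg he0).trans he
  have hcard : (G.badComponents.card : ℤ) ≤ 2 * W := by
    have h1 : ∑ q ∈ G.badComponents.erase (G.comp (Sum.inr (Sum.inr (), 0))), (1 : ℤ) ≤
        ∑ q ∈ G.badComponents.erase (G.comp (Sum.inr (Sum.inr (), 0))), e q := by
      refine Finset.sum_le_sum fun q hq => ?_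
      obtain ⟨hne, hq⟩ := Finset.mem_erase.1 hq
      have h := hex q
      simp only [e]
      rcases mem_badComponents.1 hq with h' | h' | h'
      · have := h.2.2 h'; omega
      · rw [Nat.card_eq_fintype_card] at h'; omega
      · exact absurd h' hne
    have h2 : ∑ q ∈ G.badComponents.erase (G.comp (Sum.inr (Sum.inr (), 0))), e q ≤
        ∑ q ∈ G.badComponents, e q :=
      Finset.sum_le_sum_of_subset_of_nonneg (Finset.erase_subset _ _) fun q _ _ => he0 q
    rw [Finset.sum_const, Finset.card_erase_of_mem (mem_badComponents.2 (Or.inr (Or.inr rfl))),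
      nsmul_eq_mul, mul_one] at h1
    omega
  refine ⟨fun q => ?_, by exact_mod_cast hcard, ?_⟩
  · exact (Finset.single_le_sum (f := fun q => (G.component q).defect) (fun q _ => (hex q).1)
      (Finset.mem_univ q)).trans hdef
  · have h3 : ∑ q ∈ G.badComponents, (Fintype.card (G.CompMark q) : ℤ) ≤
        ∑ q ∈ G.badComponents, (e q + 2) := by
      refine Finset.sum_le_sum fun q _ => ?_
      have := (hex q).1
      simp only [e]; omega
    rw [Finset.sum_add_distrib, Finset.sum_const, nsmul_eq_mul] at h3
    zify
    linarith

open Classical in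
/-- If the degree is bounded, the number of bubbles outside the dipoles is bounded, and all but a
bounded number of sides of dipoles are joined by two edges to exactly one other side. -/
theorem exists_bad_marks [Fintype V] [Fintype D] (hG : G.DipoleConnected) (hN : G.NoDipole)
    (hloop : ∀ m, G.pair (Sum.inr (m, 0)) ≠ Sum.inr (m, 1)) {κ : D → Fin 3} {W : ℕ}
    (hW : (6 + 3 * Fintype.card V + 4 * Fintype.card D : ℤ) -
      2 * (numOrbits G.pair (dipoleTurn κ 0) + numOrbits G.pair (dipoleTurn κ 1) +
        numOrbits G.pair (dipoleTurn κ 2) : ℕ) ≤ W) :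
    Fintype.card V ≤ 2 * W * bubbleBound W (6 * W) ∧ ∃ B : Finset (Marks D), B.card ≤ 6 * W ∧
      Sum.inr () ∈ B ∧ ∀ m ∉ B, ∃ m' ∉ B, m' ≠ m ∧
        ∀ u, ∃ u', G.pair (Sum.inr (m, u)) = Sum.inr (m', u') := by
  obtain ⟨h1, h2, h3⟩ := card_badComponents_le hG hN hloop hW
  constructor
  · have hV : Fintype.card V = ∑ q, Fintype.card (G.CompBubble q) := by
      rw [← Fintype.card_sigma]
      exact Fintype.card_congr (Equiv.sigmaFiberEquiv fun v => G.comp (Sum.inl (v, 0))).symm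
    have hsub : ∑ q ∈ G.badComponents, Fintype.card (G.CompBubble q) =
        ∑ q, Fintype.card (G.CompBubble q) := by
      refine Finset.sum_subset (Finset.subset_univ _) fun q _ hq => ?_
      rw [Fintype.card_eq_zero_iff]
      exact not_nonempty_iff.1 fun h => hq (mem_badComponents.2 (Or.inl h))
    rw [hV, ← hsub]
    refine (Finset.sum_le_card_nsmul _ _ (bubbleBound W (6 * W)) fun q hq => ?_).trans
      (Nat.mul_le_mul_right _ h2)
    rcases isEmpty_or_nonempty (G.CompBubble q) with he | hne
    · rw [Fintype.card_eq_zero]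
      exact Nat.zero_le _
    · refine (card_le_bubbleBound connected_component hN.component (h1 q)).trans
        (bubbleBound_mono le_rfl ?_)
      exact (Finset.single_le_sum (f := fun q => Fintype.card (G.CompMark q))
        (fun _ _ => Nat.zero_le _) hq).trans h3
  · refine ⟨Finset.univ.filter fun m => G.comp (Sum.inr (m, 0)) ∈ G.badComponents, ?_, ?_, ?_⟩
    · refine le_trans (le_of_eq ?_) h3
      refine (Finset.card_eq_sum_card_fiberwise (t := G.badComponents)
        (f := fun m => G.comp (Sum.inr (m, 0))) fun m hm => (Finset.mem_filter.1 hm).2).trans ?_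
      refine Finset.sum_congr rfl fun q hq => ?_
      rw [Fintype.card_subtype, Finset.filter_filter]
      congr 1
      ext m
      simp only [Finset.mem_filter, Finset.mem_univ, true_and, and_iff_right_iff_imp]
      rintro rfl
      exact hq
    · simp only [Finset.mem_filter, Finset.mem_univ, true_and]
      exact mem_badComponents.2 (Or.inr (Or.inr rfl))
    · intro m hm
      simp only [Finset.mem_filter, Finset.mem_univ, true_and] at hm
      have hq := hm
      rw [mem_badComponents, not_or, not_or, not_nonempty_iff] at hq
      obtain ⟨he, h3, -⟩ := hq
      rw [Nat.card_eq_fintype_card] at h3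
      obtain ⟨m', hne, u', hu'⟩ := exists_pair_mark hloop
        (⟨m, rfl⟩ : G.CompMark (G.comp (Sum.inr (m, 0)))) 0
      refine ⟨m'.1, ?_, fun e => hne (Subtype.ext e), fun u => ?_⟩
      · simp only [Finset.mem_filter, Finset.mem_univ, true_and, m'.2]
        exact hm
      · obtain ⟨m'', hne', u'', hu''⟩ := exists_pair_mark hloop
          (⟨m, rfl⟩ : G.CompMark (G.comp (Sum.inr (m, 0)))) u
        obtain rfl : m' = m'' := by
          by_contra hmm
          exact h3 (Fintype.two_lt_card_iff.2 ⟨_, _, _, hne.symm, hne'.symm, hmm⟩)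
        exact ⟨u'', hu''⟩

end cut
end MarkedGraph
end QuarticMultiMatrix

namespace QuarticMultiMatrix
open Module

/-! ### Dipoles -/

/-- The multiple `s • dir i`, the displacement along the edge of colour `i` of a tetrahedral bubble
for `s = 1`. -/
def shift (i : Fin 3) (s : ZMod 2) : Leg := if s = 0 then 0 else dir i

theorem shift_zero (i : Fin 3) : shift i 0 = 0 := rfl

theorem shift_one (i : Fin 3) : shift i 1 = dir i := rfl

theorem add_shift_add_one (i : Fin 3) (s : ZMod 2) (a : Leg) :
    a + shift i (s + 1) = a + shift i s + dir i := by revert i s a; decide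

theorem ne_of_add_shift_add_dir {i c : Fin 3} (h : c ≠ i) (s : ZMod 2) (a : Leg) :
    a + shift i s + dir c ≠ a ∧
      a + shift i s + dir c ≠ a + dir i := by
  revert i c s a; decide

theorem add_shift_injective {i : Fin 3} {s s' : ZMod 2} {a : Leg}
    (h : a + shift i s = a + shift i s') : s = s' := by revert i s s' a; decide

theorem eq_add_shift {i : Fin 3} {a c : Leg} (h : ∀ s, c ≠ a + shift i s) :
    c ≠ a ∧ c ≠ a + dir i :=
  ⟨fun e => h 0 (by rw [shift_zero, add_zero, e]), fun e => h 1 (by rw [shift_one, e])⟩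

theorem ne_add_shift {i : Fin 3} {a c : Leg} (h : c ≠ a) (h' : c ≠ a + dir i) (s) :
    c ≠ a + shift i s := by
  rcases MarkedGraph.zmod_two_cases s with rfl | rfl
  · rwa [shift_zero, add_zero]
  · rwa [shift_one]

namespace Graph
open MarkedGraph
variable {C : Graph} {i : Fin 3} {d : Leg → Fin C.n × Leg}

/-- Two tetrahedral bubbles joined by two edges which form a face of colour `i`, seen symmetrically
from both bubbles. -/
def IsTetraDipole (i : Fin 3) (d : Leg → Fin C.n × Leg) (v w : Fin C.n) (a b : Leg) : Prop :=
  v ≠ w ∧ C.kind v = .tetra ∧ C.kind w = .tetra ∧ (∀ s, d (s, 0) = (v, a + shift i s)) ∧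
    (∀ s, d (s, 1) = (w, b + shift i s)) ∧
    (∀ c, c ≠ a → c ≠ a + dir i → C.pair (Sum.inl (v, c)) = Sum.inl (w, c + (a + b))) ∧
    ∀ c, c ≠ b → c ≠ b + dir i → C.pair (Sum.inl (w, c)) = Sum.inl (v, c + (a + b))

theorem isDipole_iff : C.IsDipole i d ↔
    (∃ (v : Fin C.n) (t : Leg), (C.kind v).pillowColour = some i ∧ ∀ a, d a = (v, a + t)) ∨
      ∃ v w a b, IsTetraDipole i d v w a b := by
  refine or_congr Iff.rfl ?_
  constructor
  · rintro ⟨v, w, a, b, hvw, hv, hw, h00, h10, h01, h11, hp⟩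
    refine ⟨v, w, a, b, hvw, hv, hw, ?_, ?_, hp, ?_⟩
    · intro s
      rcases zmod_two_cases s with rfl | rfl
      · rw [h00, shift_zero, add_zero]
      · rw [h10]; rfl
    · intro s
      rcases zmod_two_cases s with rfl | rfl
      · rw [h01, shift_zero, add_zero]
      · rw [h11]; rfl
    · intro c h1 h2
      have e : ∀ (i : Fin 3) (a b c : Leg), c ≠ b → c ≠ b + dir i →
          c + (a + b) ≠ a ∧ c + (a + b) ≠ a + dir i := by decide
      obtain ⟨e1, e2⟩ := e i a b c h1 h2
      have := hp _ e1 e2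
      rw [leg_add_add] at this
      rw [← this, C.pair_pair]
  · rintro ⟨v, w, a, b, hvw, hv, hw, h0, h1, hp, -⟩
    refine ⟨v, w, a, b, hvw, hv, hw, ?_, h0 1, ?_, h1 1, hp⟩
    · rw [h0, shift_zero, add_zero]
    · rw [h1, shift_zero, add_zero]

theorem IsTetraDipole.isDipole {v w a b} (h : IsTetraDipole i d v w a b) : C.IsDipole i d :=
  isDipole_iff.2 (Or.inr ⟨v, w, a, b, h⟩)

theorem IsDipole.fst_eq (h : C.IsDipole i d) (s u : ZMod 2) : (d (s, u)).1 = (d (0, u)).1 := by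
  rcases isDipole_iff.1 h with ⟨v, t, -, hd⟩ | ⟨v, w, a, b, -, -, -, h0, h1, -⟩
  · rw [hd, hd]
  · rcases zmod_two_cases u with rfl | rfl
    · rw [h0, h0]
    · rw [h1, h1]

theorem IsDipole.injective (h : C.IsDipole i d) : Function.Injective d := by
  rcases isDipole_iff.1 h with ⟨v, t, -, hd⟩ | ⟨v, w, a, b, hvw, -, -, h0, h1, -⟩
  · intro x y hxy
    rw [hd, hd] at hxy
    exact add_right_cancel (congrArg Prod.snd hxy)
  · rintro ⟨s, u⟩ ⟨s', u'⟩ hxy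
    rcases zmod_two_cases u with rfl | rfl <;> rcases zmod_two_cases u' with rfl | rfl
    · rw [h0, h0] at hxy
      rw [add_shift_injective (congrArg Prod.snd hxy)]
    · rw [h0, h1] at hxy
      exact absurd (congrArg Prod.fst hxy) hvw
    · rw [h0, h1] at hxy
      exact absurd (congrArg Prod.fst hxy).symm hvw
    · rw [h1, h1] at hxy
      rw [add_shift_injective (congrArg Prod.snd hxy)]

/-- `p` is a half-edge inside the dipole `d`. -/
def Inside (d : Leg → Fin C.n × Leg) (p : Fin C.n × Leg) : Prop :=
  (∃ a, (d a).1 = p.1) ∧ p ∉ Set.range d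

/-- The half-edges inside a dipole exist only if it is made of two tetrahedral bubbles. -/
theorem IsDipole.inside (h : C.IsDipole i d) {p : Fin C.n × Leg} (hp : Inside d p) :
    ∃ v w a b, IsTetraDipole i d v w a b ∧
      ((p.1 = v ∧ p.2 ≠ a ∧ p.2 ≠ a + dir i) ∨ (p.1 = w ∧ p.2 ≠ b ∧ p.2 ≠ b + dir i)) := by
  obtain ⟨⟨⟨s, u⟩, hv⟩, hr⟩ := hp
  rcases isDipole_iff.1 h with ⟨v, t, -, hd⟩ | ⟨v, w, a, b, ht⟩
  · rw [hd] at hv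
    exact absurd ⟨p.2 - t, by rw [hd]; exact Prod.ext hv (sub_add_cancel _ _)⟩ hr
  · refine ⟨v, w, a, b, ht, ?_⟩
    obtain ⟨hvw, -, -, h0, h1, -⟩ := ht
    rcases zmod_two_cases u with rfl | rfl
    · rw [h0] at hv
      exact Or.inl ⟨hv.symm, eq_add_shift fun s e => hr ⟨(s, 0), by rw [h0]; exact Prod.ext hv e.symm⟩⟩
    · rw [h1] at hv
      exact Or.inr ⟨hv.symm, eq_add_shift fun s e => hr ⟨(s, 1), by rw [h1]; exact Prod.ext hv e.symm⟩⟩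

theorem IsTetraDipole.inside_left {v w a b} (h : IsTetraDipole i d v w a b) {c : Leg} (h1 : c ≠ a)
    (h2 : c ≠ a + dir i) : Inside d (v, c) := by
  obtain ⟨hvw, -, -, e0, e1, -⟩ := h
  refine ⟨⟨(0, 0), by rw [e0]⟩, ?_⟩
  rintro ⟨⟨s, u⟩, hs⟩
  rcases zmod_two_cases u with rfl | rfl
  · rw [e0] at hs
    exact ne_add_shift h1 h2 s (congrArg Prod.snd hs).symm
  · rw [e1] at hs
    exact hvw (congrArg Prod.fst hs).symm

theorem IsTetraDipole.inside_right {v w a b} (h : IsTetraDipole i d v w a b) {c : Leg} (h1 : c ≠ b)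
    (h2 : c ≠ b + dir i) : Inside d (w, c) := by
  obtain ⟨hvw, -, -, e0, e1, -⟩ := h
  refine ⟨⟨(0, 1), by rw [e1]⟩, ?_⟩
  rintro ⟨⟨s, u⟩, hs⟩
  rcases zmod_two_cases u with rfl | rfl
  · rw [e0] at hs
    exact hvw (congrArg Prod.fst hs)
  · rw [e1] at hs
    exact ne_add_shift h1 h2 s (congrArg Prod.snd hs).symm

theorem leg_ne_add {i : Fin 3} {a b c : Leg} (h1 : c ≠ a) (h2 : c ≠ a + dir i) :
    c + (a + b) ≠ b ∧ c + (a + b) ≠ b + dir i := by revert i a b c; decide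

theorem IsDipole.pair_inside (h : C.IsDipole i d) {p : Fin C.n × Leg} (hp : Inside d p) :
    ∃ p', C.pair (Sum.inl p) = Sum.inl p' ∧ Inside d p' := by
  obtain ⟨v, w, a, b, ht, hc⟩ := h.inside hp
  obtain ⟨v', c⟩ := p
  rcases hc with ⟨rfl, h1, h2⟩ | ⟨rfl, h1, h2⟩
  · obtain ⟨e1, e2⟩ := leg_ne_add (b := b) h1 h2
    exact ⟨_, ht.2.2.2.2.2.1 c h1 h2, ht.inside_right e1 e2⟩
  · obtain ⟨e1, e2⟩ := leg_ne_add (b := a) h1 h2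
    rw [add_comm b a] at e1 e2
    exact ⟨_, ht.2.2.2.2.2.2 c h1 h2, ht.inside_left e1 e2⟩

theorem colour_tetra (a : Leg) : Interaction.tetra.colour a = a.1 + a.2 := rfl

theorem halfColour_pair (C : Graph) (x : Half C.n) : halfColour Interaction.colour C.kind (C.pair x) =
    halfColour Interaction.colour C.kind x + 1 := zmod_two_add_one_of_ne (C.colour_pair x)

/-- The two legs on the same side of a dipole have opposite colours. -/
theorem IsDipole.colour_eq (h : C.IsDipole i d) (s u : ZMod 2) :
    halfColour Interaction.colour C.kind (Sum.inl (d (s, u))) =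
      halfColour Interaction.colour C.kind (Sum.inl (d (s, 0))) + u := by
  rcases zmod_two_cases u with rfl | rfl
  · rw [add_zero]
  rcases isDipole_iff.1 h with ⟨v, t, hk, hd⟩ | ⟨v, w, a, b, ht⟩
  · rw [hd, hd]
    simp only [halfColour]
    generalize C.kind v = k at *
    have e : ∀ (s : ZMod 2) (t : Leg), ((s, 1) + t : Leg).2 = ((s, 0) + t : Leg).2 + 1 ∧
        ((s, 1) + t : Leg).1 + ((s, 1) + t : Leg).2 =
          ((s, 0) + t : Leg).1 + ((s, 0) + t : Leg).2 + 1 := by decide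
    unfold Interaction.colour
    split_ifs
    · exact (e s t).1
    · exact (e s t).2
  · obtain ⟨hvw, hv, hw, h0, h1, hp, -⟩ := ht
    have e : ∀ i : Fin 3, ∃ x, x ≠ 0 ∧ x ≠ dir i := by decide
    obtain ⟨x, hx0, hxi⟩ := e i
    have := halfColour_pair C (Sum.inl (v, a + x))
    rw [hp (a + x) (by simpa using hx0) (by simpa using hxi), h0, h1] at *
    simp only [halfColour, hv, hw, colour_tetra] at *
    clear * - this
    revert a b x s i; decide

/-- A face of colour `i` goes straight through a dipole of colour `i`. -/
theorem IsDipole.orbit_side (h : C.IsDipole i d) (s u : ZMod 2) :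
    orbit C.pair (C.turn i) (Sum.inl (d (s + 1, u))) = orbit C.pair (C.turn i) (Sum.inl (d (s, u))) := by
  rcases isDipole_iff.1 h with ⟨v, t, hk, hd⟩ | ⟨v, w, a, b, -, hv, hw, h0, h1, -⟩
  · rw [← orbit_right _ _ (Sum.inl (d (s, u))), hd, hd]
    simp only [turn, edge_pillow hk, if_true]
    have e : ((s + 1, u) + t : Leg) = (s, u) + t + (1, 0) := by clear * -; revert s u t; decide
    rw [e]
  · rcases zmod_two_cases u with rfl | rfl
    · rw [← orbit_right _ _ (Sum.inl (d (s, 0))), h0, h0, turn_tetra C hv, add_shift_add_one]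
    · rw [← orbit_right _ _ (Sum.inl (d (s, 1))), h1, h1, turn_tetra C hw, add_shift_add_one]

/-- A face of another colour turns back at a dipole. -/
theorem IsDipole.orbit_level (h : C.IsDipole i d) {c : Fin 3} (hc : c ≠ i) (s u : ZMod 2) :
    orbit C.pair (C.turn c) (Sum.inl (d (s, u + 1))) = orbit C.pair (C.turn c) (Sum.inl (d (s, u))) := by
  rcases isDipole_iff.1 h with ⟨v, t, hk, hd⟩ | ⟨v, w, a, b, -, hv, hw, h0, h1, hp, -⟩
  · rw [← orbit_right _ _ (Sum.inl (d (s, u))), hd, hd]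
    simp only [turn, edge_pillow hk, hc, if_false]
    have e : ((s, u + 1) + t : Leg) = (s, u) + t + (0, 1) := by clear * -; revert s u t; decide
    rw [e]
  · have key : orbit C.pair (C.turn c) (Sum.inl (d (s, 1))) =
        orbit C.pair (C.turn c) (Sum.inl (d (s, 0))) := by
      obtain ⟨e1, e2⟩ := ne_of_add_shift_add_dir hc s a
      rw [← orbit_right _ _ (Sum.inl (d (s, 0))), ← orbit_right _ _ (Sum.inl (d (s, 1))),
        h0, h1, turn_tetra C hv, turn_tetra C hw, ← orbit_left _ _ (Sum.inl (v, _)), hp _ e1 e2]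
      have e : a + shift i s + dir c + (a + b) = b + shift i s + dir c := by
        clear * -; revert a b i c s; decide
      rw [e]
    rcases zmod_two_cases u with rfl | rfl
    · exact key
    · exact key.symm

/-- The half-edges inside a dipole lie on a single face of its colour. -/
theorem IsDipole.orbit_inside (h : C.IsDipole i d) {p p' : Fin C.n × Leg} (hp : Inside d p)
    (hp' : Inside d p') :
    orbit C.pair (C.turn i) (Sum.inl p) = orbit C.pair (C.turn i) (Sum.inl p') := by
  obtain ⟨v, w, a, b, ht, hc⟩ := h.inside hp
  have h' := hp'
  obtain ⟨⟨⟨s, u⟩, hs⟩, hr⟩ := hp'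
  obtain ⟨hvw, hv, hw, h0, h1, hl, hr'⟩ := ht
  have e : ∀ (i : Fin 3) (a b c : Leg), ¬(a = b ∨ a = b + dir i) → ¬(c = b ∨ c = b + dir i) →
      a = c ∨ a = c + dir i := by decide
  have same : ∀ (x : Fin C.n) (y c c' : Leg), C.kind x = .tetra → c ≠ y → c ≠ y + dir i → c' ≠ y →
      c' ≠ y + dir i → orbit C.pair (C.turn i) (Sum.inl (x, c)) =
        orbit C.pair (C.turn i) (Sum.inl (x, c')) := by
    intro x y c c' hx g1 g2 g3 g4
    rcases e i c y c' (not_or.2 ⟨g1, g2⟩) (not_or.2 ⟨g3, g4⟩) with rfl | rfl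
    · rfl
    · rw [← turn_tetra C hx, orbit_right]
  -- every half-edge inside is joined to one at the bubble `v`
  have tov : ∀ p : Fin C.n × Leg,
      ((p.1 = v ∧ p.2 ≠ a ∧ p.2 ≠ a + dir i) ∨ (p.1 = w ∧ p.2 ≠ b ∧ p.2 ≠ b + dir i)) →
      ∃ c, c ≠ a ∧ c ≠ a + dir i ∧ orbit C.pair (C.turn i) (Sum.inl p) =
        orbit C.pair (C.turn i) (Sum.inl (v, c)) := by
    rintro ⟨x, c⟩ (⟨rfl, g1, g2⟩ | ⟨rfl, g1, g2⟩)
    · exact ⟨c, g1, g2, rfl⟩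
    · obtain ⟨e1, e2⟩ := leg_ne_add (b := a) g1 g2
      rw [add_comm b a] at e1 e2
      refine ⟨_, e1, e2, ?_⟩
      rw [← hr' c g1 g2, orbit_left]
  have hc' : (p'.1 = v ∧ p'.2 ≠ a ∧ p'.2 ≠ a + dir i) ∨ (p'.1 = w ∧ p'.2 ≠ b ∧ p'.2 ≠ b + dir i) := by
    rcases zmod_two_cases u with rfl | rfl
    · rw [h0] at hs
      exact Or.inl ⟨hs.symm, eq_add_shift fun s e => hr ⟨(s, 0), by rw [h0]; exact Prod.ext hs e.symm⟩⟩
    · rw [h1] at hs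
      exact Or.inr ⟨hs.symm, eq_add_shift fun s e => hr ⟨(s, 1), by rw [h1]; exact Prod.ext hs e.symm⟩⟩
  obtain ⟨c, g1, g2, g3⟩ := tov p hc
  obtain ⟨c', g1', g2', g3'⟩ := tov p' hc'
  rw [g3, g3', same v a c c' hv g1 g2 g1' g2']

/-- Faces of another colour leave a dipole. -/
theorem IsDipole.orbit_inside_of_ne (h : C.IsDipole i d) {c : Fin 3} (hc : c ≠ i)
    {p : Fin C.n × Leg} (hp : Inside d p) :
    ∃ a, orbit C.pair (C.turn c) (Sum.inl p) = orbit C.pair (C.turn c) (Sum.inl (d a)) := by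
  obtain ⟨v, w, a, b, ⟨hvw, hv, hw, h0, h1, -⟩, hx⟩ := h.inside hp
  have e : ∀ (i c : Fin 3) (a x : Leg), c ≠ i → ¬(x = a ∨ x = a + dir i) →
      x + dir c = a + shift i 0 ∨ x + dir c = a + shift i 1 := by decide
  have e : ∀ a x : Leg, x ≠ a → x ≠ a + dir i → ∃ s, x + dir c = a + shift i s := by
    intro a x g1 g2
    rcases e i c a x hc (not_or.2 ⟨g1, g2⟩) with h | h
    exacts [⟨0, h⟩, ⟨1, h⟩]
  obtain ⟨x, y⟩ := p
  rcases hx with ⟨rfl, e1, e2⟩ | ⟨rfl, e1, e2⟩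
  · obtain ⟨s, hs⟩ := e a y e1 e2
    exact ⟨(s, 0), by rw [h0, ← hs, ← turn_tetra C hv, orbit_right]⟩
  · obtain ⟨s, hs⟩ := e b y e1 e2
    exact ⟨(s, 1), by rw [h1, ← hs, ← turn_tetra C hw, orbit_right]⟩

/-- If the two legs on one side of a dipole are joined, the two other ones are those of an elementary
melon. -/
theorem IsDipole.isElementaryMelon (h : C.IsDipole i d) {s : ZMod 2}
    (hs : C.pair (Sum.inl (d (s, 0))) = Sum.inl (d (s, 1))) :
    C.IsElementaryMelon (d (s + 1, 0)) (d (s + 1, 1)) := by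
  rcases isDipole_iff.1 h with ⟨v, t, hk, hd⟩ | ⟨v, w, a, b, hvw, hv, hw, h0, h1, hp, -⟩
  · refine Or.inr ?_
    rw [hd, hd] at *
    refine ⟨rfl, fun e => ?_, ?_, ?_⟩
    · rw [e] at hk; cases hk
    · change ((s + 1, 1) + t : Leg) = (s + 1, 0) + t + (0, 1)
      clear * -; revert s t; decide
    · have e1 : ((s + 1, 0) + t + (1, 0) : Leg) = (s, 0) + t := by clear * -; revert s t; decide
      have e2 : ((s + 1, 0) + t + (1, 1) : Leg) = (s, 1) + t := by clear * -; revert s t; decide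
      simp only [e1, e2, hs]
  · refine Or.inl ?_
    rw [h0, h1] at *
    refine ⟨hvw, hv, hw, fun c hc => ?_⟩
    have e : ∀ (i : Fin 3) (s : ZMod 2) (a c : Leg), c ≠ a + shift i (s + 1) → c = a + shift i s ∨
        (c ≠ a ∧ c ≠ a + dir i) := by decide
    have e' : ∀ (i : Fin 3) (s : ZMod 2) (a b : Leg),
        a + shift i (s + 1) + (b + shift i (s + 1)) = a + b := by decide
    simp only at hc ⊢
    rw [e']
    rcases e i s a c hc with rfl | ⟨g1, g2⟩
    · rw [hs]
      have e : a + shift i s + (a + b) = b + shift i s := by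
        clear * -; revert a b i s; decide
      rw [e]
    · exact hp c g1 g2

end Graph
end QuarticMultiMatrix

namespace QuarticMultiMatrix
open Module

/-! ### Cutting a maximal family of dipoles -/

namespace Graph
open MarkedGraph

/-- Two dipoles have no common bubble. -/
def Apart {n : ℕ} (x y : Fin 3 × (Leg → Fin n × Leg)) : Prop := ∀ a b, (x.2 a).1 ≠ (y.2 b).1

theorem Apart.symm {n : ℕ} {x y : Fin 3 × (Leg → Fin n × Leg)} (h : Apart x y) : Apart y x :=
  fun a b e => h b a e.symm

/-- `T` is a maximal family of dipoles without common bubbles. -/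
structure IsCutFamily (C : Graph) (T : Finset (Fin 3 × (Leg → Fin C.n × Leg))) : Prop where
  isDipole : ∀ x ∈ T, C.IsDipole x.1 x.2
  apart : ∀ x ∈ T, ∀ y ∈ T, x ≠ y → Apart x y
  maximal : ∀ x, C.IsDipole x.1 x.2 → ∃ y ∈ T, ¬ Apart x y

theorem exists_isCutFamily (C : Graph) : ∃ T, C.IsCutFamily T := by
  classical
  let P : Finset (Fin 3 × (Leg → Fin C.n × Leg)) → Prop := fun T =>
    (∀ x ∈ T, C.IsDipole x.1 x.2) ∧ ∀ x ∈ T, ∀ y ∈ T, x ≠ y → Apart x y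
  obtain ⟨T, hT⟩ := (Set.toFinite {T | P T}).exists_maximal ⟨∅, by simp [P]⟩
  refine ⟨T, hT.1.1, hT.1.2, fun x hx => ?_⟩
  by_contra! hc
  have hP : P (insert x T) := by
    constructor
    · intro y hy
      rcases Finset.mem_insert.1 hy with rfl | hy
      exacts [hx, hT.1.1 y hy]
    · intro y hy z hz hyz
      rcases Finset.mem_insert.1 hy with rfl | hy' <;> rcases Finset.mem_insert.1 hz with rfl | hz'
      · exact absurd rfl hyz
      · exact hc z hz'
      · exact (hc y hy').symm
      · exact hT.1.2 y hy' z hz' hyz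
  have hx' : x ∈ T := hT.2 hP (Finset.subset_insert x T) (Finset.mem_insert_self x T)
  exact hc x hx' 0 0 rfl

variable {C : Graph} {T : Finset (Fin 3 × (Leg → Fin C.n × Leg))}

/-- The bubbles outside the dipoles. -/
abbrev Outer (T : Finset (Fin 3 × (Leg → Fin C.n × Leg))) : Type :=
  {v : Fin C.n // ∀ x ∈ T, ∀ a, (x.2 a).1 ≠ v}

/-- The half-edges outside the dipoles: the mark `(x, s)` replaces the side `s` of the dipole `x`. -/
def ext : Ends (Outer T) (Marks T) → Half C.n
  | Sum.inl p => Sum.inl (p.1, p.2)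
  | Sum.inr (Sum.inl x, u) => Sum.inl (x.1.1.2 (x.2, u))
  | Sum.inr (Sum.inr _, u) => Sum.inr u

variable (hT : C.IsCutFamily T)
include hT

theorem IsCutFamily.eq_of_fst_eq {x y : Fin 3 × (Leg → Fin C.n × Leg)} (hx : x ∈ T) (hy : y ∈ T)
    {a b : Leg} (h : (x.2 a).1 = (y.2 b).1) : x = y := by
  by_contra hne
  exact hT.apart x hx y hy hne a b h

theorem IsCutFamily.ext_injective : Function.Injective (ext (T := T)) := by
  rintro (⟨v, a⟩ | ⟨⟨x, s⟩ | r, u⟩) (⟨v', a'⟩ | ⟨⟨x', s'⟩ | r', u'⟩) h <;>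
    simp only [ext, Sum.inl.injEq, Sum.inr.injEq, reduceCtorEq] at h
  · obtain rfl : v = v' := Subtype.ext (congrArg Prod.fst h)
    obtain rfl : a = a' := congrArg Prod.snd h
    rfl
  · exact absurd (congrArg Prod.fst h).symm (v.2 _ x'.2 _)
  · exact absurd (congrArg Prod.fst h) (v'.2 _ x.2 _)
  · obtain rfl : x = x' := Subtype.ext (hT.eq_of_fst_eq x.2 x'.2 (congrArg Prod.fst h))
    obtain ⟨rfl, rfl⟩ := Prod.mk.inj ((hT.isDipole _ x.2).injective h)
    rfl
  · rw [h]

omit hT in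
theorem ext_or_inside (z : Half C.n) :
    (∃ y, ext (T := T) y = z) ∨ ∃ x ∈ T, ∃ p, z = Sum.inl p ∧ Inside x.2 p := by
  rcases z with p | b
  · by_cases h : ∀ x ∈ T, ∀ a, (x.2 a).1 ≠ p.1
    · exact Or.inl ⟨Sum.inl (⟨p.1, h⟩, p.2), rfl⟩
    · push Not at h
      obtain ⟨x, hx, a, ha⟩ := h
      by_cases hr : p ∈ Set.range x.2
      · obtain ⟨b, rfl⟩ := hr
        exact Or.inl ⟨Sum.inr (Sum.inl (⟨x, hx⟩, b.1), b.2), rfl⟩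
      · exact Or.inr ⟨x, hx, p, rfl, ⟨a, ha⟩, hr⟩
  · exact Or.inl ⟨Sum.inr (Sum.inr (), b), rfl⟩

theorem IsCutFamily.not_inside_ext {y : Ends (Outer T) (Marks T)}
    {x : Fin 3 × (Leg → Fin C.n × Leg)} (hx : x ∈ T) {p : Fin C.n × Leg} (h : ext y = Sum.inl p) :
    ¬ Inside x.2 p := by
  rintro ⟨⟨a, ha⟩, hr⟩
  rcases y with ⟨v, b⟩ | ⟨⟨x', s⟩ | r, u⟩ <;> simp only [ext, Sum.inl.injEq, reduceCtorEq] at h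
  · subst h
    exact v.2 x hx a ha
  · subst h
    have := hT.eq_of_fst_eq hx x'.2 ha
    exact hr ⟨(s, u), by rw [this]⟩

theorem IsCutFamily.exists_ext_eq_pair (y : Ends (Outer T) (Marks T)) :
    ∃ y', ext (T := T) y' = C.pair (ext y) := by
  rcases ext_or_inside (T := T) (C.pair (ext y)) with h | ⟨x, hx, p, hp, hi⟩
  · exact h
  · obtain ⟨p', hp', hi'⟩ := (hT.isDipole x hx).pair_inside hi
    rw [← hp, C.pair_pair] at hp'
    exact absurd hi' (hT.not_inside_ext hx hp')

theorem IsCutFamily.kind_outer (v : Outer T) : C.kind v.1 = .tetra := by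
  by_contra hk
  obtain ⟨i, hi⟩ := pillowColour_eq_none hk
  obtain ⟨y, hy, h⟩ := hT.maximal (i, fun a => (v.1, a)) (Or.inl ⟨v.1, 0, hi, fun a => by
    rw [add_zero]⟩)
  refine h fun a b e => v.2 y hy b e.symm

/-- The graph obtained by cutting all the dipoles of a family. -/
noncomputable def IsCutFamily.cut : MarkedGraph (Outer T) (Marks T) where
  pair y := (hT.exists_ext_eq_pair y).choose
  pair_pair y := hT.ext_injective (by
    rw [(hT.exists_ext_eq_pair _).choose_spec, (hT.exists_ext_eq_pair _).choose_spec, C.pair_pair])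
  tint m := halfColour Interaction.colour C.kind (ext (T := T) (Sum.inr (m, 0)))
  colour_pair y := by
    have h : ∀ y : Ends (Outer T) (Marks T), Sum.elim (fun p : Outer T × Leg => p.2.1 + p.2.2)
        (fun q => halfColour Interaction.colour C.kind (ext (T := T) (Sum.inr (q.1, 0))) + q.2) y =
          halfColour Interaction.colour C.kind (ext y) := by
      rintro (⟨v, a⟩ | ⟨⟨x, s⟩ | r, u⟩)
      · simp only [Sum.elim_inl, ext, halfColour, hT.kind_outer, colour_tetra]
      · exact ((hT.isDipole _ x.2).colour_eq s u).symm
      · exact zero_add u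
    rw [h, h, (hT.exists_ext_eq_pair _).choose_spec]
    exact C.colour_pair _

theorem IsCutFamily.ext_pair (y : Ends (Outer T) (Marks T)) :
    ext (hT.cut.pair y) = C.pair (ext y) := (hT.exists_ext_eq_pair y).choose_spec

theorem IsCutFamily.numFaces_le (c : Fin 3) : C.numFaces c ≤
    numOrbits hT.cut.pair (dipoleTurn (fun x : T => x.1.1) c) +
      Nat.card {x : T // x.1.1 = c ∧ C.kind (x.1.2 0).1 = .tetra} := by
  classical
  have hin : ∀ x : T, ∃ p, ∀ p', Inside x.1.2 p' →
      Inside x.1.2 p ∧ C.kind (x.1.2 0).1 = .tetra := by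
    rintro ⟨x, hx⟩
    by_cases h : ∃ p, Inside x.2 p
    · obtain ⟨p, hp⟩ := h
      refine ⟨p, fun _ _ => ⟨hp, ?_⟩⟩
      obtain ⟨v, w, a, b, ⟨-, hv, -, h0, -⟩, -⟩ := (hT.isDipole x hx).inside hp
      have := h0 0
      rw [show (x.2 0) = _ from this, hv]
    · exact ⟨x.2 0, fun p' hp' => absurd ⟨p', hp'⟩ h⟩
  choose f hf using hin
  refine numOrbits_le_add ext (fun e => Sum.inl (f e.1)) (fun y => ?_) ?_ fun z => ?_
  · rw [hT.ext_pair, orbit_left]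
  · rintro (⟨v, a⟩ | ⟨⟨x, s⟩ | r, u⟩)
    · simp only [dipoleTurn, ext]
      rw [← turn_tetra C (hT.kind_outer v), orbit_right]
    · simp only [dipoleTurn]
      split_ifs with h
      · subst h
        exact (hT.isDipole _ x.2).orbit_side s u
      · exact (hT.isDipole _ x.2).orbit_level (Ne.symm h) s u
    · exact orbit_right C.pair (C.turn c) (Sum.inr u)
  · rcases ext_or_inside (T := T) z with ⟨y, rfl⟩ | ⟨x, hx, p, rfl, hi⟩
    · exact Or.inl ⟨y, rfl⟩
    · by_cases hc : x.1 = c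
      · subst hc
        obtain ⟨h1, h2⟩ := hf ⟨x, hx⟩ p hi
        exact Or.inr ⟨⟨⟨x, hx⟩, rfl, h2⟩, (hT.isDipole x hx).orbit_inside hi h1⟩
      · obtain ⟨a, ha⟩ := (hT.isDipole x hx).orbit_inside_of_ne (Ne.symm hc) hi
        exact Or.inl ⟨Sum.inr (Sum.inl (⟨x, hx⟩, a.1), a.2), ha⟩

omit hT in
/-- The bubbles of a dipole weigh `4`, plus `2` for a pair of tetrahedral bubbles. -/
theorem IsDipole.sum_weight {i : Fin 3} {d : Leg → Fin C.n × Leg} (h : C.IsDipole i d) :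
    ∑ v ∈ Finset.univ.image (fun a => (d a).1), (C.kind v).weight =
      4 + if C.kind (d 0).1 = .tetra then 2 else 0 := by
  rcases isDipole_iff.1 h with ⟨v, t, hk, hd⟩ | ⟨v, w, a, b, hvw, hv, hw, h0, h1, -⟩
  · have hi : Finset.univ.image (fun a => (d a).1) = {v} := by
      ext x
      simp only [hd, Finset.mem_image, Finset.mem_univ, true_and, exists_const,
        Finset.mem_singleton, eq_comm]
    have hne : C.kind v ≠ .tetra := fun e => by rw [e] at hk; cases hk
    rw [hi, Finset.sum_singleton, hd, if_neg hne, weight_eq_four hne]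
  · have hi : Finset.univ.image (fun a => (d a).1) = {v, w} := by
      ext x
      simp only [Finset.mem_image, Finset.mem_univ, true_and, Finset.mem_insert,
        Finset.mem_singleton]
      constructor
      · rintro ⟨⟨s, u⟩, rfl⟩
        rcases zmod_two_cases u with rfl | rfl
        · exact Or.inl (by rw [h0])
        · exact Or.inr (by rw [h1])
      · rintro (rfl | rfl)
        · exact ⟨(0, 0), by rw [h0]⟩
        · exact ⟨(0, 1), by rw [h1]⟩
    have hd0 : d 0 = (v, a + shift i 0) := h0 0
    rw [hi, Finset.sum_pair hvw, hd0, if_pos hv, hv, hw]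
    rfl

theorem IsCutFamily.sum_weight : ∑ v, (C.kind v).weight =
    3 * Fintype.card (Outer T) +
      ∑ x : T, (4 + if C.kind (x.1.2 0).1 = .tetra then 2 else 0) := by
  classical
  have hsplit := Finset.sum_add_sum_compl (T.biUnion fun x => Finset.univ.image fun a => (x.2 a).1)
    fun v => (C.kind v).weight
  rw [Finset.sum_biUnion] at hsplit
  · rw [← hsplit, add_comm]
    congr 1
    · have h3 : ∀ v ∈ (T.biUnion fun x => Finset.univ.image fun a => (x.2 a).1)ᶜ,
          (C.kind v).weight = 3 := by
        intro v hv
        simp only [Finset.mem_compl, Finset.mem_biUnion, Finset.mem_image, Finset.mem_univ,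
          true_and, not_exists, not_and] at hv
        rw [hT.kind_outer ⟨v, fun x hx a => hv x hx a⟩]
        rfl
      rw [Finset.sum_congr rfl h3, Finset.sum_const, smul_eq_mul, mul_comm, Fintype.card_subtype]
      congr 2
      ext v
      simp
    · rw [← Finset.sum_coe_sort]
      exact Finset.sum_congr rfl fun x _ => IsDipole.sum_weight (hT.isDipole _ x.2)
  · intro x hx y hy hxy
    rw [Function.onFun, Finset.disjoint_left]
    intro v h1 h2
    obtain ⟨a, -, rfl⟩ := Finset.mem_image.1 h1
    obtain ⟨b, -, hb⟩ := Finset.mem_image.1 h2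
    exact hT.apart x hx y hy hxy a b hb.symm

theorem IsCutFamily.le_doubleDegree : (6 + 3 * Fintype.card (Outer T) + 4 * Fintype.card T : ℤ) -
      2 * (numOrbits hT.cut.pair (dipoleTurn (fun x : T => x.1.1) 0) +
        numOrbits hT.cut.pair (dipoleTurn (fun x : T => x.1.1) 1) +
        numOrbits hT.cut.pair (dipoleTurn (fun x : T => x.1.1) 2) : ℕ) ≤ C.doubleDegree := by
  classical
  have h0 := hT.numFaces_le 0
  have h1 := hT.numFaces_le 1
  have h2 := hT.numFaces_le 2
  have hs : Nat.card {x : T // x.1.1 = 0 ∧ C.kind (x.1.2 0).1 = .tetra} +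
      Nat.card {x : T // x.1.1 = 1 ∧ C.kind (x.1.2 0).1 = .tetra} +
      Nat.card {x : T // x.1.1 = 2 ∧ C.kind (x.1.2 0).1 = .tetra} =
      ∑ x : T, if C.kind (x.1.2 0).1 = .tetra then 1 else 0 := by
    simp only [Nat.card_eq_fintype_card, Fintype.card_subtype, Finset.card_filter,
      ← Finset.sum_add_distrib]
    refine Finset.sum_congr rfl fun x _ => ?_
    have h3 : ∀ i : Fin 3, i = 0 ∨ i = 1 ∨ i = 2 := by decide
    rcases h3 x.1.1 with h | h | h <;> simp [h]
  have hw := hT.sum_weight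
  have hd : (∑ x : T, if C.kind (x.1.2 0).1 = .tetra then 2 else 0) =
      2 * ∑ x : T, if C.kind (x.1.2 0).1 = .tetra then 1 else 0 := by
    rw [Finset.mul_sum]
    simp
  rw [Finset.sum_add_distrib, Finset.sum_const, Finset.card_univ, smul_eq_mul, hd] at hw
  rw [doubleDegree, hw]
  omega

theorem IsCutFamily.noDipole : hT.cut.NoDipole := by
  intro i v w a b hvw h1 h2
  have e1 := hT.ext_pair (Sum.inl (v, a))
  have e2 := hT.ext_pair (Sum.inl (v, a + dir i))
  rw [h1] at e1
  rw [h2] at e2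
  have hc : ∀ (i : Fin 3) (a c : Leg), c ≠ a + dir (i + 1) → c ≠ a + dir (i + 1) + dir i →
      c = a ∨ c = a + dir i := by decide
  have ht : IsTetraDipole i (fun x : Leg => if x.2 = 0 then (v.1, a + dir (i + 1) + shift i x.1) else
      (w.1, b + dir (i + 1) + shift i x.1)) v.1 w.1 (a + dir (i + 1)) (b + dir (i + 1)) := by
    have e : ∀ (i : Fin 3) (a b : Leg), a + dir (i + 1) + (b + dir (i + 1)) = a + b := by decide
    have ea : ∀ a b : Leg, a + (a + b) = b := by decide
    have eb : ∀ a b : Leg, b + (a + b) = a := by decide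
    have ed : ∀ a b c : Leg, a + c + (a + b) = b + c := by decide
    have ed' : ∀ a b c : Leg, b + c + (a + b) = a + c := by decide
    refine ⟨fun h => hvw (Subtype.ext h), hT.kind_outer v, hT.kind_outer w, fun s => if_pos rfl,
      fun s => if_neg one_ne_zero, fun c g1 g2 => ?_, fun c g1 g2 => ?_⟩
    · rw [e]
      rcases hc i a c g1 g2 with rfl | rfl
      · rw [ea]; exact e1.symm
      · rw [ed]; exact e2.symm
    · rw [e]
      rcases hc i b c g1 g2 with rfl | rfl
      · rw [eb, ← C.pair_pair (Sum.inl (v.1, a))]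
        exact congrArg C.pair e1
      · rw [ed', ← C.pair_pair (Sum.inl (v.1, _))]
        exact congrArg C.pair e2
  obtain ⟨y, hy, h⟩ := hT.maximal (i, _) ht.isDipole
  refine h fun x z hxz => ?_
  rcases zmod_two_cases x.2 with hx | hx
  · exact v.2 y hy z (hxz.symm.trans (congrArg Prod.fst (if_pos hx)))
  · exact w.2 y hy z (hxz.symm.trans (congrArg Prod.fst (if_neg (by rw [hx]; exact one_ne_zero))))

omit hT in
/-- A set of bubbles which is joined by edges to itself only is empty. -/
theorem isEmpty_of_closed (N : Fin C.n → Prop)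
    (h : ∀ p : Fin C.n × Leg, N p.1 → ∃ p', C.pair (Sum.inl p) = Sum.inl p' ∧ N p'.1) (v : Fin C.n) :
    ¬ N v := by
  intro hv
  let S : Half C.n → Prop := fun z => ∃ u, z.node = some u ∧ N u
  have hS : ∀ x y : Half C.n, y = C.pair x ∨ x.node = y.node → S x = S y := by
    have hp : ∀ x, S x → S (C.pair x) := by
      rintro (p | b) ⟨u, hu, hN⟩
      · obtain ⟨p', hp', hN'⟩ := h p (by
          rw [Option.some_injective _ hu]; exact hN)
        rw [hp']
        exact ⟨p'.1, rfl, hN'⟩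
      · cases hu
    rintro x y (rfl | hxy)
    · exact propext ⟨hp x, fun h => by have := hp _ h; rwa [C.pair_pair] at this⟩
    · simp only [S, hxy]
  have := eq_of_eqvGen S hS (C.connected (Sum.inl (v, 0)) (Sum.inr 0))
  obtain ⟨u, hu, -⟩ : S (Sum.inr 0) := this ▸ ⟨v, rfl, hv⟩
  cases hu

theorem IsCutFamily.pair_mark_ne (hC : ∀ p q, ¬ C.IsElementaryMelon p q) (hn : 0 < C.n)
    (m : Marks T) : hT.cut.pair (Sum.inr (m, 0)) ≠ Sum.inr (m, 1) := by
  intro h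
  have e := hT.ext_pair (Sum.inr (m, 0))
  rw [h] at e
  rcases m with ⟨x, s⟩ | r
  · exact hC _ _ ((hT.isDipole _ x.2).isElementaryMelon e.symm)
  · -- the external ends are joined, so that no bubble is connected to them
    refine isEmpty_of_closed (fun _ => True) (fun p _ => ?_) ⟨0, hn⟩ trivial
    rcases hp : C.pair (Sum.inl p) with p' | b
    · exact ⟨p', rfl, trivial⟩
    · change Sum.inr 1 = C.pair (Sum.inr 0) at e
      exfalso
      have hb : C.pair (Sum.inr b) = Sum.inr (b + 1) := by
        rcases zmod_two_cases b with rfl | rfl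
        · exact e.symm
        · rw [e, C.pair_pair]; rfl
      have := C.pair_pair (Sum.inl p)
      rw [hp, hb] at this
      cases this

theorem IsCutFamily.dipoleConnected : hT.cut.DipoleConnected := by
  classical
  intro s hp hn hd x y
  have hval : ∀ (x : T) (e u : ZMod 2), s (Sum.inr (Sum.inl (x, e), u)) =
      s (Sum.inr (Sum.inl (x, 0), 0)) := by
    intro x e u
    rw [hn (Sum.inr (Sum.inl (x, e), u)) (Sum.inr (Sum.inl (x, e), 0)) rfl]
    rcases zmod_two_cases e with rfl | rfl
    · rfl
    · exact (hd x).symm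
  let N : Option (Fin C.n) → ZMod 2 := fun o => o.elim (s (Sum.inr (Sum.inr (), 0))) fun v =>
    if h : ∃ x : T, ∃ a, (x.1.2 a).1 = v then s (Sum.inr (Sum.inl (h.choose, 0), 0)) else
      if h' : ∀ x ∈ T, ∀ a, (x.2 a).1 ≠ v then s (Sum.inl (⟨v, h'⟩, 0)) else 0
  have hNd : ∀ (x : T) (v : Fin C.n), (∃ a, (x.1.2 a).1 = v) →
      N (some v) = s (Sum.inr (Sum.inl (x, 0), 0)) := by
    rintro x v ⟨a, ha⟩
    have h : ∃ x : T, ∃ a, (x.1.2 a).1 = v := ⟨x, a, ha⟩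
    simp only [N, Option.elim_some, dif_pos h]
    obtain ⟨b, hb⟩ := h.choose_spec
    rw [Subtype.ext (hT.eq_of_fst_eq h.choose.2 x.2 (hb.trans ha.symm))]
  have hext : ∀ y, N (ext y).node = s y := by
    rintro (⟨v, a⟩ | ⟨⟨x, e⟩ | r, u⟩)
    · have h : ¬ ∃ x : T, ∃ a, (x.1.2 a).1 = v := by
        rintro ⟨x, a, ha⟩
        exact v.2 x.1 x.2 a ha
      simp only [N, ext, Half.node, Option.elim_some, dif_neg h]
      rw [dif_pos v.2]
      exact hn _ _ rfl
    · rw [hval]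
      exact hNd x _ ⟨_, rfl⟩
    · exact hn _ _ rfl
  rw [← hext, ← hext]
  refine eq_of_eqvGen (fun z : Half C.n => N z.node) ?_ (C.connected _ _)
  rintro z z' (rfl | h)
  · rcases ext_or_inside (T := T) z with ⟨y, rfl⟩ | ⟨x, hx, p, rfl, hi⟩
    · rw [← hT.ext_pair, hext, hext, hp]
    · obtain ⟨p', hp', hi'⟩ := (hT.isDipole x hx).pair_inside hi
      simp only [hp', Half.node]
      rw [hNd ⟨x, hx⟩ _ hi.1, hNd ⟨x, hx⟩ _ hi'.1]
  · simp only [h]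

end Graph
end QuarticMultiMatrix

namespace QuarticMultiMatrix
open Module

/-! ### Dipoles inside chains -/

namespace Graph
open MarkedGraph
variable {C : Graph}

theorem IsTetraDipole.swap {i : Fin 3} {d : Leg → Fin C.n × Leg} {v w a b}
    (h : IsTetraDipole i d v w a b) : IsTetraDipole i (fun x => d (x + (0, 1))) w v b a := by
  obtain ⟨hvw, hv, hw, h0, h1, hl, hr⟩ := h
  have e0 : ∀ s : ZMod 2, ((s, 0) + (0, 1) : Leg) = (s, 1) := by decide
  have e1 : ∀ s : ZMod 2, ((s, 1) + (0, 1) : Leg) = (s, 0) := by decide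
  refine ⟨hvw.symm, hw, hv, fun s => ?_, fun s => ?_, ?_, ?_⟩
  · change d ((s, 0) + (0, 1)) = _
    rw [e0, h1]
  · change d ((s, 1) + (0, 1)) = _
    rw [e1, h0]
  · rwa [add_comm b a]
  · rwa [add_comm b a]

theorem IsTetraDipole.translate_side {i : Fin 3} {d : Leg → Fin C.n × Leg} {v w a b}
    (h : IsTetraDipole i d v w a b) (s : ZMod 2) :
    IsTetraDipole i (fun x => d (x + (s, 0))) v w (a + shift i s) (b + shift i s) := by
  obtain ⟨hvw, hv, hw, h0, h1, hl, hr⟩ := h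
  have e : ∀ (s s' : ZMod 2) u, ((s', u) + (s, 0) : Leg) = (s' + s, u) := by decide
  have e' : ∀ (i : Fin 3) (s s' : ZMod 2) (a : Leg),
      a + shift i (s' + s) =
        a + shift i s + shift i s' := by decide
  have e2 : ∀ (i : Fin 3) (s : ZMod 2) (a b : Leg),
      a + shift i s + (b + shift i s) = a + b := by decide
  have e3 : ∀ (i : Fin 3) (s : ZMod 2) (a c : Leg), ¬(c = a + shift i s ∨
      c = a + shift i s + dir i) → c ≠ a ∧ c ≠ a + dir i := by decide
  refine ⟨hvw, hv, hw, fun s' => ?_, fun s' => ?_, fun c g1 g2 => ?_, fun c g1 g2 => ?_⟩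
  · change d ((s', 0) + (s, 0)) = _
    rw [e, h0, e']
  · change d ((s', 1) + (s, 0)) = _
    rw [e, h1, e']
  · rw [e2]
    obtain ⟨k1, k2⟩ := e3 i s a c (not_or.2 ⟨g1, g2⟩)
    exact hl c k1 k2
  · rw [e2]
    obtain ⟨k1, k2⟩ := e3 i s b c (not_or.2 ⟨g1, g2⟩)
    exact hr c k1 k2

/-- The legs of a dipole can be relabelled by translations. -/
theorem IsDipole.translate {i : Fin 3} {d : Leg → Fin C.n × Leg} (h : C.IsDipole i d) (τ : Leg) :
    C.IsDipole i (fun a => d (a + τ)) := by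
  rcases isDipole_iff.1 h with ⟨v, t, hk, hd⟩ | ⟨v, w, a, b, ht⟩
  · exact Or.inl ⟨v, τ + t, hk, fun a => (hd _).trans (by rw [add_assoc])⟩
  · obtain ⟨s, u⟩ := τ
    rcases zmod_two_cases u with rfl | rfl
    · exact (ht.translate_side s).isDipole
    · have := (ht.swap.translate_side s).isDipole
      have e : ∀ (s : ZMod 2) (a : Leg), a + (s, 0) + (0, 1) = a + (s, 1) := by decide
      simpa only [e] using this

/-- A dipole which shares a bubble with a pair of tetrahedral bubbles, whose sides are joined to
distinct dipoles, is the same one up to relabelling its legs. -/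
theorem IsTetraDipole.eq_translate {i j : Fin 3} {d d' : Leg → Fin C.n × Leg} {v w w' a b a' b'}
    (h : IsTetraDipole i d v w a b) (h' : IsTetraDipole j d' v w' a' b')
    (h0 : ∀ s, ∃ p, C.pair (Sum.inl (v, a + shift i s)) = Sum.inl p ∧ p.1 ≠ w)
    (h1 : ∀ p p', C.pair (Sum.inl (v, a)) = Sum.inl p → C.pair (Sum.inl (v, a + dir i)) = Sum.inl p' →
      p.1 ≠ p'.1) : j = i ∧ ∃ τ, ∀ x, d' x = d (x + τ) := by
  by_cases hw : w' = w
  · subst hw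
    have key : ∀ (i j : Fin 3) (a a' : Leg), (∀ c, ¬ (c = a' ∨ c = a' + dir j) →
        ¬ (c = a ∨ c = a + dir i)) → j = i ∧ (a' = a + shift i 0 ∨
          a' = a + shift i 1) := by decide
    have hint : ∀ c, ¬ (c = a' ∨ c = a' + dir j) → ¬ (c = a ∨ c = a + dir i) := by
      intro c hc hc'
      rw [not_or] at hc
      have hp := h'.2.2.2.2.2.1 c hc.1 hc.2
      have : ∃ s, c = a + shift i s := by
        rcases hc' with rfl | rfl
        exacts [⟨0, by rw [shift_zero, add_zero]⟩, ⟨1, rfl⟩]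
      obtain ⟨s, rfl⟩ := this
      obtain ⟨p, hp', hne⟩ := h0 s
      rw [hp] at hp'
      exact hne (by rw [← Sum.inl_injective hp'])
    obtain ⟨rfl, ha⟩ := key i j a a' hint
    obtain ⟨s, rfl⟩ : ∃ s, a' = a + shift j s := by
      rcases ha with rfl | rfl
      exacts [⟨0, rfl⟩, ⟨1, rfl⟩]
    have hex : ∀ (j : Fin 3) (a : Leg), ∃ c, ¬ (c = a ∨ c = a + dir j) := by decide
    obtain ⟨c, hc⟩ := hex j (a + shift j s)
    have hc' := hint c hc
    rw [not_or] at hc hc'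
    have hp := h'.2.2.2.2.2.1 c hc.1 hc.2
    rw [h.2.2.2.2.2.1 c hc'.1 hc'.2] at hp
    have hb : c + (a + b) = c + (a + shift j s + b') :=
      congrArg Prod.snd (Sum.inl_injective hp)
    have hb' : b' = b + shift j s := by
      clear * - hb
      revert c a b b' j s; decide
    subst hb'
    refine ⟨rfl, (s, 0), ?_⟩
    have e := h.translate_side s
    rintro ⟨s', u⟩
    rcases zmod_two_cases u with rfl | rfl
    · rw [h'.2.2.2.1, ← e.2.2.2.1]
    · rw [h'.2.2.2.2.1, ← e.2.2.2.2.1]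
  · exfalso
    have key : ∀ (i j : Fin 3) (a a' : Leg), (∀ c, (c = a' ∨ c = a' + dir j) ∨
        (c = a ∨ c = a + dir i)) → ¬ ((a = a' ∨ a = a' + dir j) ∨
          (a + dir i = a' ∨ a + dir i = a' + dir j)) := by decide
    obtain ⟨k1, k2⟩ := not_or.1 <| key i j a a' fun c => by
      by_contra hcc
      obtain ⟨hc, hc'⟩ := not_or.1 hcc
      rw [not_or] at hc hc'
      have hp := h'.2.2.2.2.2.1 c hc.1 hc.2
      rw [h.2.2.2.2.2.1 c hc'.1 hc'.2] at hp
      exact hw (congrArg Prod.fst (Sum.inl_injective hp)).symm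
    rw [not_or] at k1 k2
    exact h1 _ _ (h'.2.2.2.2.2.1 _ k1.1 k1.2) (h'.2.2.2.2.2.1 _ k2.1 k2.2) rfl

theorem IsDipole.eq_translate {i j : Fin 3} {d d' : Leg → Fin C.n × Leg} (h : C.IsDipole i d)
    (h' : C.IsDipole j d')
    (h0 : ∀ s u, ∃ p, C.pair (Sum.inl (d (s, u))) = Sum.inl p ∧ ∀ a, p.1 ≠ (d a).1)
    (h1 : ∀ u p p', C.pair (Sum.inl (d (0, u))) = Sum.inl p →
      C.pair (Sum.inl (d (1, u))) = Sum.inl p' → p.1 ≠ p'.1)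
    {x y : Leg} (hxy : (d x).1 = (d' y).1) : j = i ∧ ∃ τ, ∀ x, d' x = d (x + τ) := by
  rcases isDipole_iff.1 h with ⟨v, t, hk, hd⟩ | ⟨v, w, a, b, ht⟩
  · rcases isDipole_iff.1 h' with ⟨v', t', hk', hd'⟩ | ⟨v', w', a', b', -, hv', hw', h0', h1', -⟩
    · rw [hd, hd'] at hxy
      obtain rfl : v = v' := hxy
      rw [hk] at hk'
      refine ⟨(Option.some_injective _ hk').symm, t' - t, fun x => ?_⟩
      rw [hd, hd', add_assoc, sub_add_cancel]
    · exfalso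
      have hv : C.kind v = .tetra := by
        rw [hd] at hxy
        obtain ⟨s, u⟩ := y
        rcases zmod_two_cases u with rfl | rfl
        · rw [h0'] at hxy
          exact (congrArg C.kind hxy).trans hv'
        · rw [h1'] at hxy
          exact (congrArg C.kind hxy).trans hw'
      rw [hv] at hk
      cases hk
  · rcases isDipole_iff.1 h' with ⟨v', t', hk', hd'⟩ | ⟨v', w', a', b', ht'⟩
    · exfalso
      have hv : C.kind v' = .tetra := by
        rw [hd'] at hxy
        obtain ⟨-, hv, hw, h0, h1, -⟩ := ht
        obtain ⟨s, u⟩ := x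
        rcases zmod_two_cases u with rfl | rfl
        · rw [h0] at hxy
          exact (congrArg C.kind hxy).symm.trans hv
        · rw [h1] at hxy
          exact (congrArg C.kind hxy).symm.trans hw
      rw [hv] at hk'
      cases hk'
    · -- up to relabelling, the shared bubble comes first in both dipoles
      have e : ∀ x : Leg, x + (0, 1) + (0, 1) = x := by decide
      have main : ∀ (d d' : Leg → Fin C.n × Leg) (v w a b v' w' a' b'),
          IsTetraDipole i d v w a b → IsTetraDipole j d' v' w' a' b' →
          (∀ s u, ∃ p, C.pair (Sum.inl (d (s, u))) = Sum.inl p ∧ ∀ a, p.1 ≠ (d a).1) →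
          (∀ u p p', C.pair (Sum.inl (d (0, u))) = Sum.inl p →
            C.pair (Sum.inl (d (1, u))) = Sum.inl p' → p.1 ≠ p'.1) → v = v' →
          j = i ∧ ∃ τ, ∀ x, d' x = d (x + τ) := by
        rintro d d' v w a b v' w' a' b' ht ht' h0 h1 rfl
        refine ht.eq_translate ht' (fun s => ?_) fun p p' hp hp' => h1 0 p p' ?_ ?_
        · obtain ⟨p, hp, hne⟩ := h0 s 0
          rw [ht.2.2.2.1] at hp
          refine ⟨p, hp, fun e => hne (0, 1) ?_⟩
          rw [ht.2.2.2.2.1, e]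
        · rw [ht.2.2.2.1, shift_zero, add_zero]; exact hp
        · rw [ht.2.2.2.1]; exact hp'
      have main' : ∀ (d d' : Leg → Fin C.n × Leg) (v w a b v' w' a' b'),
          IsTetraDipole i d v w a b → IsTetraDipole j d' v' w' a' b' →
          (∀ s u, ∃ p, C.pair (Sum.inl (d (s, u))) = Sum.inl p ∧ ∀ a, p.1 ≠ (d a).1) →
          (∀ u p p', C.pair (Sum.inl (d (0, u))) = Sum.inl p →
            C.pair (Sum.inl (d (1, u))) = Sum.inl p' → p.1 ≠ p'.1) → v = v' ∨ v = w' →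
          j = i ∧ ∃ τ, ∀ x, d' x = d (x + τ) := by
        rintro d d' v w a b v' w' a' b' ht ht' h0 h1 (hv | hv)
        · exact main d d' v w a b v' w' a' b' ht ht' h0 h1 hv
        · obtain ⟨hj, τ, hτ⟩ := main d _ v w a b w' v' b' a' ht ht'.swap h0 h1 hv
          refine ⟨hj, τ + (0, 1), fun x => ?_⟩
          have := hτ (x + (0, 1))
          rw [e] at this
          rw [this]
          congr 1
          abel
      have hy : (d' y).1 = v' ∨ (d' y).1 = w' := by
        obtain ⟨s, u⟩ := y
        rcases zmod_two_cases u with rfl | rfl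
        · exact Or.inl (by rw [ht'.2.2.2.1])
        · exact Or.inr (by rw [ht'.2.2.2.2.1])
      have hx : (d x).1 = v ∨ (d x).1 = w := by
        obtain ⟨s, u⟩ := x
        rcases zmod_two_cases u with rfl | rfl
        · exact Or.inl (by rw [ht.2.2.2.1])
        · exact Or.inr (by rw [ht.2.2.2.2.1])
      rcases hx with hx | hx
      · exact main' d d' v w a b v' w' a' b' ht ht' h0 h1 (by rwa [← hx, hxy])
      · have es : ∀ s u : ZMod 2, ((s, u) + (0, 1) : Leg) = (s, u + 1) := by decide
        obtain ⟨hj, τ, hτ⟩ := main' _ d' w v b a v' w' a' b' ht.swap ht' (fun s u => by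
          obtain ⟨p, hp, hne⟩ := h0 s (u + 1)
          exact ⟨p, by rw [es]; exact hp, fun a => hne _⟩) (fun u p p' hp hp' => by
            rw [es] at hp hp'
            exact h1 (u + 1) p p' hp hp') (by rwa [← hx, hxy])
        exact ⟨hj, τ + (0, 1), fun x => by rw [hτ, add_assoc]⟩

/-- A dipole each of whose sides is joined to a side of another dipole, and such that every dipole
which shares a bubble with it is the same one with its legs relabelled. The joined side of the other
dipole is normalised to be its side `0`. -/
structure IsLinked (C : Graph) (x : Fin 3 × (Leg → Fin C.n × Leg)) : Prop where
  isDipole : C.IsDipole x.1 x.2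
  link : ∀ s, ∃ y : Fin 3 × (Leg → Fin C.n × Leg), C.IsDipole y.1 y.2 ∧ Apart x y ∧
    ∀ u, C.pair (Sum.inl (x.2 (s, u))) = Sum.inl (y.2 (0, u))
  eq_translate : ∀ y : Fin 3 × (Leg → Fin C.n × Leg), C.IsDipole y.1 y.2 → ¬ Apart x y →
    ∃ τ, y = (x.1, fun a => x.2 (a + τ))

theorem IsLinked.of_not_apart {x y : Fin 3 × (Leg → Fin C.n × Leg)} (hx : C.IsLinked x)
    (hy : C.IsDipole y.1 y.2) (hxy : ¬ Apart x y) : C.IsLinked y := by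
  obtain ⟨τ, rfl⟩ := hx.eq_translate y hy hxy
  refine ⟨hy, fun s => ?_, fun z hz hyz => ?_⟩
  · obtain ⟨z, hz, hxz, hl⟩ := hx.link (s + τ.1)
    refine ⟨(z.1, fun a => z.2 (a + (0, τ.2))), hz.translate _, fun a b => hxz _ _, fun u => ?_⟩
    have e : ((s, u) + τ : Leg) = (s + τ.1, u + τ.2) := rfl
    have e' : ((0, u) + (0, τ.2) : Leg) = (0, u + τ.2) := by simp
    simp only [e, e', hl]
  · obtain ⟨τ', rfl⟩ := hx.eq_translate z hz fun h => hyz fun a b => h _ _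
    refine ⟨τ' - τ, ?_⟩
    simp only [sub_add_cancel, add_assoc]

theorem IsLinked.inChain {x : Fin 3 × (Leg → Fin C.n × Leg)} (hx : C.IsLinked x) (a : Leg) :
    C.InChain (x.2 a).1 := by
  refine ⟨[x], ⟨by simp, by simpa using hx.isDipole, ?_, by simp, by simp⟩, x, by simp, a, rfl⟩
  rintro y h j d' hd' ⟨a, b, hab⟩
  obtain rfl : x = y := by simpa using h
  obtain ⟨τ, hτ⟩ := hx.eq_translate (j, d') hd' fun h => h a b hab
  obtain rfl : d' = _ := congrArg Prod.snd hτ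
  exact (Equiv.addRight τ).surjective.range_comp x.2

/-- A nonempty set of dipoles cannot be joined to itself only. -/
theorem false_of_closed (S : Fin 3 × (Leg → Fin C.n × Leg) → Prop)
    (hS : ∀ x, S x → C.IsDipole x.1 x.2)
    (h : ∀ x, S x → ∀ a, ∃ y, S y ∧ ∃ b, C.pair (Sum.inl (x.2 a)) = Sum.inl (y.2 b))
    {x : Fin 3 × (Leg → Fin C.n × Leg)} (hx : S x) : False := by
  refine isEmpty_of_closed (fun v => ∃ x, S x ∧ ∃ a, (x.2 a).1 = v) ?_ (x.2 0).1 ⟨x, hx, 0, rfl⟩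
  rintro p ⟨y, hy, hp⟩
  by_cases hr : p ∈ Set.range y.2
  · obtain ⟨a, rfl⟩ := hr
    obtain ⟨z, hz, b, hb⟩ := h y hy a
    exact ⟨_, hb, z, hz, b, rfl⟩
  · obtain ⟨p', hp', hi⟩ := (hS y hy).pair_inside ⟨hp, hr⟩
    exact ⟨p', hp', y, hy, hi.1⟩

variable {T : Finset (Fin 3 × (Leg → Fin C.n × Leg))}

theorem zmod_two_add_add (a b : ZMod 2) : a + b + b = a := by revert a b; decide

/-- If the side `(x, s)` is joined to the side `(y, e)`, the half-edges of both sides are matched by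
an affine bijection. -/
theorem IsCutFamily.exists_link (hT : C.IsCutFamily T) {B : Finset (Marks T)}
    (hroot : Sum.inr () ∈ B) (hB : ∀ m ∉ B, ∃ m' ∉ B, m' ≠ m ∧
      ∀ u, ∃ u', hT.cut.pair (Sum.inr (m, u)) = Sum.inr (m', u')) {x : T} {s : ZMod 2}
    (hx : Sum.inl (x, s) ∉ B) : ∃ (y : T) (e v : ZMod 2), (y, e) ≠ (x, s) ∧
      ∀ u, C.pair (Sum.inl (x.1.2 (s, u))) = Sum.inl (y.1.2 (e, u + v)) := by
  obtain ⟨⟨y, e⟩ | r, hm, hne, hp⟩ := hB _ hx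
  · choose f hf using hp
    have hinj : f 1 ≠ f 0 := fun h => by
      have := (hf 1).trans ((by rw [h]) : _ = _) |>.trans (hf 0).symm
      have := hT.cut.pair_injective this
      simp at this
    refine ⟨y, e, f 0, fun h => hne (by rw [h]), fun u => ?_⟩
    have h := hT.ext_pair (Sum.inr (Sum.inl (x, s), u))
    rw [hf] at h
    have hu : f u = u + f 0 := by
      rcases zmod_two_cases u with rfl | rfl
      · rw [zero_add]
      · rw [zmod_two_add_one_of_ne hinj, add_comm]
    rw [hu] at h
    exact h.symm
  · exact absurd hroot hm

theorem IsCutFamily.isLinked (hT : C.IsCutFamily T) {B : Finset (Marks T)}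
    (hroot : Sum.inr () ∈ B) (hB : ∀ m ∉ B, ∃ m' ∉ B, m' ≠ m ∧
      ∀ u, ∃ u', hT.cut.pair (Sum.inr (m, u)) = Sum.inr (m', u')) {x : T}
    (hx : ∀ s, Sum.inl (x, s) ∉ B) : C.IsLinked x.1 := by
  have hl := fun s => hT.exists_link hroot hB (hx s)
  choose y e v hne hp using hl
  have hp' : ∀ s u, C.pair (Sum.inl ((y s).1.2 (e s, u))) = Sum.inl (x.1.2 (s, u + v s)) := by
    intro s u
    rw [← C.pair_pair (Sum.inl (x.1.2 _)), hp, zmod_two_add_add]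
  have hyx : ∀ s, y s ≠ x := by
    intro s h
    have hes : e s = s + 1 := zmod_two_add_one_of_ne fun h' => hne s (by rw [h, h'])
    refine false_of_closed (fun z => z = x.1) (fun z hz => hz ▸ hT.isDipole _ x.2) ?_ rfl
    rintro z rfl ⟨s', u⟩
    refine ⟨x.1, rfl, ?_⟩
    by_cases hs : s' = s
    · rw [hs, hp, h]
      exact ⟨_, rfl⟩
    · have := hp' s u
      rw [h, hes, ← zmod_two_add_one_of_ne hs] at this
      exact ⟨_, this⟩
  have hyy : y 0 ≠ y 1 := by
    intro h
    have he : e 1 ≠ e 0 := by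
      intro he
      have h1 := hp' 0 0
      rw [h, ← he, hp'] at h1
      have := (hT.isDipole _ x.2).injective (Sum.inl_injective h1)
      exact one_ne_zero (congrArg Prod.fst this)
    refine false_of_closed (fun z => z = x.1 ∨ z = (y 0).1) ?_ ?_ (Or.inl rfl)
    · rintro z (rfl | rfl)
      exacts [hT.isDipole _ x.2, hT.isDipole _ (y 0).2]
    · rintro z (rfl | rfl) ⟨s, u⟩
      · refine ⟨(y 0).1, Or.inr rfl, (e s, u + v s), ?_⟩
        rw [hp]
        rcases zmod_two_cases s with rfl | rfl
        · rfl
        · rw [h]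
      · refine ⟨x.1, Or.inl rfl, ?_⟩
        by_cases hs : s = e 0
        · rw [hs, hp']
          exact ⟨_, rfl⟩
        · have hs' : s = e 1 := by
            rw [zmod_two_add_one_of_ne hs, zmod_two_add_one_of_ne he]
          rw [hs', h, hp']
          exact ⟨_, rfl⟩
  have hap : ∀ s, Apart x.1 (y s).1 := fun s =>
    hT.apart _ x.2 _ (y s).2 fun h => hyx s (Subtype.ext h.symm)
  refine ⟨hT.isDipole _ x.2, fun s => ?_, fun z hz hxz => ?_⟩
  · refine ⟨((y s).1.1, fun a => (y s).1.2 (a + (e s, v s))), (hT.isDipole _ (y s).2).translate _,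
      fun a b => hap s _ _, fun u => ?_⟩
    rw [hp]
    simp
  · simp only [Apart, not_forall, not_not] at hxz
    obtain ⟨a, b, hab⟩ := hxz
    obtain ⟨hj, τ, hτ⟩ := (hT.isDipole _ x.2).eq_translate hz (fun s u => ⟨_, hp s u, fun a h =>
      hap s _ _ h.symm⟩) (fun u p p' h0 h1 h => by
        rw [hp] at h0 h1
        obtain rfl := Sum.inl_injective h0
        obtain rfl := Sum.inl_injective h1
        exact hyy (Subtype.ext (hT.eq_of_fst_eq (y 0).2 (y 1).2 h))) hab
    exact ⟨τ, Prod.ext hj (funext hτ)⟩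

/-- The bound on the number of bubbles which are not in linked dipoles. -/
def unlinkedBound (W : ℕ) : ℕ := 2 * W * MarkedGraph.bubbleBound W (6 * W) + 12 * W

theorem exists_unlinked (hC : ∀ p q, ¬ C.IsElementaryMelon p q) (hn : 0 < C.n) {W : ℕ}
    (hW : C.doubleDegree ≤ W) : ∃ S : Finset (Fin C.n), S.card ≤ unlinkedBound W ∧
      ∀ v ∉ S, ∃ x, C.IsLinked x ∧ ∃ a, (x.2 a).1 = v := by
  obtain ⟨T, hT⟩ := C.exists_isCutFamily
  have hD := hT.le_doubleDegree.trans hW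
  have h := exists_bad_marks hT.dipoleConnected hT.noDipole (hT.pair_mark_ne hC hn) hD
  obtain ⟨hV, B, hcard, hroot, hB⟩ := h
  classical
  let g : Marks T → Finset (Fin C.n) := Sum.elim
    (fun m => {(m.1.1.2 (0, 0)).1, (m.1.1.2 (0, 1)).1}) fun _ => ∅
  have hg : ∀ m, (g m).card ≤ 2 := by
    rintro (m | r)
    · exact Finset.card_le_two
    · simp [g]
  refine ⟨(Finset.univ.filter fun v => ∀ x ∈ T, ∀ a, (x.2 a).1 ≠ v) ∪ B.biUnion g, ?_, ?_⟩
  · refine (Finset.card_union_le _ _).trans (Nat.add_le_add ?_ ?_)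
    · rwa [Fintype.card_subtype] at hV
    · refine (Finset.card_biUnion_le_card_mul _ _ 2 fun m _ => hg m).trans ?_
      omega
  · intro v hv
    simp only [Finset.mem_union, Finset.mem_filter, Finset.mem_univ, true_and, not_or,
      Finset.mem_biUnion, not_exists, not_and] at hv
    obtain ⟨h1, h2⟩ := hv
    push Not at h1
    obtain ⟨x, hx, ⟨s, u⟩, rfl⟩ := h1
    have hgood : ∀ s', (Sum.inl (⟨x, hx⟩, s') : Marks T) ∉ B := by
      intro s' hs'
      have h := h2 _ hs'
      simp only [g, Sum.elim_inl, (hT.isDipole x hx).fst_eq s u, Finset.mem_insert,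
        Finset.mem_singleton, not_or] at h
      rcases zmod_two_cases u with rfl | rfl
      exacts [h.1 rfl, h.2 rfl]
    have hl : C.IsLinked x := hT.isLinked hroot hB hgood
    exact ⟨x, hl, (s, u), rfl⟩

end Graph
end QuarticMultiMatrix

namespace QuarticMultiMatrix

/-! ### Maximal chains and finiteness -/

theorem exists_next_of_isChain {α : Type*} {R : α → α → Prop} : ∀ (l : List α) (w : α),
    List.IsChain R (w :: l) → ∀ z ∈ w :: l, (w :: l).getLast? = some z ∨ ∃ y ∈ w :: l, R z y
  | [], w, _, z, hz => by
    obtain rfl : z = w := by simpa using hz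
    exact Or.inl rfl
  | b :: l, w, h, z, hz => by
    rw [List.isChain_cons_cons] at h
    rcases List.mem_cons.1 hz with rfl | hz
    · exact Or.inr ⟨b, by simp, h.1⟩
    · rw [List.getLast?_cons_cons]
      refine (exists_next_of_isChain l b h.2 z hz).imp id ?_
      rintro ⟨y, hy, hR⟩
      exact ⟨y, List.mem_cons_of_mem _ hy, hR⟩

theorem exists_prev_of_isChain {α : Type*} {R : α → α → Prop} : ∀ (l : List α) (w : α),
    List.IsChain R (w :: l) → ∀ z ∈ w :: l, z = w ∨ ∃ y ∈ w :: l, R y z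
  | [], w, _, z, hz => Or.inl (by simpa using hz)
  | b :: l, w, h, z, hz => by
    rw [List.isChain_cons_cons] at h
    rcases List.mem_cons.1 hz with rfl | hz
    · exact Or.inl rfl
    · rcases exists_prev_of_isChain l b h.2 z hz with rfl | ⟨y, hy, hR⟩
      · exact Or.inr ⟨w, by simp, h.1⟩
      · exact Or.inr ⟨y, List.mem_cons_of_mem _ hy, hR⟩

namespace Graph
open MarkedGraph
variable {C : Graph}

/-- The side `1` of `x` is joined to the side `0` of `y`. -/
def Follows (C : Graph) (x y : Fin 3 × (Leg → Fin C.n × Leg)) : Prop :=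
  ∀ t, C.pair (Sum.inl (x.2 (1, t))) = Sum.inl (y.2 (0, t))

/-- A sequence of dipoles does not close up: otherwise it would be a component without external
ends. -/
theorem not_cyclic {w x : Fin 3 × (Leg → Fin C.n × Leg)} {l : List (Fin 3 × (Leg → Fin C.n × Leg))}
    (hd : ∀ y ∈ w :: l, C.IsDipole y.1 y.2) (hl : List.IsChain C.Follows (w :: l))
    (hx : (w :: l).getLast? = some x)
    {τ : ZMod 2} (hw : ∀ t, C.pair (Sum.inl (x.2 (1, t))) = Sum.inl (w.2 (0, t + τ))) : False := by
  have hxl : x ∈ w :: l := List.mem_of_getLast? hx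
  refine false_of_closed (fun y => y ∈ w :: l) hd ?_ hxl
  rintro y hy ⟨s, t⟩
  rcases zmod_two_cases s with rfl | rfl
  · rcases exists_prev_of_isChain l w hl y hy with rfl | ⟨z, hz, hR⟩
    · refine ⟨x, hxl, (1, t + τ), ?_⟩
      have := hw (t + τ)
      rw [zmod_two_add_add] at this
      rw [← this, C.pair_pair]
    · exact ⟨z, hz, (1, t), by rw [← hR t, C.pair_pair]⟩
  · rcases exists_next_of_isChain l w hl y hy with h | ⟨z, hz, hR⟩
    · rw [hx] at h
      obtain rfl : x = y := Option.some_injective _ h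
      exact ⟨w, by simp, _, hw t⟩
    · exact ⟨z, hz, _, hR t⟩

/-- A maximal chain ends near a bubble which is not in a linked dipole: it could be extended
otherwise. -/
theorem IsMaximalChain.exists_unlinked {S : Finset (Fin C.n)}
    (hS : ∀ v ∉ S, ∃ x, C.IsLinked x ∧ ∃ a, (x.2 a).1 = v)
    {l : List (Fin 3 × (Leg → Fin C.n × Leg))} (hl : C.IsMaximalChain l)
    {x : Fin 3 × (Leg → Fin C.n × Leg)} (hx : l.getLast? = some x) : (x.2 (1, 0)).1 ∈ S ∨
      ∀ p, C.pair (Sum.inl (x.2 (1, 0))) = Sum.inl p → p.1 ∈ S := by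
  by_contra! hc
  obtain ⟨h1, p, hp, h2⟩ := hc
  obtain ⟨⟨hne, hdip, -, hpw, hch⟩, hmax⟩ := hl
  have hxl : x ∈ l := List.mem_of_getLast? hx
  have hlink : C.IsLinked x := by
    obtain ⟨x0, hx0, a, ha⟩ := hS _ h1
    exact hx0.of_not_apart (hdip x hxl) fun h => h _ _ ha
  obtain ⟨z, hz, hxz, hlz⟩ := hlink.link 1
  have hzlink : C.IsLinked z := by
    obtain ⟨x0, hx0, a, ha⟩ := hS _ h2
    rw [hlz] at hp
    obtain rfl := Sum.inl_injective hp
    exact hx0.of_not_apart hz fun h => h _ _ ha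
  have hall : ∀ w ∈ l, Apart w z := by
    intro w hw
    by_contra hwz
    obtain ⟨τ, rfl⟩ := hzlink.eq_translate w (hdip w hw) fun h => hwz h.symm
    obtain ⟨s, u⟩ := τ
    rcases zmod_two_cases s with rfl | rfl
    · -- the chain closes up
      obtain ⟨l1, l2, rfl⟩ := List.append_of_mem hw
      refine not_cyclic (fun y hy => hdip y (List.mem_append_right _ hy))
        (List.isChain_append.1 hch).2.1 (x := x) ?_ (τ := u) fun t => ?_
      · rw [List.getLast?_append_of_ne_nil _ (by simp)] at hx
        exact hx
      · rw [hlz]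
        have e : ((0, t + u) + (0, u) : Leg) = (0, t) := by clear * -; revert t u; decide
        simp only [e]
    · -- the sides `1` of two dipoles would be joined
      have hend : ∀ t, C.pair (Sum.inl (z.2 ((1, t) + (1, u)))) = Sum.inl (x.2 (1, t + u)) := by
        intro t
        have e : ((1, t) + (1, u) : Leg) = (0, t + u) := by clear * -; revert t u; decide
        rw [e, ← hlz, C.pair_pair]
      have hnext : ∀ y ∈ l, ¬ ∀ t, C.pair (Sum.inl (z.2 ((1, t) + (1, u)))) =
          Sum.inl (y.2 (0, t)) := by
        intro y hy h
        have h0 := h 0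
        rw [hend] at h0
        have hxy : x.2 (1, 0 + u) = y.2 (0, 0) := Sum.inl_injective h0
        by_cases hne : x = y
        · subst hne
          exact one_ne_zero (congrArg Prod.fst ((hdip x hxl).injective hxy))
        · have hsymm : Std.Symm fun x y : Fin 3 × (Leg → Fin C.n × Leg) =>
              ∀ a b, (x.2 a).1 ≠ (y.2 b).1 := ⟨fun _ _ h a b e => h b a e.symm⟩
          exact hpw.forall hxl hy hne _ _ (congrArg Prod.fst hxy)
      obtain ⟨l1, l2, rfl⟩ := List.append_of_mem hw
      rcases exists_next_of_isChain l2 _ (List.isChain_append.1 hch).2.1 _ List.mem_cons_self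
        with h | ⟨y, hy, hR⟩
      · rw [List.getLast?_append_of_ne_nil _ (by simp), h] at hx
        obtain rfl := Option.some_injective _ hx
        exact hwz hxz
      · exact hnext y (List.mem_append_right _ hy) hR
  have hext : C.IsChain (l ++ [z]) := by
    refine ⟨by simp, ?_, ?_, ?_, ?_⟩
    · intro y hy
      rcases List.mem_append.1 hy with hy | hy
      · exact hdip y hy
      · obtain rfl : y = z := by simpa using hy
        exact hz
    · intro y hy
      have := congrArg List.length hy
      simp only [List.length_append, List.length_cons, List.length_nil] at this
      exact absurd (List.length_eq_zero_iff.1 (by omega)) hne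
    · refine List.pairwise_append.2 ⟨hpw, by simp, fun w hw y hy => ?_⟩
      obtain rfl : y = z := by simpa using hy
      exact hall w hw
    · refine List.isChain_append.2 ⟨hch, by simp, fun w hw y hy => ?_⟩
      rw [hx] at hw
      obtain rfl : x = w := by simpa using hw
      obtain rfl : z = y := by simpa using hy
      exact hlz
  have := congrArg List.length (hmax _ hext (List.prefix_append l [z]).isInfix)
  simp at this

end Graph

/-- The number of nodes of a scheme of a melon-free graph is bounded in terms of its degree. -/
theorem IsChainReduction.n_le {S : SchemeDiagram} {C : Graph} (h : IsChainReduction S C)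
    (hC : ∀ p q, ¬ C.IsElementaryMelon p q) {W : ℕ} (hW : C.doubleDegree ≤ W) :
    S.n ≤ 8 * Graph.unlinkedBound W + 4 := by
  obtain ⟨φ, -, hpair, -, hbubble, hchain, -⟩ := h
  rcases Nat.eq_zero_or_pos C.n with hn | hn
  · have := Fintype.card_le_of_injective φ φ.injective
    simp only [Half, Fintype.card_sum, Fintype.card_prod, Fintype.card_fin, ZMod.card, hn] at this
    omega
  obtain ⟨N, hN, hlink⟩ := Graph.exists_unlinked hC hn hW
  let Z : Finset (Half C.n) := (N ×ˢ Finset.univ).disjSum Finset.univ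
  have hinl : ∀ p : Fin C.n × Leg, Sum.inl p ∈ Z ↔ p.1 ∈ N := fun p => by simp [Z]
  have hZ : Z.card = 4 * N.card + 2 := by
    simp only [Z, Finset.card_disjSum, Finset.card_product, Finset.card_univ, Fintype.card_prod,
      ZMod.card]
    ring
  have key : ∀ v : Fin S.n, ∃ a, φ (Sum.inl (v, a)) ∈ Z ∪ Z.image C.pair := by
    intro v
    rcases hk : S.kind v with k | ⟨c, ε⟩
    · obtain ⟨u, -, hu, hφ⟩ := hbubble v k hk
      refine ⟨0, Finset.mem_union_left _ ?_⟩
      rw [hφ, hinl]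
      by_contra hc
      obtain ⟨x, hx, a, ha⟩ := hlink u hc
      exact hu (ha ▸ hx.inChain a)
    · obtain ⟨l, d, hl, -, ⟨-, x, hx, hd⟩, hφ⟩ := hchain v c ε hk
      refine ⟨(1, 0), ?_⟩
      rw [hφ, hd, Finset.mem_union]
      rcases hl.exists_unlinked hlink hx with h | h
      · exact Or.inl ((hinl _).2 h)
      · refine Or.inr (Finset.mem_image.2 ⟨C.pair (Sum.inl (x.2 (1, 0))), ?_, C.pair_pair _⟩)
        rcases hp : C.pair (Sum.inl (x.2 (1, 0))) with p | b
        · exact (hinl p).2 (h p hp)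
        · simp [Z]
  choose a ha using key
  have hcard := Finset.card_le_card_of_injOn (s := Finset.univ) (fun v => φ (Sum.inl (v, a v)))
    (fun v _ => ha v) fun v _ w _ h => congrArg Prod.fst (Sum.inl_injective (φ.injective h))
  have h1 := Finset.card_union_le Z (Z.image C.pair)
  have h2 : (Z.image C.pair).card ≤ Z.card := Finset.card_image_le
  rw [Finset.card_univ, Fintype.card_fin] at hcard
  omega

theorem finite_schemeKind : Finite SchemeKind := by
  have hI : Finite Interaction := by
    refine Finite.of_surjective (![.tetra, .pillow1, .pillow2, .pillow3b, .pillow3nb] :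
      Fin 5 → Interaction) fun k => ?_
    cases k
    exacts [⟨0, rfl⟩, ⟨1, rfl⟩, ⟨2, rfl⟩, ⟨3, rfl⟩, ⟨4, rfl⟩]
  refine Finite.of_surjective (Sum.elim SchemeKind.bubble fun p => SchemeKind.chain p.1 p.2 :
    Interaction ⊕ (Option (Fin 3) × ZMod 2) → SchemeKind) fun k => ?_
  rcases k with k | ⟨c, ε⟩
  exacts [⟨Sum.inl k, rfl⟩, ⟨Sum.inr (c, ε), rfl⟩]

theorem finite_schemeDiagram_n_le (N : ℕ) : {S : SchemeDiagram | S.n ≤ N}.Finite := by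
  have := finite_schemeKind
  let f : {S : SchemeDiagram | S.n ≤ N} →
      Σ n : Fin (N + 1), (Fin n → SchemeKind) × (Half n → Half n) := fun S =>
    ⟨⟨S.1.n, Nat.lt_succ_of_le S.2⟩, S.1.kind, S.1.pair⟩
  refine Set.finite_coe_iff.1 (Finite.of_injective f ?_)
  rintro ⟨⟨n, k, p, _, _, _⟩, hS⟩ ⟨⟨n', k', p', _, _, _⟩, hS'⟩ h
  simp only [f, Sigma.mk.injEq, Fin.mk.injEq] at h
  obtain ⟨rfl, h⟩ := h
  obtain ⟨rfl, rfl⟩ := Prod.mk.inj (eq_of_heq h)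
  rfl

end QuarticMultiMatrix

theorem mainTheorem9 (h l : ℕ) : (QuarticMultiMatrix.schemes h l).Finite := by
  refine ((QuarticMultiMatrix.finite_schemeDiagram_n_le
    (8 * QuarticMultiMatrix.Graph.unlinkedBound (2 * h + l) + 4)).image
      (Quotient.mk (QuarticMultiMatrix.Diagram.isoSetoid _))).subset ?_
  rintro s ⟨S, G, rfl, ⟨C, hcore, hred⟩, hh, hl⟩
  refine ⟨S, hred.n_le hcore.2 (hcore.doubleDegree_le.trans ?_), rfl⟩
  rw [G.doubleDegree_eq hh hl]
  push_cast
  exact le_rfl
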